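/- A target arena $\mathcal A=(V,V_P,E,T)$ is a finite directed graph $(V,E)$ that is bipartite between $V_P$ (Protagonist) and $V_N:=V\setminus V_P$ (Nature), with a set of targets $T\subseteq V_P$, such that every $u\in V_N$ has a non-empty set of successors $uE$; we assume $V_N\neq\emptyset$. For a family $\mu=(\mu_u)_{u\in V_N}$ of rational probability distributions $\mu_u$ on $uE$, let $\mathcal A_\mu$ be the Markov decision process with states $V_P\uplus\{\bot\}$, actions $V_N$, and transition probabilities $\delta(q\mid p,a)=\mu_a(q)$ if $(p,a),(a,q)\in E$, $\delta(\bot\mid p,a)=1$ if $(p,a)\notin E$, and $0$ otherwise. For $v\in V_P$ let $\mathrm{Val}^\mu(v)$ be the maximum, over the memoryless deterministic strategies $\sigma:V_P\uplus\{\bot\}\to V_N$, of the probability of eventually reaching $T$ from $v$ in the Markov chain induced by $\sigma$; for $u\in V_N$ let $\mathrm{Val}^\mu(u)=\sum_{v\in uE}\mu_u(v)\mathrm{Val}^\mu(v)$. For $v\in V$ and $W\subseteq V$ write $v\unlhd W$ if for every family $\mu$ of full-support distributions there is $w\in W$ with $\mathrm{Val}^\mu(v)\le\mathrm{Val}^\mu(w)$.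 For a partition $(S_i)_{0\le i\le k}$ of $V$ into non-empty sets let $S_i^+=\bigcup_{j>i}S_j$, $S_i^-=\bigcup_{j<i}S_j$, $D_i=\{v\in S_i\cap V_N : vE\cap S_i^-\ne\emptyset\}$ and $D=\bigcup_{0<i<k}D_i$. It is a drift partition if, for all $i\le k$, $vE\cap S_i^+=\emptyset$ for all $v\in S_i\cap V_P$, and $v\in D$ for all $v\in S_i\cap V_N$ with $vE\cap S_i^+\neq\emptyset$. **Corollary.** Consider the problem: given a target arena $\mathcal A$ (as an adjacency matrix), a non-empty set $W\subseteq V$ and a vertex $v\in V$, does $v\unlhd W$ hold? This problem is decidable and in $\mathsf{coNP}$. Moreover, $v\unlhd W$ fails if and only if there are a drift partition $(S_i)_{0\le i\le k}$ and a simple path $\pi$ from $v$ to $T$ with $\pi\subseteq S_k$, $T\subseteq S_k$ and $W\subseteq S_k^-$; every such pair has size polynomial in the size of the input, and whether a given pair, consisting of a partition $(S_i)_{0\le i\le k}$ of $V$ indexed by $0,\dots,k$ (blocks possibly empty) and a word of vertices, has these properties can be checked in polynomial time by a Turing machine. -/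

import Mathlib

open scoped ENNReal NNReal

noncomputable section

/-! ### Distributions, Markov chains, Markov decision processes -/

/-- Rational probability distributions on a finite set. -/
structure FinDist (S : Type) [Fintype S] where
  prob : S → ℚ≥0
  sum_eq_one : ∑ s, prob s = 1

/-- Full support. -/
def FinDist.FullSupport {S : Type} [Fintype S] (f : FinDist S) : Prop := ∀ s, 0 < f.prob s

/-- Finite Markov chains with set of states `Q`. -/
structure MarkovChain (Q : Type) [Fintype Q] where
  δ : Q → FinDist Q

namespace MarkovChain

variable {Q : Type} [Fintype Q]

/-- The probability `∏_{0 ≤ i < n} δ(p_i, p_{i+1})` of a run `p_0 … p_n`. -/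
def runProb (C : MarkovChain Q) : List Q → ℚ≥0
  | [] => 1
  | [_] => 1
  | p :: q :: ρ => (C.δ p).prob q * C.runProb (q :: ρ)

/-- The runs `q_0 … q_n ∈ (S \ T)^* T` with `n ≥ 1` that start in `q₀`. -/
def untilRuns (q₀ : Q) (S T : Set Q) : Set (List Q) :=
  {ρ | ρ.head? = some q₀ ∧
    ∃ (ρ' : List Q) (t : Q), ρ = ρ' ++ [t] ∧ ρ' ≠ [] ∧ (∀ q ∈ ρ', q ∈ S \ T) ∧ t ∈ T}

open scoped Classical in
/-- The probability of staying in states from `S` until `T` is reached. -/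
def untilProb (C : MarkovChain Q) (q₀ : Q) (S T : Set Q) : ℝ≥0∞ :=
  if q₀ ∈ T then 1 else ∑' ρ : untilRuns q₀ S T, ((C.runProb ρ.1 : ℝ≥0) : ℝ≥0∞)

/-- The probability of eventually reaching `T` from `q₀`. -/
def reachProb (C : MarkovChain Q) (q₀ : Q) (T : Set Q) : ℝ≥0∞ :=
  C.untilProb q₀ Set.univ T

end MarkovChain

/-- Finite Markov decision processes with states `Q`, actions `A` and target states `T`;
`(δ p a).prob q` is `δ(q | p, a)`. -/
structure MDP (Q A : Type) [Fintype Q] where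
  δ : Q → A → FinDist Q
  T : Set Q

/-- The Markov chain induced by a (memoryless deterministic) strategy `σ : Q → A`. -/
def MDP.inducedChain {Q A : Type} [Fintype Q] (M : MDP Q A) (σ : Q → A) : MarkovChain Q where
  δ q := M.δ q (σ q)

/-! ### Target arenas and the never-worse relation -/

/-- Target arenas `(V, V_P, E, T)`; the vertices of Nature are those outside `V_P`. -/
structure TargetArena (V : Type) where
  VP : Set V
  E : V → V → Prop
  T : Set V
  bipartite : ∀ u v, E u v → (u ∈ VP ↔ v ∉ VP)
  T_subset : T ⊆ VP
  exists_succ : ∀ u, u ∉ VP → ∃ v, E u v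

namespace TargetArena

variable {V : Type}

/-- The set `V_N` of the vertices of Nature. -/
def VN (A : TargetArena V) : Set V := A.VPᶜ

/-- The set `uE` of the successors of `u`. -/
def succ (A : TargetArena V) (u : V) : Set V := {v | A.E u v}

lemma succ_mem_VP (A : TargetArena V) (u : A.VN) (v : A.succ u) : (v : V) ∈ A.VP := by
  by_contra h
  exact u.2 ((A.bipartite _ _ v.2).2 h)

variable [Fintype V]

open scoped Classical in
/-- Families `μ = (μ_u)_{u ∈ V_N}` with `μ_u` a distribution on `uE`. -/
def NatureFamily (A : TargetArena V) : Type := ∀ u : A.VN, FinDist (A.succ u)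

open scoped Classical in
/-- All the distributions of the family have full support. -/
def NatureFamily.FullSupport {A : TargetArena V} (μ : A.NatureFamily) : Prop :=
  ∀ u, (μ u).FullSupport

open scoped Classical in
/-- The transition probabilities `δ(q | p, a)` of the MDP given by an arena and a family `μ`.
Its states are `V_P ⊎ {⊥}`, where `⊥` is `none`. -/
def transProb (A : TargetArena V) (μ : A.NatureFamily) :
    Option A.VP → A.VN → Option A.VP → ℚ≥0
  | some p, a, some q =>
      if h : A.E p a ∧ A.E a q then (μ a).prob ⟨q, h.2⟩ else 0
  | some p, a, none => if A.E p a then 0 else 1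
  | none, _, some _ => 0
  | none, _, none => 1

open scoped Classical in
lemma transProb_sum (A : TargetArena V) (μ : A.NatureFamily) (p : Option A.VP) (a : A.VN) :
    ∑ q, A.transProb μ p a q = 1 := by
  rw [Fintype.sum_option]
  cases p with
  | none => simp [transProb]
  | some p =>
    by_cases h : A.E p a
    · rw [← (μ a).sum_eq_one]
      simp only [transProb, h, if_true, true_and, zero_add]
      rw [← Finset.sum_filter_add_sum_filter_not Finset.univ (fun q : A.VP => A.E a q)]
      rw [Finset.sum_eq_zero (s := Finset.univ.filter fun q : A.VP => ¬ A.E a q), add_zero]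
      · refine Finset.sum_bij' (i := fun q hq => ⟨q.1, (Finset.mem_filter.1 hq).2⟩)
          (j := fun v _ => ⟨v.1, A.succ_mem_VP a v⟩) ?_ ?_ ?_ ?_ ?_
        · intro q hq; simp
        · intro v _; exact Finset.mem_filter.2 ⟨Finset.mem_univ _, v.2⟩
        · intro q hq; rfl
        · intro v _; rfl
        · intro q hq
          rw [dif_pos (Finset.mem_filter.1 hq).2]
      · intro q hq
        rw [dif_neg (Finset.mem_filter.1 hq).2]
    · simp [transProb, h]

open scoped Classical in
/-- The MDP induced by an arena and a family `μ`. -/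
def toMDP (A : TargetArena V) (μ : A.NatureFamily) : MDP (Option A.VP) A.VN where
  δ p a := ⟨A.transProb μ p a, A.transProb_sum μ p a⟩
  T := {q | ∃ t : A.VP, q = some t ∧ (t : V) ∈ A.T}

open scoped Classical in
/-- The value of a vertex of Protagonist: the maximum over all strategies of the probability of
reaching `T` in the induced chain (there are finitely many strategies, and at least one if
`V_N` is non-empty). -/
def valP (A : TargetArena V) (μ : A.NatureFamily) (v : A.VP) : ℝ≥0∞ :=
  ⨆ σ : Option A.VP → A.VN, ((A.toMDP μ).inducedChain σ).reachProb (some v) (A.toMDP μ).T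

open scoped Classical in
/-- The value `Val^μ(v)` of a vertex. -/
def val (A : TargetArena V) (μ : A.NatureFamily) (v : V) : ℝ≥0∞ :=
  if h : v ∈ A.VP then A.valP μ ⟨v, h⟩
  else ∑ w : A.succ v,
    (((μ ⟨v, h⟩).prob w : ℝ≥0) : ℝ≥0∞) * A.valP μ ⟨w, A.succ_mem_VP ⟨v, h⟩ w⟩

/-- The never-worse relation `v ⊴ W`. -/
def NeverWorse (A : TargetArena V) (v : V) (W : Set V) : Prop :=
  ∀ μ : A.NatureFamily, μ.FullSupport → ∃ w ∈ W, A.val μ v ≤ A.val μ w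

end TargetArena

/-! ### Drift partitions -/

/-- A partition `(S_i)_{0 ≤ i ≤ k}` is given by the function that maps each vertex to the index of
its block: `S_i` is `layer part i`. -/
def layer {V : Type} {k : ℕ} (part : V → Fin (k + 1)) (i : Fin (k + 1)) : Set V :=
  {u | part u = i}

/-- `S_i^+`, the union of the blocks `S_j` with `i < j`. -/
def layersAbove {V : Type} {k : ℕ} (part : V → Fin (k + 1)) (i : Fin (k + 1)) : Set V :=
  ⋃ j > i, layer part j

/-- `S_i^-`, the union of the blocks `S_j` with `j < i`. -/
def layersBelow {V : Type} {k : ℕ} (part : V → Fin (k + 1)) (i : Fin (k + 1)) : Set V :=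
  ⋃ j < i, layer part j

namespace TargetArena

variable {V : Type}

/-- The set `D` of drift vertices, the union of the `D_i` with `0 < i < k`. -/
def driftVertices (A : TargetArena V) {k : ℕ} (part : V → Fin (k + 1)) : Set V :=
  ⋃ i : Fin (k + 1), ⋃ _ : 0 < i ∧ i < Fin.last k,
    {v | v ∈ layer part i ∩ A.VN ∧ (A.succ v ∩ layersBelow part i).Nonempty}

/-- Drift partitions; surjectivity says that no block is empty. -/
structure IsDriftPartition (A : TargetArena V) {k : ℕ} (part : V → Fin (k + 1)) : Prop where
  surjective : Function.Surjective part
  protagonist : ∀ i, ∀ v ∈ layer part i ∩ A.VP, A.succ v ∩ layersAbove part i = ∅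
  nature : ∀ i, ∀ v ∈ layer part i ∩ A.VN,
    (A.succ v ∩ layersAbove part i).Nonempty → v ∈ A.driftVertices part

/-- Simple paths that start in `v` and end in the target set. -/
structure IsSimplePathToTarget (A : TargetArena V) (v : V) (π : List V) : Prop where
  chain : π.IsChain A.E
  simple : π.Nodup
  head : π.head? = some v
  last : ∃ t ∈ A.T, π.getLast? = some t

end TargetArena

/-- A candidate certificate on the vertex set `V`: an indexed family of `k + 1` pairwise disjoint
blocks covering `V`, and a word of vertices. -/
structure Certificate (V : Type) where
  k : ℕ
  part : V → Fin (k + 1)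
  path : List V

/-- The candidate is a drift partition `(S_i)_{0 ≤ i ≤ k}` together with a simple path `π` from `v`
to `T`, such that `π ⊆ S_k`, `T ⊆ S_k` and `W ⊆ S_k^-`. -/
structure Certificate.IsValid {V : Type} (c : Certificate V) (A : TargetArena V)
    (v : V) (W : Set V) : Prop where
  drift : A.IsDriftPartition c.part
  path_ok : A.IsSimplePathToTarget v c.path
  path_subset : ∀ u ∈ c.path, u ∈ layer c.part (Fin.last c.k)
  target_subset : A.T ⊆ layer c.part (Fin.last c.k)
  W_subset : W ⊆ layersBelow c.part (Fin.last c.k)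

/-! ### Decision problems

A decision problem is a set `L` of yes-instances in a type `α` of instances, which are presented to
machines as words through `enc : α → List Γ`. -/

/-- The problem `L` is decidable. -/
def DecidableProblem {α Γ : Type} [Primcodable Γ] (enc : α → List Γ) (L : Set α) : Prop :=
  ∃ f : List Γ → Bool, Computable f ∧ ∀ a, f (enc a) = true ↔ a ∈ L

/-- The problem `L` is decided by a Turing machine in polynomial time. -/
def InPolyTime {α Γ : Type} (enc : α → List Γ) (L : Set α) : Prop :=
  ∃ f : α → Bool, Nonempty (Turing.TM2ComputableInPolyTime enc Computability.encodeBool f) ∧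
    ∀ a, f a = true ↔ a ∈ L

/-- The encoding of a pair consisting of an instance and an arbitrary word. -/
def encodeWithWord {α Γ Δ : Type} (enc : α → List Γ) (x : α × List Δ) : List (Γ ⊕ Δ) :=
  (enc x.1).map Sum.inl ++ x.2.map Sum.inr

/-- The problem `L` is in NP: there are a polynomial-time decidable relation `R` between instances
and arbitrary words over a finite alphabet, and a polynomial `p`, such that `a ∈ L` if and only if
`R (a, y)` for some word `y` of length at most `p (|a|)`. -/
def InNP {α Γ : Type} (enc : α → List Γ) (L : Set α) : Prop :=
  ∃ (Δ : Type) (_ : Fintype Δ) (R : Set (α × List Δ)) (p : Polynomial ℕ),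
    InPolyTime (encodeWithWord enc) R ∧
    ∀ a, a ∈ L ↔ ∃ y : List Δ, y.length ≤ p.eval (enc a).length ∧ (a, y) ∈ R

/-- The problem `L` is in coNP. -/
def InCoNP {α Γ : Type} (enc : α → List Γ) (L : Set α) : Prop := InNP enc Lᶜ

/-! ### The problem of deciding the never-worse relation -/

/-- Instances: a target arena on the vertices `0, …, n - 1`, a non-empty set `W` and a vertex `v`.
Nature has at least one vertex, so that the induced MDPs have an action. -/
structure NWRInstance where
  n : ℕ
  arena : TargetArena (Fin n)
  VN_nonempty : arena.VN.Nonempty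
  W : Set (Fin n)
  W_nonempty : W.Nonempty
  v : Fin n

open scoped Classical in
/-- An instance is written as `n` rows over the alphabet of the two bits and the separator `none`.
The row of the vertex `u` tells whether `u ∈ V_P`, `u ∈ T`, `u ∈ W`, `u = v`, and goes on with the
row of `u` in the adjacency matrix. -/
def NWRInstance.encode (x : NWRInstance) : List (Option Bool) :=
  (List.ofFn fun u : Fin x.n =>
    [some (decide (u ∈ x.arena.VP)), some (decide (u ∈ x.arena.T)),
      some (decide (u ∈ x.W)), some (decide (u = x.v))] ++
    (List.ofFn fun w : Fin x.n => some (decide (x.arena.E u w))) ++ [none]).flatten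

/-- The problem: does `v ⊴ W` hold? -/
def NWRProblem : Set NWRInstance := {x | x.arena.NeverWorse x.v x.W}

/-- Unary notation, ended by the separator. -/
def unaryWord (m : ℕ) : List (Option Bool) := List.replicate m (some true) ++ [none]

/-- A candidate certificate is written as `k`, followed by the block index of each vertex, followed
by the vertices of the path, all in unary. -/
def Certificate.encode {n : ℕ} (c : Certificate (Fin n)) : List (Option Bool) :=
  unaryWord c.k ++ (List.ofFn fun u => unaryWord (c.part u)).flatten ++
    (c.path.map fun u => unaryWord u).flatten

/-- The encoding of a pair of an instance and a candidate certificate. -/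
def encodeWithCertificate (y : Σ x : NWRInstance, Certificate (Fin x.n)) :
    List (Option Bool ⊕ Option Bool) :=
  y.1.encode.map Sum.inl ++ y.2.encode.map Sum.inr

/-- The problem of checking a candidate certificate. -/
def CertificateCheck : Set (Σ x : NWRInstance, Certificate (Fin x.n)) :=
  {y | y.2.IsValid y.1.arena y.1.v y.1.W}

end

noncomputable section

/-! Why certificates characterise failure. For fixed `μ`, the values are the least nonnegative
solution of the optimality inequalities (`exists_isValue`); this rests on policy improvement
(`MDP.reach_switch`) and on reachability probabilities being least pre-fixed points
(`reachReal_le`).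

Suppose that some full-support `μ` makes every `w ∈ W` strictly worse than `v`. Take as blocks the
level sets of the values below that of `v`, in increasing order, and put everything else into the
top block. Protagonist never has a better successor. The value at a vertex of Nature is an average
with positive weights, so a strictly better successor forces a strictly worse one. Finally, `v`
reaches `T` inside the top block: otherwise the largest value among the vertices reachable there
could be lowered, against leastness (`IsValue.exists_walk`). This gives
`exists_certificate_of_not_neverWorse`.

Conversely, given a certificate, let Nature move with probability close to `1` downwards at drift
vertices and along `π` at the vertices of the path. With error probability `a`, a potential function
bounds the values on `W` by `k * a`, while `v` has value at least `1 - |π| * a`. A small `a`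
separates the two (`not_neverWorse_of_certificate`).

Why certificates are easy to check. Validity is expressed by one fixed first-order formula over
words, whose variables range over numbers up to the length of the word and whose atoms count letters
in prefixes. Nested loops on a stack machine evaluate such a formula in polynomial time
(`WordFormula.inPolyTime`), and its semantics is primitive recursive
(`WordFormula.primrecPred_eval`). The formula also rejects malformed words behind an instance. Hence
it serves as the verifier for coNP, where witnesses are arbitrary words, and in the bounded search
that gives decidability. -/

lemma ENNReal.tsum_list {Q : Type} (F : List Q → ℝ≥0∞) :
    ∑' l, F l = F [] + ∑' q, ∑' l, F (q :: l) := by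
  classical
  rw [ENNReal.tsum_eq_add_tsum_ite [], ← ENNReal.tsum_prod (f := fun q l => F (q :: l))]
  congr 1
  have hinj : Function.Injective (fun p : Q × List Q => p.1 :: p.2) := by
    rintro ⟨a, b⟩ ⟨c, d⟩ h
    simpa using h
  rw [← hinj.tsum_eq]
  · simp
  · intro l hl
    cases l with
    | nil => simp at hl
    | cons a l => exact ⟨(a, l), rfl⟩

/-! ### Reachability probabilities of Markov chains -/

namespace MarkovChain

variable {Q : Type} [Fintype Q]

/-- Transition probabilities as extended nonnegative reals. -/
def step (C : MarkovChain Q) (p q : Q) : ℝ≥0∞ := (((C.δ p).prob q : ℝ≥0) : ℝ≥0∞)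

lemma sum_step (C : MarkovChain Q) (p : Q) : ∑ q, C.step p q = 1 := by
  have h := (C.δ p).sum_eq_one
  have h2 : ∑ q, (((C.δ p).prob q : ℚ≥0) : ℝ≥0) = 1 := by
    rw [← NNRat.cast_sum, h, NNRat.cast_one]
  unfold step
  rw [← ENNReal.ofNNReal_finsetSum, h2, ENNReal.coe_one]

open scoped Classical in
/-- The probability of a run if it visits `T` exactly at its end, and `0` otherwise. -/
def hitWeight (C : MarkovChain Q) (T : Set Q) : List Q → ℝ≥0∞
  | [] => 0
  | [t] => if t ∈ T then 1 else 0
  | p :: q :: ρ => if p ∈ T then 0 else C.step p q * C.hitWeight T (q :: ρ)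

/-- The recursive weight permits induction along the run; this lemma ties it to the explicit
description of runs that meet `T` only at their end. -/
lemma hitWeight_eq_indicator (C : MarkovChain Q) (T : Set Q) (p : Q) (ρ : List Q) :
    C.hitWeight T (p :: ρ) = Set.indicator
      {ρ | ∃ (ρ' : List Q) (t : Q), ρ = ρ' ++ [t] ∧ (∀ q ∈ ρ', q ∉ T) ∧ t ∈ T}
      (fun ρ => ((C.runProb ρ : ℝ≥0) : ℝ≥0∞)) (p :: ρ) := by
  classical
  induction ρ generalizing p with
  | nil =>
    by_cases h : p ∈ T
    · rw [Set.indicator_of_mem]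
      · simp [hitWeight, h, runProb]
      · exact ⟨[], p, by simp [h]⟩
    · rw [Set.indicator_of_notMem]
      · simp [hitWeight, h]
      · rintro ⟨ρ', t, h1, h2, h3⟩
        cases ρ' with
        | nil => simp at h1; exact h (h1 ▸ h3)
        | cons a l => simp at h1
  | cons q ρ ih =>
    have key : (p :: q :: ρ) ∈
        {ρ | ∃ (ρ' : List Q) (t : Q), ρ = ρ' ++ [t] ∧ (∀ q ∈ ρ', q ∉ T) ∧ t ∈ T} ↔
        p ∉ T ∧ (q :: ρ) ∈
          {ρ | ∃ (ρ' : List Q) (t : Q), ρ = ρ' ++ [t] ∧ (∀ q ∈ ρ', q ∉ T) ∧ t ∈ T} := by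
      constructor
      · rintro ⟨ρ', t, h1, h2, h3⟩
        cases ρ' with
        | nil => simp at h1
        | cons a l =>
          simp only [List.cons_append, List.cons.injEq] at h1
          obtain ⟨rfl, h1⟩ := h1
          exact ⟨h2 p (by simp), l, t, h1, fun q hq => h2 q (by simp [hq]), h3⟩
      · rintro ⟨hp, ρ', t, h1, h2, h3⟩
        refine ⟨p :: ρ', t, by simp [h1], ?_, h3⟩
        intro a ha
        rcases List.mem_cons.1 ha with rfl | ha
        · exact hp
        · exact h2 a ha
    rw [hitWeight, ih]
    simp only [Set.indicator_apply, key]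
    by_cases hp : p ∈ T
    · simp [hp]
    · by_cases hq : (q :: ρ) ∈
          {ρ | ∃ (ρ' : List Q) (t : Q), ρ = ρ' ++ [t] ∧ (∀ q ∈ ρ', q ∉ T) ∧ t ∈ T}
      · simp only [hp, hq, if_true, if_false, not_false_iff, true_and, runProb, step]
        push_cast
        rfl
      · simp only [hp, hq, if_false, and_false, mul_zero]

/-- The definition treats a start in `T` separately and otherwise demands at least one transition.
The weight covers both cases: a run from a target counts only if it stops at once, and a run that
stops at once outside `T` has weight `0`. -/
lemma reachProb_eq_tsum (C : MarkovChain Q) (T : Set Q) (p : Q) :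
    C.reachProb p T = ∑' ρ, C.hitWeight T (p :: ρ) := by
  classical
  unfold reachProb untilProb
  by_cases hp : p ∈ T
  · rw [if_pos hp, tsum_eq_single []]
    · simp [hitWeight, hp]
    · intro l hl
      cases l with
      | nil => exact absurd rfl hl
      | cons a l => simp [hitWeight, hp]
  · rw [if_neg hp, tsum_subtype (untilRuns p Set.univ T)
      (fun ρ => ((C.runProb ρ : ℝ≥0) : ℝ≥0∞)), ENNReal.tsum_list]
    have h0 : (untilRuns p Set.univ T).indicator
        (fun ρ => ((C.runProb ρ : ℝ≥0) : ℝ≥0∞)) [] = 0 := by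
      apply Set.indicator_of_notMem
      rintro ⟨h, -⟩
      simp at h
    rw [h0, zero_add, tsum_eq_single p]
    · refine tsum_congr fun ρ => ?_
      rw [hitWeight_eq_indicator, Set.indicator_apply, Set.indicator_apply]
      congr 1
      apply propext
      constructor
      · rintro ⟨-, ρ', t, h1, -, h2, h3⟩
        exact ⟨ρ', t, h1, fun q hq => (h2 q hq).2, h3⟩
      · rintro ⟨ρ', t, h1, h2, h3⟩
        refine ⟨by simp, ρ', t, h1, ?_, fun q hq => ⟨Set.mem_univ _, h2 q hq⟩, h3⟩
        rintro rfl
        simp at h1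
        exact hp (h1.1 ▸ h3)
    · intro q hq
      refine ENNReal.tsum_eq_zero.2 fun ρ => Set.indicator_of_notMem ?_ _
      rintro ⟨h, -⟩
      simp at h
      exact hq h

lemma reachProb_of_mem (C : MarkovChain Q) {T : Set Q} {p : Q} (hp : p ∈ T) :
    C.reachProb p T = 1 := by
  simp [reachProb, untilProb, hp]

lemma reachProb_of_notMem (C : MarkovChain Q) {T : Set Q} {p : Q} (hp : p ∉ T) :
    C.reachProb p T = ∑ q, C.step p q * C.reachProb q T := by
  simp only [reachProb_eq_tsum]
  rw [ENNReal.tsum_list, tsum_fintype]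
  simp [hitWeight, hp, ENNReal.tsum_mul_left]

/-- By induction on `N`, the runs with fewer than `N` transitions contribute at most `x p`: the
first transition reduces the claim to the inequality assumed for `x`. The full sum is the supremum
of its finite parts. -/
lemma reachProb_le (C : MarkovChain Q) {T : Set Q} {x : Q → ℝ≥0∞}
    (hT : ∀ p ∈ T, 1 ≤ x p) (hx : ∀ p ∉ T, ∑ q, C.step p q * x q ≤ x p) (p : Q) :
    C.reachProb p T ≤ x p := by
  classical
  have key : ∀ (N : ℕ) (p : Q),
      ∑' ρ : List Q, (if ρ.length < N then C.hitWeight T (p :: ρ) else 0) ≤ x p := by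
    intro N
    induction N with
    | zero => intro p; simp
    | succ N ih =>
      intro p
      rw [ENNReal.tsum_list, tsum_fintype]
      by_cases hp : p ∈ T
      · simpa [hitWeight, hp] using hT p hp
      · refine le_trans ?_ (hx p hp)
        simp only [List.length_nil, Nat.zero_lt_succ, if_true, hitWeight, hp, if_false, zero_add,
          List.length_cons, Nat.add_lt_add_iff_right]
        refine Finset.sum_le_sum fun q _ => ?_
        refine le_trans (le_of_eq ?_) (mul_le_mul_right (ih q) _)
        rw [← ENNReal.tsum_mul_left]
        refine tsum_congr fun ρ => ?_
        split_ifs <;> simp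
  rw [reachProb_eq_tsum, ENNReal.tsum_eq_iSup_sum]
  refine iSup_le fun s => ?_
  -- A finite set of runs has bounded length, so one value of `N` covers it.
  refine le_trans ?_ (key (s.sup List.length + 1) p)
  refine le_trans (Finset.sum_le_sum fun ρ hρ => ?_) (ENNReal.sum_le_tsum s)
  rw [if_pos (Nat.lt_succ_of_le (Finset.le_sup (f := List.length) hρ))]

lemma reachProb_le_one (C : MarkovChain Q) (T : Set Q) (p : Q) : C.reachProb p T ≤ 1 :=
  C.reachProb_le (x := fun _ => 1) (fun _ _ => le_rfl) (fun p _ => by simp [C.sum_step p]) p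

/-- The real-valued transition probabilities. -/
def stepReal (C : MarkovChain Q) (p q : Q) : ℝ := ((C.δ p).prob q : ℝ)

lemma toReal_step (C : MarkovChain Q) (p q : Q) : (C.step p q).toReal = C.stepReal p q := by
  simp only [step, stepReal, ENNReal.coe_toReal]
  norm_cast

lemma stepReal_nonneg (C : MarkovChain Q) (p q : Q) : 0 ≤ C.stepReal p q := by
  rw [← C.toReal_step]; exact ENNReal.toReal_nonneg

lemma step_eq_ofReal (C : MarkovChain Q) (p q : Q) :
    C.step p q = ENNReal.ofReal (C.stepReal p q) := by
  rw [← C.toReal_step, ENNReal.ofReal_toReal]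
  simp [step]

lemma sum_stepReal (C : MarkovChain Q) (p : Q) : ∑ q, C.stepReal p q = 1 := by
  have h := congrArg ENNReal.toReal (C.sum_step p)
  rw [ENNReal.toReal_sum (fun q _ => by simp [step])] at h
  simpa [toReal_step] using h

/-- The real-valued probability of eventually reaching `T`. -/
def reachReal (C : MarkovChain Q) (T : Set Q) (p : Q) : ℝ := (C.reachProb p T).toReal

lemma ofReal_reachReal (C : MarkovChain Q) (T : Set Q) (p : Q) :
    ENNReal.ofReal (C.reachReal T p) = C.reachProb p T :=
  ENNReal.ofReal_toReal (ne_top_of_le_ne_top ENNReal.one_ne_top (C.reachProb_le_one T p))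

lemma reachReal_nonneg (C : MarkovChain Q) (T : Set Q) (p : Q) : 0 ≤ C.reachReal T p :=
  ENNReal.toReal_nonneg

lemma reachReal_le_one (C : MarkovChain Q) (T : Set Q) (p : Q) : C.reachReal T p ≤ 1 :=
  ENNReal.toReal_le_of_le_ofReal zero_le_one (by simpa using C.reachProb_le_one T p)

lemma reachReal_of_mem (C : MarkovChain Q) {T : Set Q} {p : Q} (hp : p ∈ T) :
    C.reachReal T p = 1 := by
  simp [reachReal, C.reachProb_of_mem hp]

lemma reachReal_of_notMem (C : MarkovChain Q) {T : Set Q} {p : Q} (hp : p ∉ T) :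
    C.reachReal T p = ∑ q, C.stepReal p q * C.reachReal T q := by
  unfold reachReal
  rw [C.reachProb_of_notMem hp, ENNReal.toReal_sum]
  · simp [ENNReal.toReal_mul, toReal_step]
  · intro q _
    exact ENNReal.mul_ne_top (by simp [step])
      (ne_top_of_le_ne_top ENNReal.one_ne_top (C.reachProb_le_one T q))

/-- The reachability probabilities are the least pre-fixed point. -/
lemma reachReal_le (C : MarkovChain Q) {T : Set Q} {x : Q → ℝ} (h0 : ∀ p, 0 ≤ x p)
    (hT : ∀ p ∈ T, 1 ≤ x p) (hx : ∀ p ∉ T, ∑ q, C.stepReal p q * x q ≤ x p) (p : Q) :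
    C.reachReal T p ≤ x p := by
  have h := C.reachProb_le (T := T) (x := fun p => ENNReal.ofReal (x p))
    (fun p hp => by simpa using hT p hp) (fun p hp => by
      simp only [step_eq_ofReal]
      simp_rw [← ENNReal.ofReal_mul (C.stepReal_nonneg _ _)]
      rw [← ENNReal.ofReal_sum_of_nonneg
        (fun q _ => mul_nonneg (C.stepReal_nonneg _ _) (h0 q))]
      exact ENNReal.ofReal_le_ofReal (hx p hp)) p
  exact ENNReal.toReal_le_of_le_ofReal (h0 p) h

/-- Nothing outside a closed set without targets is reached. -/
lemma reachReal_eq_zero (C : MarkovChain Q) {T M : Set Q} (hMT : ∀ p ∈ M, p ∉ T)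
    (hM : ∀ p ∈ M, ∀ q, 0 < C.stepReal p q → q ∈ M) {p : Q} (hp : p ∈ M) :
    C.reachReal T p = 0 := by
  classical
  refine le_antisymm ?_ (C.reachReal_nonneg T p)
  have h := C.reachReal_le (T := T) (x := fun q => if q ∈ M then 0 else 1)
    (fun q => by split_ifs <;> norm_num)
    (fun q hq => by rw [if_neg (fun h => hMT q h hq)])
    (fun q _ => by
      by_cases hq : q ∈ M
      · rw [if_pos hq]
        refine le_of_eq (Finset.sum_eq_zero fun r _ => ?_)
        rcases (C.stepReal_nonneg q r).eq_or_lt with h | h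
        · simp [← h]
        · simp [hM q hq r h]
      · rw [if_neg hq]
        refine (Finset.sum_le_sum fun r _ => ?_).trans (C.sum_stepReal q).le
        split_ifs
        · simpa using C.stepReal_nonneg q r
        · simp) p
  simpa [hp] using h

/-- If a convex combination of values that are at most `m` is at least `m`, then the values of
positive weight are equal to `m`. -/
lemma eq_of_le_sum_stepReal (C : MarkovChain Q) {p : Q} {x : Q → ℝ} {m : ℝ}
    (hle : ∀ q, x q ≤ m) (h : m ≤ ∑ q, C.stepReal p q * x q) {q : Q}
    (hq : 0 < C.stepReal p q) : x q = m := by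
  by_contra hne
  have hlt : x q < m := lt_of_le_of_ne (hle q) hne
  have : ∑ r, C.stepReal p r * x r < ∑ r, C.stepReal p r * m :=
    Finset.sum_lt_sum (fun r _ => mul_le_mul_of_nonneg_left (hle r) (C.stepReal_nonneg p r))
      ⟨q, Finset.mem_univ _, mul_lt_mul_of_pos_left hlt hq⟩
  rw [← Finset.sum_mul, C.sum_stepReal, one_mul] at this
  linarith

end MarkovChain

/-! ### Optimal strategies -/

namespace MDP

variable {Q A : Type} [Fintype Q]

/-- The real-valued reachability probabilities under a strategy. -/
def reach (M : MDP Q A) (σ : Q → A) (p : Q) : ℝ := (M.inducedChain σ).reachReal M.T p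

/-- Policy improvement. Suppose that the largest loss `d` from the switch is positive. The old
values satisfy `reach σ ≤` their expectation in the new chain, so the states with loss `d` are
closed under the new chain. They contain no targets, hence the new values vanish there. It remains
to rule out both positions of the state `p` relative to this set. -/
lemma reach_switch [DecidableEq Q] (M : MDP Q A) (σ : Q → A) {p : Q} (hp : p ∉ M.T) {a : A}
    (h : M.reach σ p < ∑ q, ((M.δ p a).prob q : ℝ) * M.reach σ q) (q : Q) :
    M.reach σ q ≤ M.reach (Function.update σ p a) q := by
  set τ := Function.update σ p a with hτ
  set C := M.inducedChain τ with hC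
  have hstep_p : ∀ q, C.stepReal p q = ((M.δ p a).prob q : ℝ) := by
    intro q; simp [hC, hτ, inducedChain, MarkovChain.stepReal]
  have hstep_ne : ∀ r ≠ p, ∀ q, C.stepReal r q = (M.inducedChain σ).stepReal r q := by
    intro r hr q; simp [hC, hτ, inducedChain, MarkovChain.stepReal, hr]
  have hR : ∀ r ∉ M.T, M.reach σ r ≤ ∑ q, C.stepReal r q * M.reach σ q := by
    intro r hr
    by_cases hrp : r = p
    · subst hrp; simp only [hstep_p]; exact h.le
    · simp only [hstep_ne r hrp]
      exact ((M.inducedChain σ).reachReal_of_notMem hr).le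
  have : Nonempty Q := ⟨p⟩
  obtain ⟨m, hm⟩ := Finite.exists_max (fun r => M.reach σ r - M.reach τ r)
  by_contra hcon
  push Not at hcon
  have hpos : 0 < M.reach σ m - M.reach τ m := lt_of_lt_of_le (by linarith) (hm q)
  set d := M.reach σ m - M.reach τ m with hd
  have hMT : ∀ r, M.reach σ r - M.reach τ r = d → r ∉ M.T := by
    intro r hr hT
    have h1 : M.reach σ r = 1 := (M.inducedChain σ).reachReal_of_mem hT
    have h2 : M.reach τ r = 1 := C.reachReal_of_mem hT
    linarith
  have hclosed : ∀ r, M.reach σ r - M.reach τ r = d → ∀ q, 0 < C.stepReal r q →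
      M.reach σ q - M.reach τ q = d := by
    intro r hr q hq
    refine C.eq_of_le_sum_stepReal (p := r) (x := fun r => M.reach σ r - M.reach τ r) hm ?_ hq
    simp only [mul_sub, Finset.sum_sub_distrib]
    have h1 := hR r (hMT r hr)
    have h2 : M.reach τ r = ∑ q, C.stepReal r q * M.reach τ q :=
      C.reachReal_of_notMem (hMT r hr)
    linarith
  have hτ0 : ∀ r, M.reach σ r - M.reach τ r = d → M.reach τ r = 0 := fun r hr =>
    C.reachReal_eq_zero (M := {r | M.reach σ r - M.reach τ r = d}) hMT hclosed hr
  by_cases hpM : M.reach σ p - M.reach τ p = d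
  -- All successors of `p` have loss `d` and new value `0`, so the expectation in `h` equals `d`,
  -- which is the old value at `p`: the improvement was not strict.
  · have h1 : ∑ q, ((M.δ p a).prob q : ℝ) * M.reach σ q = ∑ q, C.stepReal p q * d := by
      refine Finset.sum_congr rfl fun q _ => ?_
      rw [hstep_p]
      rcases (C.stepReal_nonneg p q).eq_or_lt with h0 | h0
      · rw [hstep_p] at h0; simp [← h0]
      · have := hclosed p hpM q h0
        rw [← this, hτ0 q this, sub_zero]
    rw [h1, ← Finset.sum_mul, C.sum_stepReal, one_mul, ← hpM, hτ0 p hpM, sub_zero] at h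
    exact lt_irrefl _ h
  -- Away from `p` the two chains agree, so the set is closed under the old chain too, and the old
  -- values vanish there as well; then `d = 0`.
  · have h0 : M.reach σ m = 0 :=
      (M.inducedChain σ).reachReal_eq_zero (M := {r | M.reach σ r - M.reach τ r = d}) hMT
        (fun r hr q hq => hclosed r hr q (by
          rw [hstep_ne r (fun e => hpM (e ▸ hr))]; exact hq)) hd.symm
    have := hτ0 m hd.symm
    linarith

/-- Some strategy is optimal from all the states. -/
lemma exists_optimal [Finite A] [Nonempty A] (M : MDP Q A) : ∃ σ : Q → A, ∀ p ∉ M.T, ∀ a,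
    ∑ q, ((M.δ p a).prob q : ℝ) * M.reach σ q ≤ M.reach σ p := by
  classical
  -- Maximising the sum over all states suffices: a profitable switch lowers no value and raises
  -- one, so it would increase the sum.
  obtain ⟨σ, hσ⟩ := Finite.exists_max (fun σ : Q → A => ∑ p, M.reach σ p)
  refine ⟨σ, fun p hp a => ?_⟩
  by_contra hcon
  push Not at hcon
  have hle := M.reach_switch σ hp hcon
  refine absurd (hσ (Function.update σ p a)) (not_le.2 ?_)
  refine Finset.sum_lt_sum (fun q _ => hle q) ⟨p, Finset.mem_univ _, ?_⟩
  have h1 : M.reach (Function.update σ p a) p =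
      ∑ q, ((M.δ p a).prob q : ℝ) * M.reach (Function.update σ p a) q := by
    have := (M.inducedChain (Function.update σ p a)).reachReal_of_notMem hp
    simpa [MDP.reach, inducedChain, MarkovChain.stepReal] using this
  rw [h1]
  refine lt_of_lt_of_le hcon (Finset.sum_le_sum fun q _ => ?_)
  exact mul_le_mul_of_nonneg_left (hle q) (by positivity)

lemma reach_le (M : MDP Q A) (τ : Q → A) {x : Q → ℝ} (h0 : ∀ p, 0 ≤ x p)
    (hT : ∀ p ∈ M.T, 1 ≤ x p)
    (hx : ∀ p ∉ M.T, ∀ a, ∑ q, ((M.δ p a).prob q : ℝ) * x q ≤ x p) (p : Q) :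
    M.reach τ p ≤ x p :=
  (M.inducedChain τ).reachReal_le h0 hT (fun p hp => hx p hp (τ p)) p

end MDP

/-! ### Values of arenas as least solutions -/

namespace TargetArena

variable {V : Type}

lemma mem_VN_of_E (A : TargetArena V) {p u : V} (hp : p ∈ A.VP) (h : A.E p u) : u ∈ A.VN :=
  (A.bipartite _ _ h).1 hp

variable [Fintype V]

open scoped Classical in
/-- The expectation of `f` after Nature's move in `u`. -/
def expect (A : TargetArena V) (μ : A.NatureFamily) (u : A.VN) (f : V → ℝ) : ℝ :=
  ∑ w : A.succ u, ((μ u).prob w : ℝ) * f w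

lemma expect_mono (A : TargetArena V) (μ : A.NatureFamily) (u : A.VN) {f g : V → ℝ}
    (h : ∀ w, A.E u w → f w ≤ g w) : A.expect μ u f ≤ A.expect μ u g :=
  Finset.sum_le_sum fun w _ => mul_le_mul_of_nonneg_left (h w w.2) (by positivity)

lemma expect_const (A : TargetArena V) (μ : A.NatureFamily) (u : A.VN) (c : ℝ) :
    A.expect μ u (fun _ => c) = c := by
  classical
  unfold expect
  rw [← Finset.sum_mul]
  have h := (μ u).sum_eq_one
  have h2 : ∑ w, (((μ u).prob w : ℚ≥0) : ℝ) = 1 := by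
    rw [← NNRat.cast_sum, h, NNRat.cast_one]
  rw [h2, one_mul]

lemma expect_congr (A : TargetArena V) (μ : A.NatureFamily) (u : A.VN) {f g : V → ℝ}
    (h : ∀ w, A.E u w → f w = g w) : A.expect μ u f = A.expect μ u g :=
  Finset.sum_congr rfl fun w _ => by rw [h w w.2]

lemma expect_lt (A : TargetArena V) (μ : A.NatureFamily) (hμ : μ.FullSupport) (u : A.VN)
    {f g : V → ℝ} (h : ∀ w, A.E u w → f w ≤ g w) {w : V} (hw : A.E u w) (hlt : f w < g w) :
    A.expect μ u f < A.expect μ u g := by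
  classical
  refine Finset.sum_lt_sum (fun w _ => mul_le_mul_of_nonneg_left (h w w.2) (by positivity))
    ⟨⟨w, hw⟩, Finset.mem_univ _, mul_lt_mul_of_pos_left hlt ?_⟩
  have := hμ u ⟨w, hw⟩
  exact_mod_cast this

open scoped Classical in
lemma sum_transProb (A : TargetArena V) (μ : A.NatureFamily) (p : A.VP) (a : A.VN)
    (h : A.E p a) (g : Option A.VP → ℝ) (f : V → ℝ) (hg : ∀ q : A.VP, g (some q) = f q) :
    ∑ q, (A.transProb μ (some p) a q : ℝ) * g q = A.expect μ a f := by
  rw [Fintype.sum_option]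
  simp only [transProb, h, if_true, true_and, NNRat.cast_zero, zero_mul, zero_add]
  rw [← Finset.sum_filter_add_sum_filter_not Finset.univ (fun q : A.VP => A.E a q)]
  rw [Finset.sum_eq_zero (s := Finset.univ.filter fun q : A.VP => ¬ A.E a q), add_zero]
  · refine Finset.sum_bij' (i := fun q hq => ⟨q.1, (Finset.mem_filter.1 hq).2⟩)
      (j := fun v _ => ⟨v.1, A.succ_mem_VP a v⟩) ?_ ?_ ?_ ?_ ?_
    · intro q hq; simp
    · intro v _; exact Finset.mem_filter.2 ⟨Finset.mem_univ _, v.2⟩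
    · intro q hq; rfl
    · intro v _; rfl
    · intro q hq
      rw [dif_pos (Finset.mem_filter.1 hq).2, hg]
  · intro q hq
    rw [dif_neg (Finset.mem_filter.1 hq).2]
    simp

/-- The values are the least solution of the optimality equations. -/
structure IsValue (A : TargetArena V) (μ : A.NatureFamily) (y : V → ℝ) : Prop where
  val_eq : ∀ v, A.val μ v = ENNReal.ofReal (y v)
  nonneg : ∀ v, 0 ≤ y v
  le_one : ∀ v, y v ≤ 1
  target : ∀ t ∈ A.T, y t = 1
  nature : ∀ u : A.VN, y u = A.expect μ u y
  protagonist : ∀ p ∈ A.VP, ∀ u, A.E p u → y u ≤ y p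
  least : ∀ x : V → ℝ, (∀ v, 0 ≤ x v) → (∀ t ∈ A.T, 1 ≤ x t) →
    (∀ p ∈ A.VP, p ∉ A.T → ∀ u, A.E p u → x u ≤ x p) →
    (∀ u : A.VN, A.expect μ u x ≤ x u) → ∀ v, y v ≤ x v

/-- One strategy attains all the suprema at once. Its local optimality gives the inequalities at
Protagonist's vertices, and leastness is inherited from reachability probabilities. -/
lemma exists_isValue (A : TargetArena V) (hVN : A.VN.Nonempty) (μ : A.NatureFamily) :
    ∃ y, A.IsValue μ y := by
  classical
  have : Nonempty A.VN := hVN.to_subtype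
  obtain ⟨σ, hσ⟩ := (A.toMDP μ).exists_optimal
  set M := A.toMDP μ with hM
  have hmem : ∀ p : A.VP, (some p : Option A.VP) ∈ M.T ↔ (p : V) ∈ A.T := by
    intro p; simp [hM, toMDP]
  have hnoneT : (none : Option A.VP) ∉ M.T := by simp [hM, toMDP]
  have hδ : ∀ p a q, ((M.δ p a).prob q) = A.transProb μ p a q := fun _ _ _ => rfl
  have hopt : ∀ τ p, M.reach τ p ≤ M.reach σ p := fun τ =>
    M.reach_le τ (fun p => MarkovChain.reachReal_nonneg _ _ _)
      (fun p hp => (MarkovChain.reachReal_of_mem _ hp).ge) hσ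
  have hvalP : ∀ p : A.VP, A.valP μ p = ENNReal.ofReal (M.reach σ (some p)) := by
    intro p
    refine le_antisymm (iSup_le fun τ => ?_) ?_
    · rw [← MarkovChain.ofReal_reachReal]
      exact ENNReal.ofReal_le_ofReal (hopt τ _)
    · rw [MDP.reach, MarkovChain.ofReal_reachReal]
      exact le_iSup (fun σ => ((A.toMDP μ).inducedChain σ).reachProb (some p) (A.toMDP μ).T) σ
  -- The value `0` on Nature's vertices is a dummy: `z` is averaged only over successors of Nature,
  -- which belong to Protagonist.
  let z : V → ℝ := fun v => if h : v ∈ A.VP then M.reach σ (some ⟨v, h⟩) else 0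
  have hz : ∀ p : A.VP, M.reach σ (some p) = z p := fun p => by simp [z]
  let y : V → ℝ := fun v => if h : v ∈ A.VP then z v else A.expect μ ⟨v, h⟩ z
  have hyP : ∀ v ∈ A.VP, y v = z v := fun v hv => by simp [y, hv]
  have hyN : ∀ u : A.VN, y u = A.expect μ u z := fun u => by
    have : ¬ ((u : V) ∈ A.VP) := u.2
    simp only [y, dif_neg this]
  have hyz : ∀ u : A.VN, ∀ w, A.E u w → y w = z w := fun u w hw =>
    hyP w (A.succ_mem_VP u ⟨w, hw⟩)
  have hz0 : ∀ v, 0 ≤ z v := by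
    intro v; simp only [z]; split_ifs
    · exact MarkovChain.reachReal_nonneg _ _ _
    · exact le_rfl
  have hz1 : ∀ v, z v ≤ 1 := by
    intro v; simp only [z]; split_ifs
    · exact MarkovChain.reachReal_le_one _ _ _
    · exact zero_le_one
  have hsum : ∀ (p : A.VP) (a : A.VN), A.E p a →
      ∑ q, ((M.δ (some p) a).prob q : ℝ) * M.reach σ q = y a := by
    intro p a h
    rw [hyN]
    exact A.sum_transProb μ p a h _ _ hz
  refine ⟨y, ⟨?_, ?_, ?_, ?_, ?_, ?_, ?_⟩⟩
  · intro v
    by_cases hv : v ∈ A.VP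
    · rw [hyP v hv, ← hz ⟨v, hv⟩, ← hvalP]
      simp [val, hv]
    · rw [hyN ⟨v, hv⟩, val, dif_neg hv, expect,
        ENNReal.ofReal_sum_of_nonneg (fun w _ => mul_nonneg (by positivity) (hz0 _))]
      refine Finset.sum_congr rfl fun w _ => ?_
      rw [hvalP, hz, ENNReal.ofReal_mul (by positivity)]
      congr 1
      rw [ENNReal.ofReal, ENNReal.coe_inj]
      apply NNReal.coe_injective
      rw [Real.coe_toNNReal _ (by positivity)]
      norm_cast
  · intro v
    by_cases hv : v ∈ A.VP
    · rw [hyP v hv]; exact hz0 v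
    · rw [hyN ⟨v, hv⟩, ← A.expect_const μ ⟨v, hv⟩ 0]
      exact A.expect_mono _ _ fun w _ => hz0 w
  · intro v
    by_cases hv : v ∈ A.VP
    · rw [hyP v hv]; exact hz1 v
    · rw [hyN ⟨v, hv⟩, ← A.expect_const μ ⟨v, hv⟩ 1]
      exact A.expect_mono _ _ fun w _ => hz1 w
  · intro t ht
    rw [hyP t (A.T_subset ht), ← hz ⟨t, A.T_subset ht⟩]
    exact MarkovChain.reachReal_of_mem _ ((hmem _).2 ht)
  · intro u
    rw [hyN]
    exact (A.expect_congr μ u (hyz u)).symm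
  · intro p hp u hu
    rw [hyP p hp, ← hz ⟨p, hp⟩, ← hsum ⟨p, hp⟩ ⟨u, A.mem_VN_of_E hp hu⟩ hu]
    -- Local optimality is only known outside `T`; at a target the inequality holds because an
    -- average of values is at most `1`.
    by_cases hT : p ∈ A.T
    · rw [show M.reach σ (some ⟨p, hp⟩) = 1 from
        MarkovChain.reachReal_of_mem _ ((hmem _).2 hT),
        hsum ⟨p, hp⟩ ⟨u, A.mem_VN_of_E hp hu⟩ hu, hyN,
        ← A.expect_const μ ⟨u, A.mem_VN_of_E hp hu⟩ 1]
      exact A.expect_mono _ _ fun w _ => hz1 w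
    · exact hσ _ (fun h => hT ((hmem _).1 h)) _
  · intro x hx0 hxT hxP hxN
    -- The sink `⊥` gets `0`, so unavailable actions satisfy the inequality by nonnegativity.
    let g : Option A.VP → ℝ := fun q => q.elim 0 (fun q => x q)
    have hg : ∀ q : A.VP, g (some q) = x q := fun _ => rfl
    have hle : ∀ q, M.reach σ q ≤ g q := by
      refine M.reach_le σ ?_ ?_ ?_
      · rintro (_ | q)
        · exact le_rfl
        · exact hx0 q
      · rintro (_ | q) hq
        · exact absurd hq hnoneT
        · exact hxT q ((hmem q).1 hq)
      · rintro (_ | p) hp a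
        · refine le_of_eq ?_
          rw [Fintype.sum_option]
          simp [hδ, transProb, g]
        · by_cases hE : A.E p a
          · rw [show ∑ q, ((M.δ (some p) a).prob q : ℝ) * g q = A.expect μ a x from
              A.sum_transProb μ p a hE g x hg]
            exact (hxN a).trans (hxP p p.2 (fun h => hp ((hmem p).2 h)) a hE)
          · rw [Fintype.sum_option]
            simpa [hδ, transProb, hE, g] using hx0 p
    have hzx : ∀ v ∈ A.VP, z v ≤ x v := fun v hv => by
      rw [← hz ⟨v, hv⟩]; exact hle (some ⟨v, hv⟩)
    intro v
    by_cases hv : v ∈ A.VP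
    · rw [hyP v hv]; exact hzx v hv
    · rw [hyN ⟨v, hv⟩]
      exact (A.expect_mono μ ⟨v, hv⟩
        fun w hw => hzx w (A.succ_mem_VP ⟨v, hv⟩ ⟨w, hw⟩)).trans (hxN ⟨v, hv⟩)

end TargetArena

/-! ### Blocks of partitions and simple paths -/

section Layers

variable {V : Type} {k : ℕ} (part : V → Fin (k + 1)) (i : Fin (k + 1)) (v : V)

@[simp] lemma mem_layer : v ∈ layer part i ↔ part v = i := Iff.rfl

@[simp] lemma mem_layersAbove : v ∈ layersAbove part i ↔ i < part v := by
  simp [layersAbove]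

@[simp] lemma mem_layersBelow : v ∈ layersBelow part i ↔ part v < i := by
  simp [layersBelow]

@[simp] lemma TargetArena.mem_driftVertices (A : TargetArena V) :
    v ∈ A.driftVertices part ↔
      (0 < part v ∧ part v < Fin.last k) ∧ v ∉ A.VP ∧ ∃ w, A.E v w ∧ part w < part v := by
  simp only [TargetArena.driftVertices, Set.mem_iUnion, Set.mem_ofPred_eq, Set.mem_inter_iff,
    mem_layer, Set.Nonempty, mem_layersBelow, TargetArena.succ, TargetArena.VN, Set.mem_compl_iff]
  constructor
  · rintro ⟨i, hi, ⟨rfl, h1⟩, h2⟩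
    exact ⟨hi, h1, h2⟩
  · rintro ⟨h1, h2, h3⟩
    exact ⟨part v, h1, ⟨rfl, h2⟩, h3⟩

end Layers

/-- A walk contains a simple path. -/
lemma Relation.ReflTransGen.exists_nodup_isChain {α : Type*} {r : α → α → Prop} {a b : α}
    (h : Relation.ReflTransGen r a b) : ∃ l : List α, l.IsChain r ∧ l.Nodup ∧
      l.head? = some a ∧ l.getLast? = some b := by
  induction h using Relation.ReflTransGen.head_induction_on with
  | refl => exact ⟨[b], by simp⟩
  | @head a c hac _ ih =>
    obtain ⟨l, h1, h2, h3, h4⟩ := ih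
    by_cases ha : a ∈ l
    · obtain ⟨l₁, l₂, rfl⟩ := List.append_of_mem ha
      refine ⟨a :: l₂, h1.right_of_append, h2.of_append_right, rfl, ?_⟩
      rw [← h4, List.getLast?_append_of_ne_nil _ (by simp)]
    · cases l with
      | nil => simp at h3
      | cons d l =>
        simp only [List.head?_cons, Option.some.injEq] at h3
        subst h3
        exact ⟨a :: d :: l, List.isChain_cons_cons.2 ⟨hac, h1⟩,
          List.nodup_cons.2 ⟨ha, h2⟩, rfl, by rw [← h4, List.getLast?_cons_cons]⟩

/-! ### From values to certificates -/

namespace TargetArena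

variable {V : Type}

/-- Nature can favour the drift and the path at the same time. -/
lemma exists_favoured {A : TargetArena V} {v : V} {W : Set V} {c : Certificate V}
    (hc : c.IsValid A v W) (u : A.VN) : ∃ w : A.succ u,
      ((u : V) ∈ A.driftVertices c.part → c.part w < c.part u) ∧
      ∀ i b, c.path[i]? = some (u : V) → c.path[i + 1]? = some b → (w : V) = b := by
  by_cases hD : (u : V) ∈ A.driftVertices c.part
  · have hD' := hD
    rw [mem_driftVertices] at hD'
    obtain ⟨⟨-, h2⟩, -, w, hw, hlt⟩ := hD'
    -- There is no conflict with the path: drift vertices lie below the last block, and the path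
    -- lies inside it.
    refine ⟨⟨w, hw⟩, fun _ => hlt, fun i b hi _ => ?_⟩
    have := hc.path_subset u (List.mem_of_getElem? hi)
    rw [mem_layer] at this
    exact absurd this h2.ne
  · by_cases hπ : ∃ i b, c.path[i]? = some (u : V) ∧ c.path[i + 1]? = some b
    · obtain ⟨i, b, hi, hb⟩ := hπ
      obtain ⟨hi', hi''⟩ := List.getElem?_eq_some_iff.1 hi
      obtain ⟨hb', hb''⟩ := List.getElem?_eq_some_iff.1 hb
      have hE : A.E u b := by
        have := List.isChain_iff_getElem.1 hc.path_ok.chain i hb'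
        rwa [hi'', hb''] at this
      refine ⟨⟨b, hE⟩, fun h => absurd h hD, fun j d hj hd => ?_⟩
      -- A simple path visits `u` once, so the favoured successor is determined.
      have : i = j := (List.getElem?_inj hi' hc.path_ok.simple).1 (hi.trans hj.symm)
      subst this
      rw [hb] at hd
      exact Option.some.inj hd
    · obtain ⟨w, hw⟩ := A.exists_succ u u.2
      exact ⟨⟨w, hw⟩, fun h => absurd h hD, fun i b hi hb => absurd ⟨i, b, hi, hb⟩ hπ⟩

variable [Fintype V]

/-- From a vertex of positive value one can reach the targets without decreasing the value. -/
lemma IsValue.exists_walk {A : TargetArena V} {μ : A.NatureFamily} {y : V → ℝ}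
    (hy : A.IsValue μ y) {v : V} (hv : 0 < y v) :
    ∃ t ∈ A.T, Relation.ReflTransGen (fun a b => A.E a b ∧ y v ≤ y b) v t := by
  classical
  by_contra hcon
  push Not at hcon
  set R : Set V := {u | Relation.ReflTransGen (fun a b => A.E a b ∧ y v ≤ y b) v u} with hR
  have hvR : v ∈ R := Relation.ReflTransGen.refl
  have hRstep : ∀ u ∈ R, ∀ w, A.E u w → y v ≤ y w → w ∈ R := fun u hu w h1 h2 =>
    Relation.ReflTransGen.tail hu ⟨h1, h2⟩
  obtain ⟨m₀, hm₀R, hm₀⟩ := Set.exists_max_image R y (Set.toFinite _) ⟨v, hvR⟩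
  set m := y m₀ with hm
  have hvm : y v ≤ m := hm₀ v hvR
  -- The next value below the maximum `m` on `R`; including `0` makes it exist and keeps it
  -- nonnegative. If `R` contains no target, lowering the value `m` to `m'` on `R` leaves all
  -- optimality inequalities intact: the successors of vertices in `R` have values at most `m`, and
  -- those of value `m` lie in `R` and are lowered too. This contradicts leastness.
  obtain ⟨m', hm'mem, hm'max⟩ := Finset.exists_max_image
    (insert 0 ((Finset.univ.image y).filter (· < m))) id ⟨0, by simp⟩
  have hm'lt : m' < m := by
    rcases Finset.mem_insert.1 hm'mem with h | h
    · rw [h]; linarith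
    · exact (Finset.mem_filter.1 h).2
  have hm'0 : 0 ≤ m' := hm'max 0 (by simp)
  have hm'y : ∀ u, y u < m → y u ≤ m' := fun u hu => hm'max (y u) (by simp [hu])
  let x : V → ℝ := fun u => if u ∈ R ∧ y u = m then m' else y u
  have hxM : ∀ u, u ∈ R → y u = m → x u = m' := fun u h1 h2 => if_pos ⟨h1, h2⟩
  have hxn : ∀ u, ¬ (u ∈ R ∧ y u = m) → x u = y u := fun u h => if_neg h
  have hxy : ∀ u, x u ≤ y u := by
    intro u
    by_cases h : u ∈ R ∧ y u = m
    · rw [hxM u h.1 h.2, h.2]; exact hm'lt.le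
    · rw [hxn u h]
  have hsucc : ∀ u ∈ R, ∀ w, A.E u w → y w ≤ m := by
    intro u hu w hw
    by_cases h : y v ≤ y w
    · exact hm₀ w (hRstep u hu w hw h)
    · linarith
  have hxsucc : ∀ u ∈ R, ∀ w, A.E u w → x w ≤ m' := by
    intro u hu w hw
    rcases (hsucc u hu w hw).eq_or_lt with h | h
    · rw [hxM w (hRstep u hu w hw (by rw [h]; exact hvm)) h]
    · exact (hxy w).trans (hm'y w h)
  have hle := hy.least x ?_ ?_ ?_ ?_ m₀
  · rw [hxM m₀ hm₀R rfl] at hle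
    linarith
  · intro u
    by_cases h : u ∈ R ∧ y u = m
    · rw [hxM u h.1 h.2]; exact hm'0
    · rw [hxn u h]; exact hy.nonneg u
  · intro t ht
    rw [hxn t (fun h => hcon t ht h.1), hy.target t ht]
  · intro p hp _ u hu
    by_cases h : p ∈ R ∧ y p = m
    · rw [hxM p h.1 h.2]
      exact hxsucc p h.1 u hu
    · rw [hxn p h]
      exact (hxy u).trans (hy.protagonist p hp u hu)
  · intro u
    by_cases h : (u : V) ∈ R ∧ y u = m
    · rw [hxM u h.1 h.2, ← A.expect_const μ u m']
      exact A.expect_mono μ u (hxsucc u h.1)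
    · rw [hxn u h, hy.nature u]
      exact A.expect_mono μ u fun w _ => hxy w

/-- Blocks are level sets of the values truncated at `y v`: one block for each smaller value, and a
last block for the rest. Comparing blocks thus means comparing truncated values. -/
theorem exists_certificate_of_not_neverWorse (A : TargetArena V) (hVN : A.VN.Nonempty) {W : Set V}
    (hW : W.Nonempty) {v : V} (h : ¬ A.NeverWorse v W) :
    ∃ c : Certificate V, c.IsValid A v W := by
  classical
  unfold NeverWorse at h
  push Not at h
  obtain ⟨μ, hμ, hlt⟩ := h
  obtain ⟨y, hy⟩ := A.exists_isValue hVN μ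
  have hWv : ∀ w ∈ W, y w < y v := by
    intro w hw
    have := hlt w hw
    rw [hy.val_eq, hy.val_eq] at this
    exact (ENNReal.ofReal_lt_ofReal_iff_of_nonneg (hy.nonneg w)).1 this
  have hv0 : 0 < y v := by
    obtain ⟨w, hw⟩ := hW
    exact lt_of_le_of_lt (hy.nonneg w) (hWv w hw)
  set s : Finset ℝ := (Finset.univ.image y).filter (· < y v) with hs
  have hmem : ∀ u, y u ∈ s ↔ y u < y v := fun u => by simp [hs]
  let e := s.orderIsoOfFin rfl
  let part : V → Fin (s.card + 1) := fun u =>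
    if h : y u ∈ s then (e.symm ⟨y u, h⟩).castSucc else Fin.last _
  have hlast : ∀ u, part u = Fin.last _ ↔ y v ≤ y u := by
    intro u
    by_cases h : y u ∈ s
    · simp only [part, dif_pos h]
      constructor
      · intro h'; exact absurd h' (Fin.castSucc_lt_last _).ne
      · intro h'; exact absurd ((hmem u).1 h) (not_lt.2 h')
    · simp only [part, dif_neg h, true_iff]
      exact not_lt.1 (fun h' => h ((hmem u).2 h'))
  have hpart : ∀ u w, part u < part w ↔ y u < y w ∧ y u < y v := by
    intro u w
    by_cases hu : y u ∈ s
    · by_cases hw : y w ∈ s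
      · simp only [part, dif_pos hu, dif_pos hw, Fin.castSucc_lt_castSucc_iff, OrderIso.lt_iff_lt,
          Subtype.mk_lt_mk, (hmem u).1 hu, and_true]
      · simp only [part, dif_pos hu, dif_neg hw, Fin.castSucc_lt_last, true_iff]
        have := (hmem u).1 hu
        exact ⟨this.trans_le (not_lt.1 (fun h' => hw ((hmem w).2 h'))), this⟩
    · simp only [part, dif_neg hu]
      constructor
      · intro h'; exact absurd h' (not_lt.2 (Fin.le_last _))
      · intro h'; exact absurd ((hmem u).2 h'.2) hu
  obtain ⟨t, ht, hwalk⟩ := hy.exists_walk hv0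
  -- Recording the bound at both ends of each edge keeps it available after the walk has been
  -- shortened to a simple path.
  have hwalk' : Relation.ReflTransGen (fun a b => A.E a b ∧ y v ≤ y a ∧ y v ≤ y b) v t := by
    clear ht
    have : Relation.ReflTransGen (fun a b => A.E a b ∧ y v ≤ y a ∧ y v ≤ y b) v t ∧
        y v ≤ y t := by
      induction hwalk with
      | refl => exact ⟨.refl, le_rfl⟩
      | tail _ hbc ih => exact ⟨ih.1.tail ⟨hbc.1, ih.2, hbc.2⟩, hbc.2⟩
    exact this.1
  obtain ⟨π, hπ1, hπ2, hπ3, hπ4⟩ := hwalk'.exists_nodup_isChain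
  refine ⟨⟨s.card, part, π⟩, ⟨⟨?_, ?_, ?_⟩, ⟨hπ1.imp fun _ _ h => h.1, hπ2, hπ3, t, ht, hπ4⟩,
    ?_, ?_, ?_⟩⟩
  · intro i
    induction i using Fin.lastCases with
    | last => exact ⟨v, (hlast v).2 le_rfl⟩
    | cast i =>
      have hi := (e i).2
      obtain ⟨u, hu⟩ : ∃ u, y u = e i := by
        have := (Finset.mem_filter.1 hi).1
        simpa using this
      refine ⟨u, ?_⟩
      have h' : y u ∈ s := hu ▸ hi
      have : (⟨y u, h'⟩ : s) = e i := Subtype.ext hu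
      simp only [part, dif_pos h', this, OrderIso.symm_apply_apply]
  · rintro i p ⟨rfl, hp⟩
    refine Set.eq_empty_of_forall_notMem ?_
    rintro u ⟨hu, hu'⟩
    rw [mem_layersAbove, hpart] at hu'
    exact absurd (hy.protagonist p hp u hu) (not_le.2 hu'.1)
  · rintro i u ⟨rfl, hu⟩ ⟨w, hw, hw'⟩
    rw [mem_layersAbove, hpart] at hw'
    -- Otherwise no successor has a smaller value and one has a larger value; by full support the
    -- average would exceed `y u`.
    have : ∃ w', A.E u w' ∧ part w' < part u := by
      by_contra hcon
      push Not at hcon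
      have h1 : ∀ w', A.E u w' → y u ≤ y w' := by
        intro w' h'
        by_contra h''
        push Not at h''
        exact absurd (hcon w' h') (not_le.2 ((hpart _ _).2 ⟨h'', h''.trans hw'.2⟩))
      have h2 := A.expect_lt μ hμ ⟨u, hu⟩ (f := fun _ => y u) (g := y) h1 hw hw'.1
      rw [A.expect_const, ← hy.nature] at h2
      exact lt_irrefl _ h2
    rw [mem_driftVertices]
    refine ⟨⟨?_, ?_⟩, hu, this⟩
    · obtain ⟨w', -, h'⟩ := this
      exact (Fin.zero_le _).trans_lt h'
    -- Nothing lies above the last block, so a vertex with a successor in a higher block is not in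
    -- it.
    · refine lt_of_le_of_ne (Fin.le_last _) fun h' => ?_
      exact absurd hw'.2 (not_lt.2 ((hlast u).1 h'))
  · intro u hu
    show part u = Fin.last _
    rw [hlast]
    cases π with
    | nil => simp at hu
    | cons a π =>
      simp only [List.head?_cons, Option.some.injEq] at hπ3
      rw [hπ3] at hπ1 hu
      have : ∀ (l : List V) (a : V), y v ≤ y a →
          (a :: l).IsChain (fun a b => A.E a b ∧ y v ≤ y a ∧ y v ≤ y b) → 
          ∀ u ∈ a :: l, y v ≤ y u := by
        intro l
        induction l with
        | nil => intro a ha _ u hu; simp at hu; rwa [hu]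
        | cons b l ih =>
          intro a ha hc u hu
          rw [List.isChain_cons_cons] at hc
          rcases List.mem_cons.1 hu with rfl | hu
          · exact ha
          · exact ih b hc.1.2.2 hc.2 u hu
      exact this π v le_rfl hπ1 u hu
  · intro t ht
    show part t = Fin.last _
    rw [hlast, hy.target t ht]
    exact hy.le_one v
  · intro w hw
    rw [mem_layersBelow]
    refine lt_of_le_of_ne (Fin.le_last _) fun h' => ?_
    exact absurd (hWv w hw) (not_lt.2 ((hlast w).1 h'))

/-! ### From certificates to distributions -/

open scoped Classical in
/-- The family that moves to the favoured successor `f u` with probability `b`, and uniformly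
otherwise. -/
def favouring (A : TargetArena V) (f : ∀ u : A.VN, A.succ u) (a b : ℚ≥0) (hab : a + b = 1) :
    A.NatureFamily := fun u =>
  { prob := fun w => a / Fintype.card (A.succ u) + if w = f u then b else 0
    sum_eq_one := by
      have : (Fintype.card (A.succ u) : ℚ≥0) ≠ 0 :=
        Nat.cast_ne_zero.2 (Fintype.card_pos_iff.2 ⟨f u⟩).ne'
      rw [Finset.sum_add_distrib]
      simp only [Finset.sum_const, Finset.card_univ, nsmul_eq_mul, Finset.sum_ite_eq',
        Finset.mem_univ, if_true]
      rw [mul_div_cancel₀ _ this, hab] }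

lemma favouring_fullSupport (A : TargetArena V) (f : ∀ u : A.VN, A.succ u) {a b : ℚ≥0}
    (hab : a + b = 1) (ha : 0 < a) : (A.favouring f a b hab).FullSupport := by
  classical
  intro u w
  have : (0 : ℚ≥0) < Fintype.card (A.succ u) :=
    Nat.cast_pos.2 (Fintype.card_pos_iff.2 ⟨f u⟩)
  exact add_pos_of_pos_of_nonneg (div_pos ha this) zero_le

open scoped Classical in
lemma expect_favouring (A : TargetArena V) (f : ∀ u : A.VN, A.succ u) {a b : ℚ≥0}
    (hab : a + b = 1) (u : A.VN) (x : V → ℝ) :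
    A.expect (A.favouring f a b hab) u x =
      (a : ℝ) / Fintype.card (A.succ u) * ∑ w : A.succ u, x w + b * x (f u) := by
  unfold expect favouring
  simp only [NNRat.cast_add, NNRat.cast_div, NNRat.cast_natCast, add_mul, Finset.sum_add_distrib,
    Finset.mul_sum]
  congr 1
  rw [Finset.sum_eq_single (f u)]
  · simp
  · intro w _ hw; simp [hw]
  · simp

lemma le_expect_favouring (A : TargetArena V) (f : ∀ u : A.VN, A.succ u) {a b : ℚ≥0}
    (hab : a + b = 1) (u : A.VN) {x : V → ℝ} (hx : ∀ v, 0 ≤ x v) :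
    b * x (f u) ≤ A.expect (A.favouring f a b hab) u x := by
  classical
  rw [expect_favouring]
  have : 0 ≤ (a : ℝ) / Fintype.card (A.succ u) * ∑ w : A.succ u, x w :=
    mul_nonneg (by positivity) (Finset.sum_nonneg fun w _ => hx w)
  linarith

/-- The uniformly spread mass `a` contributes at most `a`, since `x` is at most `1`. -/
lemma expect_favouring_le (A : TargetArena V) (f : ∀ u : A.VN, A.succ u) {a b : ℚ≥0}
    (hab : a + b = 1) (u : A.VN) {x : V → ℝ} (hx : ∀ v, x v ≤ 1) :
    A.expect (A.favouring f a b hab) u x ≤ a + b * x (f u) := by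
  classical
  rw [expect_favouring]
  have hc : (0 : ℝ) < Fintype.card (A.succ u) :=
    Nat.cast_pos.2 (Fintype.card_pos_iff.2 ⟨f u⟩)
  have h1 : ∑ w : A.succ u, x w ≤ Fintype.card (A.succ u) := by
    calc ∑ w : A.succ u, x w ≤ ∑ _w : A.succ u, (1 : ℝ) := Finset.sum_le_sum fun w _ => hx w
      _ = _ := by simp
  have : (a : ℝ) / Fintype.card (A.succ u) * ∑ w : A.succ u, x w ≤ a := by
    calc _ ≤ (a : ℝ) / Fintype.card (A.succ u) * Fintype.card (A.succ u) :=
          mul_le_mul_of_nonneg_left h1 (by positivity)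
      _ = a := div_mul_cancel₀ _ hc.ne'
  linarith

/-- The same small error `a` occurs in both bounds: a drift vertex pays for it by descending one
block, and the path loses at most `a` at each of its vertices. -/
theorem not_neverWorse_of_certificate (A : TargetArena V) (hVN : A.VN.Nonempty) {W : Set V}
    {v : V} {c : Certificate V} (hc : c.IsValid A v W) : ¬ A.NeverWorse v W := by
  classical
  choose f hfD hfπ using exists_favoured hc
  -- The errors add up to `|π| * a + k * a = N * a`, and `a = 1 / (N + 1)` keeps this below `1`.
  set N : ℕ := c.path.length + c.k with hN
  set a : ℚ≥0 := 1 / (N + 1) with ha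
  set b : ℚ≥0 := N / (N + 1) with hb
  have hab : a + b = 1 := by
    rw [ha, hb, ← add_div, add_comm, div_self (by positivity)]
  have ha0 : 0 < a := by rw [ha]; positivity
  have habR : (a : ℝ) + b = 1 := by exact_mod_cast hab
  have ha0R : (0 : ℝ) < a := by exact_mod_cast ha0
  have hb0R : (0 : ℝ) ≤ b := by positivity
  have hNa : (N : ℝ) * a < 1 := by
    have : (a : ℝ) = 1 / (N + 1) := by simp [ha]
    rw [this, mul_one_div, div_lt_one (by positivity)]
    linarith
  set μ := A.favouring f a b hab with hμ
  obtain ⟨y, hy⟩ := A.exists_isValue hVN μ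
  have hka : (c.k : ℝ) * a ≤ N * a := by
    refine mul_le_mul_of_nonneg_right ?_ ha0R.le
    rw [hN]; push_cast; linarith [Nat.cast_nonneg (α := ℝ) c.path.length]
  -- A potential that is a pre-fixed point: `i * a` on a block below the last one, and `1` on the
  -- last block, which contains `T`.
  let g : Fin (c.k + 1) → ℝ := fun i => if i = Fin.last _ then 1 else (i : ℕ) * a
  have hg_le : ∀ i : Fin (c.k + 1), ((i : ℕ) : ℝ) * a ≤ c.k * a := fun i =>
    mul_le_mul_of_nonneg_right (by exact_mod_cast Nat.lt_succ_iff.1 i.2) ha0R.le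
  have hg1 : ∀ i, g i ≤ 1 := by
    intro i; simp only [g]; split_ifs
    · exact le_rfl
    · linarith [hg_le i]
  have hg0 : ∀ i, 0 ≤ g i := by
    intro i; simp only [g]; split_ifs
    · exact zero_le_one
    · positivity
  have hgmono : ∀ i j, i ≤ j → g i ≤ g j := by
    intro i j hij
    by_cases hj : j = Fin.last _
    · have : g j = 1 := by simp [g, hj]
      rw [this]; exact hg1 i
    · have hi : i ≠ Fin.last _ := fun h => hj (Fin.last_le_iff.1 (h ▸ hij))
      simp only [g, if_neg hi, if_neg hj]
      exact mul_le_mul_of_nonneg_right (by exact_mod_cast hij) ha0R.le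
  have hup : ∀ u, y u ≤ g (c.part u) := by
    refine hy.least (fun u => g (c.part u)) (fun u => hg0 _) ?_ ?_ ?_
    · intro t ht
      have : c.part t = Fin.last _ := hc.target_subset ht
      simp [g, this]
    · intro p hp _ u hu
      refine hgmono _ _ (not_lt.1 fun h => ?_)
      have := hc.drift.protagonist _ p ⟨rfl, hp⟩
      exact (Set.eq_empty_iff_forall_notMem.1 this u) ⟨hu, by simpa using h⟩
    · intro u
      -- From block `i` a drift vertex moves to some block `j < i` with probability `b`, so the
      -- expectation is at most `a + b * (j * a) ≤ (j + 1) * a ≤ i * a`. A vertex of Nature outside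
      -- `D` has no successor in a higher block.
      by_cases hD : (u : V) ∈ A.driftVertices c.part
      · refine (A.expect_favouring_le f hab u fun v => hg1 _).trans ?_
        have hlt := hfD u hD
        rw [mem_driftVertices] at hD
        have h1 : c.part u ≠ Fin.last _ := hD.1.2.ne
        have h2 : c.part (f u) ≠ Fin.last _ := (hlt.trans hD.1.2).ne
        simp only [g, if_neg h1, if_neg h2]
        have h3 : ((c.part (f u) : ℕ) : ℝ) + 1 ≤ (c.part u : ℕ) := by exact_mod_cast hlt
        have h4 : (0 : ℝ) ≤ (c.part (f u) : ℕ) * a := by positivity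
        have h5 : (b : ℝ) * ((c.part (f u) : ℕ) * a) ≤ 1 * ((c.part (f u) : ℕ) * a) :=
          mul_le_mul_of_nonneg_right (by linarith) h4
        have h6 := mul_le_mul_of_nonneg_right h3 ha0R.le
        linarith
      · rw [← A.expect_const μ u (g (c.part u))]
        refine A.expect_mono μ u fun w hw => hgmono _ _ (not_lt.1 fun h => hD ?_)
        exact hc.drift.nature _ u ⟨rfl, u.2⟩ ⟨w, hw, by simpa using h⟩
  -- Induction over suffixes of the path. A vertex of Protagonist loses nothing; one of Nature has
  -- value at least `b * y w = y w - a * y w ≥ y w - a`.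
  have hlow : ∀ (s l : List V), c.path = l ++ s → ∀ u, s.head? = some u →
      1 - (s.length : ℝ) * a ≤ y u := by
    intro s
    induction s with
    | nil => intro l _ u hu; simp at hu
    | cons u s ih =>
      intro l hl u' hu'
      simp only [List.head?_cons, Option.some.injEq] at hu'
      subst hu'
      cases s with
      | nil =>
        obtain ⟨t, ht, htl⟩ := hc.path_ok.last
        rw [hl] at htl
        simp at htl
        subst htl
        rw [hy.target _ ht]
        simp [ha0R.le]
      | cons w s =>
        have h1 := ih (l ++ [u]) (by simp [hl]) w rfl
        have hE : A.E u w := by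
          have := hc.path_ok.chain
          rw [hl] at this
          exact (List.isChain_cons_cons.1 this.right_of_append).1
        rw [List.length_cons]
        push_cast at h1 ⊢
        by_cases hu : u ∈ A.VP
        · have := hy.protagonist u hu w hE
          linarith
        · have hw : (f ⟨u, hu⟩ : V) = w :=
            hfπ ⟨u, hu⟩ l.length w (by simp [hl]) (by simp [hl])
          have h2 := A.le_expect_favouring f hab ⟨u, hu⟩ hy.nonneg
          rw [← hμ, ← hy.nature, hw] at h2
          have h3 := mul_le_mul_of_nonneg_left (hy.le_one w) ha0R.le
          have h4 : (b : ℝ) * y w = y w - a * y w := by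
            rw [← sub_eq_iff_eq_add'.2 habR.symm]; ring
          linarith
  intro hNW
  obtain ⟨w, hw, hle⟩ := hNW μ (A.favouring_fullSupport f hab ha0)
  rw [hy.val_eq, hy.val_eq, ENNReal.ofReal_le_ofReal_iff (hy.nonneg w)] at hle
  have h1 := hlow c.path [] rfl v hc.path_ok.head
  have h2 := hup w
  have h3 : c.part w < Fin.last _ := by simpa using hc.W_subset hw
  simp only [g, if_neg h3.ne] at h2
  have h4 := hg_le (c.part w)
  have h5 : (N : ℝ) * a = c.path.length * a + c.k * a := by rw [hN]; push_cast; ring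
  -- The bounds give `1 - |π| * a ≤ y v ≤ y w ≤ k * a`, against `N * a < 1`.
  linarith

end TargetArena

section StackMachines

/-! ### Programs for stack machines -/

open Turing (TM2.Stmt TM2.Cfg TM2.step TM2.stepAux)

/-- The machine reaches `c'` from `c` within `t` steps. -/
def Turing.TM2.RunsTo {K : Type} [DecidableEq K] {Γ : K → Type} {Λ σ : Type}
    (m : Λ → TM2.Stmt Γ Λ σ) (c c' : TM2.Cfg Γ Λ σ) (t : ℕ) : Prop :=
  ∃ n ≤ t, (flip bind (TM2.step m))^[n] (some c) = some c'

namespace Turing.TM2.RunsTo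

variable {K : Type} [DecidableEq K] {Γ : K → Type} {Λ σ : Type}
  {m : Λ → TM2.Stmt Γ Λ σ} {c c' c'' : TM2.Cfg Γ Λ σ} {t t' : ℕ}

lemma mono (h : RunsTo m c c' t) (ht : t ≤ t') : RunsTo m c c' t' := by
  obtain ⟨n, hn, h⟩ := h
  exact ⟨n, hn.trans ht, h⟩

lemma trans (h : RunsTo m c c' t) (h' : RunsTo m c' c'' t') : RunsTo m c c'' (t + t') := by
  obtain ⟨n, hn, h⟩ := h
  obtain ⟨n', hn', h'⟩ := h'
  refine ⟨n' + n, by omega, ?_⟩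
  rw [Function.iterate_add_apply, h, h']

lemma single (h : TM2.step m c = some c') : RunsTo m c c' 1 :=
  ⟨1, le_rfl, h⟩

end Turing.TM2.RunsTo

open Turing.TM2 (RunsTo)

/-- Program fragments with one entry and one exit. -/
structure StackProgram {K : Type} (Γ : K → Type) (σ : Type) where
  Label : Type
  fin : Fintype Label
  start : Label
  code : ∀ {Λ : Type}, (Label → Λ) → Λ → Label → TM2.Stmt Γ Λ σ

namespace StackProgram

variable {K : Type} [DecidableEq K] {Γ : K → Type} {τ : Type}

/-- Started with the stacks `S` and the Boolean register `b`, the program ends within `t` steps with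
the stacks `S'` and the Boolean register `b'`. -/
def Spec (p : StackProgram Γ (Bool × τ)) (b : Bool) (S : ∀ k, List (Γ k)) (b' : Bool)
    (S' : ∀ k, List (Γ k)) (t : ℕ) : Prop :=
  ∀ r : τ, ∃ r' : τ, ∀ (Λ : Type) (emb : p.Label → Λ) (exit : Λ)
    (m : Λ → TM2.Stmt Γ Λ (Bool × τ)), (∀ l, m (emb l) = p.code emb exit l) →
    RunsTo m ⟨some (emb p.start), (b, r), S⟩ ⟨some exit, (b', r'), S'⟩ t

lemma Spec.mono {p : StackProgram Γ (Bool × τ)} {b b' : Bool} {S S' : ∀ k, List (Γ k)} {t t' : ℕ}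
    (h : p.Spec b S b' S' t) (ht : t ≤ t') : p.Spec b S b' S' t' := by
  intro r
  obtain ⟨r', h⟩ := h r
  exact ⟨r', fun Λ emb exit m hm => (h Λ emb exit m hm).mono ht⟩

/-- A single statement that may be repeated. -/
def loop (q : ∀ {Λ : Type}, Λ → Λ → TM2.Stmt Γ Λ (Bool × τ)) : StackProgram Γ (Bool × τ) where
  Label := Unit
  fin := inferInstance
  start := ()
  code emb exit _ := q (emb ()) exit

lemma Spec.loop_again {q : ∀ {Λ : Type}, Λ → Λ → TM2.Stmt Γ Λ (Bool × τ)} {b b₁ b' : Bool}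
    {S S₁ S' : ∀ k, List (Γ k)} {t : ℕ}
    (h₁ : ∀ r, ∃ r₁, ∀ {Λ : Type} (again exit : Λ),
      TM2.stepAux (q again exit) (b, r) S = ⟨some again, (b₁, r₁), S₁⟩)
    (h : (loop q).Spec b₁ S₁ b' S' t) : (loop q).Spec b S b' S' (t + 1) := by
  intro r
  obtain ⟨r₁, h₁⟩ := h₁ r
  obtain ⟨r', h⟩ := h r₁
  refine ⟨r', fun Λ emb exit m hm => ?_⟩
  rw [add_comm]
  refine RunsTo.trans (RunsTo.single ?_) (h Λ emb exit m hm)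
  rw [TM2.step, hm]
  exact congrArg some (h₁ _ _)

lemma Spec.loop_exit {q : ∀ {Λ : Type}, Λ → Λ → TM2.Stmt Γ Λ (Bool × τ)} {b b' : Bool}
    {S S' : ∀ k, List (Γ k)}
    (h : ∀ r, ∃ r', ∀ {Λ : Type} (again exit : Λ),
      TM2.stepAux (q again exit) (b, r) S = ⟨some exit, (b', r'), S'⟩) :
    (loop q).Spec b S b' S' 1 := by
  intro r
  obtain ⟨r', h⟩ := h r
  refine ⟨r', fun Λ emb exit m hm => RunsTo.single ?_⟩
  rw [TM2.step, hm]
  exact congrArg some (h _ _)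

/-- Sequential composition. -/
def seq (p q : StackProgram Γ (Bool × τ)) : StackProgram Γ (Bool × τ) where
  Label := p.Label ⊕ q.Label
  fin := @instFintypeSum _ _ p.fin q.fin
  start := .inl p.start
  code emb exit l :=
    match l with
    | .inl l => p.code (fun l => emb (.inl l)) (emb (.inr q.start)) l
    | .inr l => q.code (fun l => emb (.inr l)) exit l

/-- Code is parametric in the type of labels, so a specification holds in every machine that
contains a copy of the fragment. Composition only has to compose the embeddings of labels. -/
lemma Spec.seq {p q : StackProgram Γ (Bool × τ)} {b b₁ b' : Bool}
    {S S₁ S' : ∀ k, List (Γ k)} {t t' : ℕ} (h : p.Spec b S b₁ S₁ t) (h' : q.Spec b₁ S₁ b' S' t') :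
    (p.seq q).Spec b S b' S' (t + t') := by
  intro r
  obtain ⟨r₁, h⟩ := h r
  obtain ⟨r', h'⟩ := h' r₁
  exact ⟨r', fun Λ emb exit m hm => (h Λ (fun l => emb (.inl l)) _ m fun l => hm (.inl l)).trans
    (h' Λ (fun l => emb (.inr l)) exit m fun l => hm (.inr l))⟩

/-- Conditional execution. -/
def whenTrue (p : StackProgram Γ (Bool × τ)) : StackProgram Γ (Bool × τ) where
  Label := Option p.Label
  fin := @instFintypeOption _ p.fin
  start := none
  code emb exit l :=
    match l with
    | none => .branch Prod.fst (.goto fun _ => emb (some p.start)) (.goto fun _ => exit)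
    | some l => p.code (fun l => emb (some l)) exit l

lemma Spec.whenTrue_true {p : StackProgram Γ (Bool × τ)} {b' : Bool}
    {S S' : ∀ k, List (Γ k)} {t : ℕ} (h : p.Spec true S b' S' t) :
    p.whenTrue.Spec true S b' S' (1 + t) := by
  intro r
  obtain ⟨r', h⟩ := h r
  refine ⟨r', fun Λ emb exit m hm => RunsTo.trans (RunsTo.single ?_)
    (h Λ (fun l => emb (some l)) exit m fun l => hm (some l))⟩
  rw [TM2.step, hm]
  rfl

lemma Spec.whenTrue_false {p : StackProgram Γ (Bool × τ)} {S : ∀ k, List (Γ k)} :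
    p.whenTrue.Spec false S false S 1 := by
  intro r
  refine ⟨r, fun Λ emb exit m hm => RunsTo.single ?_⟩
  rw [TM2.step, hm]
  rfl

/-- Repeated execution; the statement `q` decides whether to go on. -/
def rep (p : StackProgram Γ (Bool × τ)) (q : ∀ {Λ : Type}, Λ → Λ → TM2.Stmt Γ Λ (Bool × τ)) :
    StackProgram Γ (Bool × τ) where
  Label := Option p.Label
  fin := @instFintypeOption _ p.fin
  start := some p.start
  code emb exit l :=
    match l with
    | none => q (emb (some p.start)) exit
    | some l => p.code (fun l => emb (some l)) (emb none) l

lemma Spec.rep_again {p : StackProgram Γ (Bool × τ)}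
    {q : ∀ {Λ : Type}, Λ → Λ → TM2.Stmt Γ Λ (Bool × τ)} {b b₁ b₂ b' : Bool}
    {S S₁ S₂ S' : ∀ k, List (Γ k)} {t t' : ℕ} (h : p.Spec b S b₁ S₁ t)
    (h₁ : ∀ r, ∃ r₁, ∀ {Λ : Type} (again exit : Λ),
      TM2.stepAux (q again exit) (b₁, r) S₁ = ⟨some again, (b₂, r₁), S₂⟩)
    (h' : (rep p q).Spec b₂ S₂ b' S' t') : (rep p q).Spec b S b' S' (t + 1 + t') := by
  intro r
  obtain ⟨r₁, h⟩ := h r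
  obtain ⟨r₂, h₁⟩ := h₁ r₁
  obtain ⟨r', h'⟩ := h' r₂
  refine ⟨r', fun Λ emb exit m hm => ((h Λ (fun l => emb (some l)) (emb none) m
    fun l => hm (some l)).trans (RunsTo.single ?_)).trans (h' Λ emb exit m hm)⟩
  exact congrArg some ((congrArg (TM2.stepAux · _ _) (hm none)).trans (h₁ _ _))

lemma Spec.rep_exit {p : StackProgram Γ (Bool × τ)}
    {q : ∀ {Λ : Type}, Λ → Λ → TM2.Stmt Γ Λ (Bool × τ)} {b b₁ b' : Bool}
    {S S₁ S' : ∀ k, List (Γ k)} {t : ℕ} (h : p.Spec b S b₁ S₁ t)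
    (h₁ : ∀ r, ∃ r₁, ∀ {Λ : Type} (again exit : Λ),
      TM2.stepAux (q again exit) (b₁, r) S₁ = ⟨some exit, (b', r₁), S'⟩) :
    (rep p q).Spec b S b' S' (t + 1) := by
  intro r
  obtain ⟨r₁, h⟩ := h r
  obtain ⟨r₂, h₁⟩ := h₁ r₁
  refine ⟨r₂, fun Λ emb exit m hm => (h Λ (fun l => emb (some l)) (emb none) m
    fun l => hm (some l)).trans (RunsTo.single ?_)⟩
  exact congrArg some ((congrArg (TM2.stepAux · _ _) (hm none)).trans (h₁ _ _))

end StackProgram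

/-! ### Formulas over words -/

/-- First-order formulas over words, with `d` free variables that range over the numbers up to the
length of the word. -/
inductive WordFormula (Γ : Type) : ℕ → Type
  | count {d : ℕ} (p : Γ → Bool) (x y z : Fin d) : WordFormula Γ d
  | not {d : ℕ} (φ : WordFormula Γ d) : WordFormula Γ d
  | and {d : ℕ} (φ ψ : WordFormula Γ d) : WordFormula Γ d
  | ex {d : ℕ} (φ : WordFormula Γ (d + 1)) : WordFormula Γ d

namespace WordFormula

variable {Γ : Type}

/-- The semantics of formulas. -/
def Eval (w : List Γ) : ∀ {d : ℕ}, WordFormula Γ d → (Fin d → ℕ) → Prop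
  | _, count p x y z, e => (w.take (e x)).countP p = e y + e z
  | _, not φ, e => ¬ φ.Eval w e
  | _, and φ ψ, e => φ.Eval w e ∧ ψ.Eval w e
  | _, ex φ, e => ∃ i ≤ w.length, φ.Eval w (Fin.snoc e i)

/-- The number of variables. -/
def width : ∀ {d : ℕ}, WordFormula Γ d → ℕ
  | d, count _ _ _ _ => d
  | _, not φ => φ.width
  | _, and φ ψ => max φ.width ψ.width
  | _, ex φ => φ.width

lemma le_width : ∀ {d : ℕ} (φ : WordFormula Γ d), d ≤ φ.width
  | _, count _ _ _ _ => le_rfl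
  | _, not φ => φ.le_width
  | _, and φ _ => φ.le_width.trans (le_max_left _ _)
  | _, ex φ => (Nat.le_succ _).trans φ.le_width

end WordFormula

/-- The stacks of the machines that evaluate formulas. -/
inductive EvalStack (M : ℕ) : Type
  | inp | rev | var (i : Fin M) | sav | cnt | out
  deriving DecidableEq, Fintype

namespace EvalStack

variable {M : ℕ}

/-- The alphabets of the stacks. -/
def Alphabet (Γ : Type) : EvalStack M → Type
  | inp => Γ
  | rev => Γ
  | var _ => Unit
  | sav => Unit
  | cnt => Unit
  | out => Bool

/-- The contents of the stacks. -/
def mem {Γ : Type} (l r : List Γ) (E : Fin M → ℕ) (s c : ℕ) :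
    ∀ k : EvalStack M, List (Alphabet Γ k)
  | inp => l
  | rev => r
  | var i => List.replicate (E i) ()
  | sav => List.replicate s ()
  | cnt => List.replicate c ()
  | out => []

variable {Γ : Type} (l r : List Γ) (E : Fin M → ℕ) (s c : ℕ)

lemma mem_var (i : Fin M) : mem l r E s c (var i) = List.replicate (E i) () := rfl

lemma update_inp (l' : List Γ) : Function.update (mem l r E s c) inp l' = mem l' r E s c := by
  funext k; cases k <;> rfl

lemma update_rev (r' : List Γ) : Function.update (mem l r E s c) rev r' = mem l r' E s c := by
  funext k; cases k <;> rfl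

lemma update_sav (s' : ℕ) :
    Function.update (mem l r E s c) sav (List.replicate s' ()) = mem l r E s' c := by
  funext k; cases k <;> rfl

lemma update_cnt (c' : ℕ) :
    Function.update (mem l r E s c) cnt (List.replicate c' ()) = mem l r E s c' := by
  funext k; cases k <;> rfl

lemma update_var (i : Fin M) (n : ℕ) :
    Function.update (mem l r E s c) (var i) (List.replicate n ()) =
      mem l r (Function.update E i n) s c := by
  funext k
  by_cases h : k = var i
  · subst h; rw [Function.update_self, mem_var, Function.update_self]; rfl
  · rw [Function.update_of_ne h]
    cases k with
    | var j =>
      have : j ≠ i := fun e => h (e ▸ rfl)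
      simp [mem, this]
    | _ => rfl

end EvalStack

namespace EvalStack

variable {M : ℕ} {Γ : Type} (l r : List Γ) (E : Fin M → ℕ) (s c : ℕ)

variable (l' r' : List Γ) (E' : Fin M → ℕ) (s' c' : ℕ)

lemma pop_inp : Function.update (mem l r E s c) inp (mem l' r' E' s' c' inp).tail =
    mem l'.tail r E s c := update_inp ..

lemma pop_rev : Function.update (mem l r E s c) rev (mem l' r' E' s' c' rev).tail =
    mem l r'.tail E s c := update_rev ..

lemma pop_var (i : Fin M) :
    Function.update (mem l r E s c) (var i) (mem l' r' E' s' c' (var i)).tail =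
      mem l r (Function.update E i (E' i - 1)) s c :=
  (congrArg _ List.tail_replicate).trans (update_var l r E s c i (E' i - 1))

lemma pop_sav : Function.update (mem l r E s c) sav (mem l' r' E' s' c' sav).tail =
    mem l r E (s' - 1) c :=
  (congrArg _ List.tail_replicate).trans (update_sav l r E s c (s' - 1))

lemma pop_cnt : Function.update (mem l r E s c) cnt (mem l' r' E' s' c' cnt).tail =
    mem l r E s (c' - 1) :=
  (congrArg _ List.tail_replicate).trans (update_cnt l r E s c (c' - 1))

lemma push_inp (a : Γ) : Function.update (mem l r E s c) inp (a :: mem l' r' E' s' c' inp) =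
    mem (a :: l') r E s c := update_inp ..

lemma push_rev (a : Γ) : Function.update (mem l r E s c) rev (a :: mem l' r' E' s' c' rev) =
    mem l (a :: r') E s c := update_rev ..

lemma push_var (i : Fin M) :
    Function.update (mem l r E s c) (var i) (() :: mem l' r' E' s' c' (var i)) =
      mem l r (Function.update E i (E' i + 1)) s c :=
  update_var l r E s c i (E' i + 1)

lemma push_sav : Function.update (mem l r E s c) sav (() :: mem l' r' E' s' c' sav) =
    mem l r E (s' + 1) c :=
  update_sav l r E s c (s' + 1)

lemma push_cnt : Function.update (mem l r E s c) cnt (() :: mem l' r' E' s' c' cnt) =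
    mem l r E s (c' + 1) :=
  update_cnt l r E s c (c' + 1)

lemma isSome_head_replicate (n : ℕ) : (List.replicate n ()).head?.isSome = decide (0 < n) := by
  cases n with
  | zero => rfl
  | succ n => exact (decide_eq_true (Nat.succ_pos _)).symm

lemma head_var (i : Fin M) : (mem l r E s c (var i)).head?.isSome = decide (0 < E i) :=
  isSome_head_replicate _

lemma head_sav : (mem l r E s c sav).head?.isSome = decide (0 < s) :=
  isSome_head_replicate _

lemma head_cnt : (mem l r E s c cnt).head?.isSome = decide (0 < c) :=
  isSome_head_replicate _

lemma head_inp : (mem l r E s c inp).head? = l.head? := rfl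

lemma head_rev : (mem l r E s c rev).head? = r.head? := rfl

end EvalStack

open EvalStack

attribute [local simp] pop_inp pop_rev pop_var pop_sav pop_cnt push_inp push_rev push_var push_sav
  push_cnt head_var head_sav head_cnt head_inp head_rev

/-- Programs on the stacks of the formula evaluation: the registers hold a Boolean, the last letter
popped, and whether the last pop of a unary stack was successful. -/
abbrev EvalProgram (Γ : Type) (M : ℕ) : Type 1 :=
  StackProgram (Alphabet Γ (M := M)) (Bool × Option Γ × Bool)

namespace EvalProgram

variable {Γ : Type} {M : ℕ}

/-- Pop from a unary stack. -/
abbrev popUnary {Λ : Type} (k : EvalStack M)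
    (q : TM2.Stmt (Alphabet Γ (M := M)) Λ (Bool × Option Γ × Bool)) :
    TM2.Stmt (Alphabet Γ (M := M)) Λ (Bool × Option Γ × Bool) :=
  .pop k (fun v o => (v.1, v.2.1, o.isSome)) q

/-- Load a function of the Boolean register. -/
def assign (f : Bool → Bool) : EvalProgram Γ M :=
  .loop fun _ exit => .load (fun v => (f v.1, v.2)) (.goto fun _ => exit)

lemma assign_spec (f : Bool → Bool) (b : Bool) (S : ∀ k : EvalStack M, List (Alphabet Γ k)) :
    (assign f).Spec b S (f b) S 1 :=
  StackProgram.Spec.loop_exit fun r => ⟨r, fun _ _ => rfl⟩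

/-- Move the unary number on the stack `sav` to a variable. -/
def restore (x : Fin M) : EvalProgram Γ M :=
  .loop fun again exit => popUnary sav
    (.branch (·.2.2) (.push (var x) (fun _ => ()) (.goto fun _ => again)) (.goto fun _ => exit))

lemma restore_spec (x : Fin M) (b : Bool) (l r : List Γ) (E : Fin M → ℕ) (s c : ℕ) :
    (restore x).Spec b (mem l r E s c) b (mem l r (Function.update E x (E x + s)) 0 c) (s + 1) := by
  induction s generalizing E with
  | zero =>
    refine StackProgram.Spec.loop_exit fun ρ => ⟨(ρ.1, false), fun _ _ => ?_⟩
    simp [TM2.stepAux]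
  | succ s ih =>
    refine StackProgram.Spec.loop_again (b₁ := b)
      (S₁ := mem l r (Function.update E x (E x + 1)) s c)
      (fun ρ => ⟨(ρ.1, true), fun _ _ => ?_⟩) ?_
    · simp [TM2.stepAux]
    · have := ih (Function.update E x (E x + 1))
      rw [Function.update_self, Function.update_idem, add_assoc, add_comm 1 s] at this
      exact this

/-- Subtract a variable from the counter; the Boolean register becomes false if this is not
possible. The variable is moved to the stack `sav`. -/
def subtract (x : Fin M) : EvalProgram Γ M :=
  .loop fun again exit => popUnary (var x)
    (.branch (·.2.2)
      (.push sav (fun _ => ()) (popUnary cnt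
        (.branch (·.2.2) (.goto fun _ => again)
          (.load (fun v => (false, v.2)) (.goto fun _ => again)))))
      (.goto fun _ => exit))

lemma subtract_spec (x : Fin M) (b : Bool) (l r : List Γ) (E : Fin M → ℕ) (s c : ℕ) :
    (subtract x).Spec b (mem l r E s c) (b && decide (E x ≤ c))
      (mem l r (Function.update E x 0) (s + E x) (c - E x)) (E x + 1) := by
  obtain ⟨n, hn⟩ : ∃ n, E x = n := ⟨_, rfl⟩
  induction n generalizing E b s c with
  | zero =>
    refine StackProgram.Spec.mono (StackProgram.Spec.loop_exit fun ρ =>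
      ⟨(ρ.1, false), fun _ _ => ?_⟩) (Nat.le_add_left _ _)
    simp [TM2.stepAux, hn]
  | succ n ih =>
    rw [hn]
    have h := ih (b && decide (0 < c)) (Function.update E x n) (s + 1) (c - 1) (by simp)
    rw [Function.update_self, Function.update_idem] at h
    -- Popping an empty counter leaves it empty, so the failure must be remembered in the register:
    -- `n ≤ c - 1` alone does not detect `c = 0` when `n = 0`.
    have e1 : (b && decide (0 < c) && decide (n ≤ c - 1)) = (b && decide (n + 1 ≤ c)) := by
      rw [Bool.and_assoc, ← Bool.decide_and]
      congr 2
      apply propext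
      omega
    have e2 : s + 1 + n = s + (n + 1) := by omega
    have e3 : c - 1 - n = c - (n + 1) := by omega
    rw [e1, e2, e3] at h
    refine StackProgram.Spec.loop_again (fun ρ => ⟨(ρ.1, decide (0 < c)), fun _ _ => ?_⟩) h
    rcases c with _ | c <;>
    simp [TM2.stepAux, hn]

/-- Empty the counter; the Boolean register becomes false unless the counter was empty. -/
def testZero : EvalProgram Γ M :=
  .loop fun again exit => popUnary cnt
    (.branch (·.2.2) (.load (fun v => (false, v.2)) (.goto fun _ => again)) (.goto fun _ => exit))

lemma testZero_spec (b : Bool) (l r : List Γ) (E : Fin M → ℕ) (s c : ℕ) :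
    testZero.Spec b (mem l r E s c) (b && decide (c = 0)) (mem l r E s 0) (c + 1) := by
  induction c generalizing b with
  | zero =>
    refine StackProgram.Spec.loop_exit fun ρ => ⟨(ρ.1, false), fun _ _ => ?_⟩
    simp [TM2.stepAux]
  | succ c ih =>
    have h := ih false
    rw [Bool.false_and] at h
    rw [show (b && decide (c + 1 = 0)) = false by simp]
    refine StackProgram.Spec.loop_again (fun ρ => ⟨(ρ.1, true), fun _ _ => ?_⟩) h
    simp [TM2.stepAux]

/-- Empty a variable. -/
def clear (x : Fin M) : EvalProgram Γ M :=
  .loop fun again exit => popUnary (var x)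
    (.branch (·.2.2) (.goto fun _ => again) (.goto fun _ => exit))

lemma clear_spec (x : Fin M) (b : Bool) (l r : List Γ) (E : Fin M → ℕ) (s c : ℕ) :
    (clear x).Spec b (mem l r E s c) b (mem l r (Function.update E x 0) s c) (E x + 1) := by
  obtain ⟨n, hn⟩ : ∃ n, E x = n := ⟨_, rfl⟩
  induction n generalizing E with
  | zero =>
    refine StackProgram.Spec.mono (StackProgram.Spec.loop_exit fun ρ =>
      ⟨(ρ.1, false), fun _ _ => ?_⟩) (Nat.le_add_left _ _)
    simp [TM2.stepAux, hn]
  | succ n ih =>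
    rw [hn]
    have h := ih (Function.update E x n) (by simp)
    rw [Function.update_self, Function.update_idem] at h
    refine StackProgram.Spec.loop_again (fun ρ => ⟨(ρ.1, true), fun _ _ => ?_⟩) h
    simp [TM2.stepAux, hn]

variable [Inhabited Γ]

/-- Move the stack `rev` back to the input. -/
def rewind : EvalProgram Γ M :=
  .loop fun again exit => .pop rev (fun v o => (v.1, o, v.2.2))
    (.branch (·.2.1.isSome) (.push inp (fun v => v.2.1.getD default) (.goto fun _ => again))
      (.goto fun _ => exit))

lemma rewind_spec (b : Bool) (l r : List Γ) (E : Fin M → ℕ) (s c : ℕ) :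
    rewind.Spec b (mem l r E s c) b (mem (r.reverse ++ l) [] E s c) (r.length + 1) := by
  induction r generalizing l with
  | nil =>
    refine StackProgram.Spec.loop_exit fun ρ => ⟨(none, ρ.2), fun _ _ => ?_⟩
    simp [TM2.stepAux]
  | cons a r ih =>
    have h := ih (a :: l)
    rw [List.reverse_cons, List.append_assoc]
    refine StackProgram.Spec.loop_again (fun ρ => ⟨(some a, ρ.2), fun _ _ => ?_⟩) h
    simp [TM2.stepAux]

/-- Read a prefix of the input whose length is given by a variable, and count letters. -/
def countPrefix (p : Γ → Bool) (x : Fin M) : EvalProgram Γ M :=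
  .loop fun again exit => popUnary (var x)
    (.branch (·.2.2)
      (.push sav (fun _ => ()) (.pop inp (fun v o => (v.1, o, v.2.2))
        (.branch (·.2.1.isSome)
          (.push rev (fun v => v.2.1.getD default)
            (.branch (·.2.1.any p) (.push cnt (fun _ => ()) (.goto fun _ => again))
              (.goto fun _ => again)))
          (.goto fun _ => again))))
      (.goto fun _ => exit))

lemma countPrefix_spec (p : Γ → Bool) (x : Fin M) (b : Bool) (l r : List Γ) (E : Fin M → ℕ)
    (s c : ℕ) : (countPrefix p x).Spec b (mem l r E s c) b
      (mem (l.drop (E x)) ((l.take (E x)).reverse ++ r) (Function.update E x 0) (s + E x)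
        (c + (l.take (E x)).countP p)) (E x + 1) := by
  obtain ⟨n, hn⟩ : ∃ n, E x = n := ⟨_, rfl⟩
  induction n generalizing E l r s c with
  | zero =>
    refine StackProgram.Spec.mono (StackProgram.Spec.loop_exit fun ρ =>
      ⟨(ρ.1, false), fun _ _ => ?_⟩) (Nat.le_add_left _ _)
    simp [TM2.stepAux, hn]
  | succ n ih =>
    rw [hn]
    cases l with
    -- Even when the input is exhausted, the variable is still moved to `sav` in full, so that
    -- `restore` recovers its exact value.
    | nil =>
      have h := ih [] r (Function.update E x n) (s + 1) c (by simp)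
      rw [Function.update_self, Function.update_idem, add_assoc s 1 n, add_comm 1 n] at h
      rw [List.take_nil, List.drop_nil] at h ⊢
      refine StackProgram.Spec.loop_again (fun ρ => ⟨(none, true), fun _ _ => ?_⟩) h
      simp [TM2.stepAux, hn]
    | cons a l =>
      have h := ih l (a :: r) (Function.update E x n) (s + 1) (c + if p a then 1 else 0) (by simp)
      rw [Function.update_self, Function.update_idem, add_assoc s 1 n, add_comm 1 n, add_assoc c,
        add_comm (ite _ _ _), ← List.countP_cons, ← List.take_succ_cons] at h
      rw [List.take_succ_cons, List.reverse_cons, List.append_assoc, ← List.take_succ_cons]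
      refine StackProgram.Spec.loop_again (fun ρ => ⟨(some a, true), fun _ _ => ?_⟩) h
      by_cases ha : p a
      · simp [TM2.stepAux, hn, ha]
      · simp [TM2.stepAux, hn, ha]

/-- Set a variable to the length of the input, which is moved to the stack `rev`. -/
def measure (x : Fin M) : EvalProgram Γ M :=
  .loop fun again exit => .pop inp (fun v o => (v.1, o, v.2.2))
    (.branch (·.2.1.isSome)
      (.push rev (fun v => v.2.1.getD default) (.push (var x) (fun _ => ()) (.goto fun _ => again)))
      (.goto fun _ => exit))

lemma measure_spec (x : Fin M) (b : Bool) (l r : List Γ) (E : Fin M → ℕ) (s c : ℕ) :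
    (measure x).Spec b (mem l r E s c) b
      (mem [] (l.reverse ++ r) (Function.update E x (E x + l.length)) s c) (l.length + 1) := by
  induction l generalizing r E with
  | nil =>
    refine StackProgram.Spec.loop_exit fun ρ => ⟨(none, ρ.2), fun _ _ => ?_⟩
    simp [TM2.stepAux]
  | cons a l ih =>
    have h := ih (a :: r) (Function.update E x (E x + 1))
    rw [Function.update_self, Function.update_idem, add_assoc, add_comm 1] at h
    rw [List.reverse_cons, List.append_assoc]
    refine StackProgram.Spec.loop_again (fun ρ => ⟨(some a, ρ.2), fun _ _ => ?_⟩) h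
    simp [TM2.stepAux]

end EvalProgram

/-! ### Evaluation of formulas by stack machines -/

namespace WordFormula

variable {Γ : Type} {M : ℕ} [Inhabited Γ]

open EvalProgram

/-- The program that evaluates a formula. -/
def prog : ∀ {d : ℕ} (φ : WordFormula Γ d), φ.width ≤ M → EvalProgram Γ M
  | _, count p x y z, h =>
    -- The counter receives the number of letters, then loses `y` and `z`; the equation holds if no
    -- subtraction fails and the counter ends empty. Each variable is restored from `sav` after use.
    ((((((((countPrefix p (Fin.castLE h x)).seq (restore (Fin.castLE h x))).seq rewind).seq
      (assign fun _ => true)).seq (subtract (Fin.castLE h y))).seq (restore (Fin.castLE h y))).seq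
      (subtract (Fin.castLE h z))).seq (restore (Fin.castLE h z))).seq testZero
  | _, not φ, h => (φ.prog h).seq (assign Bool.not)
  | _, and φ ψ, h =>
    (φ.prog ((le_max_left _ _).trans h)).seq (ψ.prog ((le_max_right _ _).trans h)).whenTrue
  | d, ex φ, h =>
    -- The bound variable, stored on stack number `d`, runs from the length of the input down to
    -- `0`, and the search stops at the first witness.
    (((measure ⟨d, φ.le_width.trans h⟩).seq rewind).seq ((φ.prog h).rep fun again exit =>
      .branch Prod.fst (.goto fun _ => exit) (popUnary (var ⟨d, φ.le_width.trans h⟩)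
        (.branch (·.2.2) (.goto fun _ => again) (.goto fun _ => exit))))).seq
      (clear ⟨d, φ.le_width.trans h⟩)

/-- A bound for the running time of the evaluation. -/
def time : ∀ {d : ℕ}, WordFormula Γ d → Polynomial ℕ
  | _, count _ _ _ _ => 8 * (Polynomial.X + 1) + 1
  | _, not φ => φ.time + 1
  | _, and φ ψ => φ.time + (1 + ψ.time)
  | _, ex φ => (Polynomial.X + 1) + (Polynomial.X + 1) + (Polynomial.X + 1) * (φ.time + 1) +
      (Polynomial.X + 1)

/-- Induction on the formula. Evaluation is compositional because all stacks end as they began and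
only the registers change. Stacks of variables with index at least `d` are empty, so a quantifier
can use the stack `d`. -/
theorem prog_spec (w : List Γ) {d : ℕ} (φ : WordFormula Γ d) (h : φ.width ≤ M) (E : Fin M → ℕ)
    (hE : ∀ i, E i ≤ w.length) (h0 : ∀ i : Fin M, d ≤ i → E i = 0) (b β : Bool)
    (hβ : β = true ↔ φ.Eval w fun i => E (Fin.castLE (φ.le_width.trans h) i)) :
    (φ.prog h).Spec b (mem w [] E 0 0) β (mem w [] E 0 0) (φ.time.eval w.length) := by
  classical
  induction φ generalizing E b β with
  | @count d p x y z =>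
    have hx := hE (Fin.castLE h x)
    have hy := hE (Fin.castLE h y)
    have hz := hE (Fin.castLE h z)
    set x' := Fin.castLE h x with hx'
    set y' := Fin.castLE h y with hy'
    set z' := Fin.castLE h z with hz'
    set c := (w.take (E x')).countP p with hc
    have hcw : c ≤ w.length :=
      List.countP_le_length.trans (by rw [List.length_take]; exact min_le_right _ _)
    have s1 := countPrefix_spec p x' b w [] E 0 0
    have s2 := restore_spec x' b (w.drop (E x')) ((w.take (E x')).reverse ++ [])
      (Function.update E x' 0) (0 + E x') (0 + c)
    have s3 := rewind_spec b (w.drop (E x')) ((w.take (E x')).reverse ++ []) E 0 (0 + c)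
    have s4 := assign_spec (Γ := Γ) (M := M) (fun _ => true) b (mem w [] E 0 c)
    have s5 := subtract_spec y' true w [] E 0 c
    have s6 := restore_spec y' (true && decide (E y' ≤ c)) w [] (Function.update E y' 0)
      (0 + E y') (c - E y')
    have s7 := subtract_spec z' (true && decide (E y' ≤ c)) w [] E 0 (c - E y')
    have s8 := restore_spec z' (true && decide (E y' ≤ c) && decide (E z' ≤ c - E y')) w []
      (Function.update E z' 0) (0 + E z') (c - E y' - E z')
    have s9 := testZero_spec (true && decide (E y' ≤ c) && decide (E z' ≤ c - E y')) w [] E 0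
      (c - E y' - E z')
    simp only [Function.update_self, Function.update_idem, zero_add, Function.update_eq_self,
      List.append_nil, List.reverse_reverse, List.take_append_drop, List.length_reverse,
      List.length_take, Bool.true_and] at s1 s2 s3 s4 s5 s6 s7 s8 s9
    rw [← hc] at s1
    have hres : (decide (E y' ≤ c) && decide (E z' ≤ c - E y') && decide (c - E y' - E z' = 0)) =
        β := by
      rw [← Bool.decide_and, ← Bool.decide_and, Bool.eq_iff_iff, decide_eq_true_iff, hβ]
      show _ ↔ c = E y' + E z'
      omega
    rw [hres] at s9
    refine StackProgram.Spec.mono ((((((((s1.seq s2).seq s3).seq s4).seq s5).seq s6).seq s7).seq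
      s8).seq s9) ?_
    -- Eight loops of at most `w.length + 1` steps each, and one assignment.
    simp only [time, Polynomial.eval_add, Polynomial.eval_mul, Polynomial.eval_X,
      Polynomial.eval_one, Polynomial.eval_ofNat]
    have : min (E x') w.length ≤ w.length := min_le_right _ _
    omega
  | not φ ih =>
    have h1 := (ih h E hE h0 b (!β) (by rw [Bool.not_eq_true', ← Bool.not_eq_true, hβ]; exact not_not)).seq
      (assign_spec (Γ := Γ) (M := M) Bool.not _ _)
    simpa only [prog, time, Bool.not_not, Polynomial.eval_add, Polynomial.eval_one] using h1
  | and φ ψ ih₁ ih₂ =>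
    simp only [prog, time, Polynomial.eval_add, Polynomial.eval_one]
    by_cases hφ : φ.Eval w fun i => E (Fin.castLE (φ.le_width.trans ((le_max_left _ _).trans h)) i)
    · have h1 := ih₁ ((le_max_left _ _).trans h) E hE h0 b true (by simpa using hφ)
      exact h1.seq (ih₂ ((le_max_right _ _).trans h) E hE h0 true β
        (hβ.trans (and_iff_right hφ))).whenTrue_true
    · have h1 := ih₁ ((le_max_left _ _).trans h) E hE h0 b false (by simpa using hφ)
      have : β = false := by
        rw [← Bool.not_eq_true, hβ]
        exact fun h => hφ h.1
      subst this
      exact (h1.seq StackProgram.Spec.whenTrue_false).mono (by omega)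
  | @ex d φ ih =>
    have hd : d < M := φ.le_width.trans h
    set x : Fin M := ⟨d, hd⟩ with hx
    set e : Fin d → ℕ := fun i => E (Fin.castLE hd.le i) with he
    have hEx : E x = 0 := h0 x le_rfl
    have hsnoc : ∀ j, (fun i => Function.update E x j (Fin.castLE (φ.le_width.trans h) i)) =
        (Fin.snoc e j : Fin (d + 1) → ℕ) := by
      intro j
      funext i
      induction i using Fin.lastCases with
      | last =>
        rw [Fin.snoc_last, show Fin.castLE (φ.le_width.trans h) (Fin.last d) = x from rfl,
          Function.update_self]
      | cast i =>
        rw [Fin.snoc_castSucc, Function.update_of_ne]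
        · rfl
        · intro h'
          exact absurd (congrArg Fin.val h') i.2.ne
    have hφ : ∀ i ≤ w.length, ∀ b, (φ.prog h).Spec b (mem w [] (Function.update E x i) 0 0)
        (decide (φ.Eval w (Fin.snoc e i))) (mem w [] (Function.update E x i) 0 0)
        (φ.time.eval w.length) := by
      intro i hi b
      refine ih h _ ?_ ?_ b _ ?_
      · intro j
        by_cases hj : j = x
        · rw [hj, Function.update_self]; exact hi
        · rw [Function.update_of_ne hj]; exact hE j
      · intro j hj
        rw [Function.update_of_ne]
        · exact h0 j (Nat.le_of_succ_le hj)
        · rintro rfl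
          exact absurd hj (Nat.not_succ_le_self d)
      · rw [hsnoc, decide_eq_true_iff]
    -- The value `m` at which the search stops is immaterial, since `clear` erases it afterwards.
    have key : ∀ i ≤ w.length, ∀ b β, (β = true ↔ ∃ j ≤ i, φ.Eval w (Fin.snoc e j)) →
        ∃ m ≤ w.length, StackProgram.Spec ((φ.prog h).rep fun again exit =>
          .branch Prod.fst (.goto fun _ => exit) (popUnary (var x)
            (.branch (·.2.2) (.goto fun _ => again) (.goto fun _ => exit)))) b
          (mem w [] (Function.update E x i) 0 0) β
          (mem w [] (Function.update E x m) 0 0) ((i + 1) * (φ.time.eval w.length + 1)) := by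
      intro i
      induction i with
      | zero =>
        intro hi b β hβ
        refine ⟨0, hi, ?_⟩
        have hβ' : decide (φ.Eval w (Fin.snoc e 0)) = β := by
          rw [Bool.eq_iff_iff, hβ, decide_eq_true_iff]
          simp
        have h1 := hφ 0 hi b
        rw [hβ'] at h1
        rw [zero_add, one_mul]
        refine h1.rep_exit fun ρ => ?_
        cases β with
        | false => exact ⟨(ρ.1, false), fun _ _ => by simp [TM2.stepAux]⟩
        | true => exact ⟨ρ, fun _ _ => by simp [TM2.stepAux]⟩
      | succ i ihi =>
        intro hi b β hβ
        have h1 := hφ (i + 1) hi b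
        by_cases hi' : φ.Eval w (Fin.snoc e (i + 1))
        · have : β = true := hβ.2 ⟨i + 1, le_rfl, hi'⟩
          subst this
          rw [decide_eq_true hi'] at h1
          refine ⟨i + 1, hi, StackProgram.Spec.mono (h1.rep_exit fun ρ =>
            ⟨ρ, fun _ _ => by simp [TM2.stepAux]⟩) (Nat.le_mul_of_pos_left _ (Nat.succ_pos _))⟩
        · rw [decide_eq_false hi'] at h1
          have hβ' : β = true ↔ ∃ j ≤ i, φ.Eval w (Fin.snoc e j) := by
            rw [hβ]
            constructor
            · rintro ⟨j, hj, hj'⟩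
              rcases hj.eq_or_lt with rfl | hj
              · exact absurd hj' hi'
              · exact ⟨j, Nat.lt_succ_iff.1 hj, hj'⟩
            · rintro ⟨j, hj, hj'⟩
              exact ⟨j, hj.trans (Nat.le_succ i), hj'⟩
          obtain ⟨m, hm, h2⟩ := ihi (Nat.le_of_succ_le hi) false β hβ'
          refine ⟨m, hm, StackProgram.Spec.mono (h1.rep_again (fun ρ =>
            ⟨(ρ.1, true), fun _ _ => by simp [TM2.stepAux]⟩) h2) ?_⟩
          rw [Nat.succ_mul (i + 1), add_comm]
    obtain ⟨m, hm, hkey⟩ := key w.length le_rfl b β hβ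
    have s1 := measure_spec x b w [] E 0 0
    have s2 := rewind_spec b [] (w.reverse ++ []) (Function.update E x (E x + w.length)) 0 0
    have s4 := clear_spec x β w [] (Function.update E x m) 0 0
    have hE0 : Function.update E x 0 = E := by rw [← hEx, Function.update_eq_self]
    simp only [Function.update_self, Function.update_idem, hEx, zero_add, hE0,
      List.append_nil, List.reverse_reverse, List.length_reverse] at s1 s2 s4
    refine StackProgram.Spec.mono (((s1.seq s2).seq hkey).seq s4) ?_
    simp only [time, Polynomial.eval_add, Polynomial.eval_mul, Polynomial.eval_X,
      Polynomial.eval_one]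
    omega

end WordFormula

namespace WordFormula

variable {Γ : Type}

/-- The statement that empties the input and outputs the Boolean register. -/
def outputStmt {M : ℕ} {Λ : Type} (again : Λ) :
    TM2.Stmt (Alphabet Γ (M := M)) Λ (Bool × Option Γ × Bool) :=
  .pop inp (fun v o => (v.1, o, v.2.2)) (.branch (·.2.1.isSome) (.goto fun _ => again)
    -- A halting configuration must have initial registers and nothing but the output on its stacks.
    (.push out (fun v => v.1) (.load (fun _ => (false, none, false)) .halt)))

lemma stepAux_outputStmt_nil {M : ℕ} {Λ : Type} (again : Λ) (E : Fin M → ℕ) (b : Bool)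
    (r : Option Γ × Bool) : TM2.stepAux (outputStmt again) (b, r) (mem [] [] E 0 0) =
      ⟨none, (false, none, false), Function.update (mem [] [] E 0 0) out [b]⟩ := by
  simp [outputStmt]
  rfl

lemma stepAux_outputStmt_cons {M : ℕ} {Λ : Type} (again : Λ) (a : Γ) (w : List Γ)
    (E : Fin M → ℕ) (b : Bool) (r : Option Γ × Bool) :
    TM2.stepAux (outputStmt again) (b, r) (mem (a :: w) [] E 0 0) =
      ⟨some again, (b, some a, r.2), mem w [] E 0 0⟩ := by
  simp [outputStmt]

variable [Inhabited Γ] [Fintype Γ]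

/-- The machine that evaluates a formula. -/
def machine (φ : WordFormula Γ 0) : Turing.FinTM2 where
  K := EvalStack φ.width
  k₀ := inp
  k₁ := out
  Γ := Alphabet Γ
  Λ := Option (φ.prog (M := φ.width) le_rfl).Label
  main := some (φ.prog (M := φ.width) le_rfl).start
  ΛFin := @instFintypeOption _ (φ.prog (M := φ.width) le_rfl).fin
  σ := Bool × Option Γ × Bool
  initialState := (false, none, false)
  Γk₀Fin := inferInstanceAs (Fintype Γ)
  m l := match l with
    | some l => (φ.prog le_rfl).code some none l
    | none => outputStmt none

lemma output_runsTo (φ : WordFormula Γ 0) (w : List Γ) (E : Fin φ.width → ℕ) (b : Bool)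
    (r : Option Γ × Bool) : RunsTo φ.machine.m ⟨some none, (b, r), mem w [] E 0 0⟩
      ⟨none, (false, none, false), Function.update (mem [] [] E 0 0) out [b]⟩ (w.length + 1) := by
  induction w generalizing r with
  | nil => exact RunsTo.single (congrArg some (stepAux_outputStmt_nil _ E b r))
  | cons a w ih =>
    rw [List.length_cons, add_comm]
    exact RunsTo.trans (RunsTo.single (congrArg some (stepAux_outputStmt_cons _ a w E b r)))
      (ih (some a, r.2))

lemma machine_runsTo (φ : WordFormula Γ 0) (w : List Γ) (β : Bool)
    (hβ : β = true ↔ φ.Eval w Fin.elim0) :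
    RunsTo φ.machine.m (Turing.initList φ.machine w) (Turing.haltList φ.machine [β])
      (φ.time.eval w.length + (w.length + 1)) := by
  have h := φ.prog_spec w le_rfl (fun _ => 0) (fun _ => Nat.zero_le _) (fun _ _ => rfl) false β
    (hβ.trans (iff_of_eq (congrArg _ (Subsingleton.elim _ _))))
  obtain ⟨r', h⟩ := h (none, false)
  have h1 := h _ some none φ.machine.m (fun _ => rfl)
  have h2 := h1.trans (φ.output_runsTo w (fun _ => 0) β r')
  have e1 : Turing.initList φ.machine w = (⟨some (some (φ.prog le_rfl).start),
      (false, none, false), mem w [] (fun _ => 0) 0 0⟩ : TM2.Cfg _ _ _) := by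
    unfold Turing.initList
    congr 1
    funext k
    cases k <;> rfl
  have e2 : Turing.haltList φ.machine [β] = (⟨none, (false, none, false),
      Function.update (mem [] [] (fun _ => 0) 0 0) out [β]⟩ : TM2.Cfg _ _ _) := by
    unfold Turing.haltList
    congr 1
    funext k
    cases k <;> rfl
  rw [e1, e2]
  exact h2

/-- A fixed formula has a fixed number of nested quantifiers, each ranging over at most `|w| + 1`
values. Polynomial running time is thus obtained from definability alone. -/
theorem inPolyTime {α : Type} {enc : α → List Γ} {L : Set α} (φ : WordFormula Γ 0)
    (h : ∀ a, a ∈ L ↔ φ.Eval (enc a) Fin.elim0) : InPolyTime enc L := by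
  classical
  refine ⟨fun a => decide (a ∈ L), ⟨?_⟩, fun a => decide_eq_true_iff⟩
  refine
    { tm := φ.machine
      inputAlphabet := Equiv.refl Γ
      outputAlphabet := Equiv.refl Bool
      time := φ.time + (Polynomial.X + 1)
      outputsFun := fun a => ?_ }
  have hr := φ.machine_runsTo (enc a) (decide (a ∈ L)) (by rw [decide_eq_true_iff, h])
  have h1 : List.map (Equiv.refl Γ).invFun (enc a) = enc a := List.map_id _
  refine
    { steps := hr.choose
      evals_in_steps := ?_
      steps_le_m := ?_ }
  · have := hr.choose_spec.2
    exact (congrArg (fun l => (flip bind φ.machine.step)^[hr.choose]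
      (some (Turing.initList φ.machine l))) h1).trans this
  · simpa using hr.choose_spec.1

end WordFormula

lemma Primrec.fin_snoc {d : ℕ} : Primrec₂ fun (e : Fin d → ℕ) (i : ℕ) =>
    (Fin.snoc e i : Fin (d + 1) → ℕ) := by
  refine Primrec.fin_curry.2 (Primrec₂.swap ?_)
  refine Primrec.fin_curry₁.2 fun j => ?_
  induction j using Fin.lastCases with
  | last => simpa using Primrec.snd
  | cast j => simpa using Primrec.fin_app.comp Primrec.fst (Primrec.const j)

/-- The semantics of a formula is primitive recursive. -/
theorem WordFormula.primrecPred_eval {Γ : Type} [Finite Γ] [Primcodable Γ] {d : ℕ}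
    (φ : WordFormula Γ d) : PrimrecPred fun q : List Γ × (Fin d → ℕ) => φ.Eval q.1 q.2 := by
  induction φ with
  | @count d p x y z =>
    have hp : PrimrecPred fun a : Γ => p a = true :=
      Primrec.eq.comp (Primrec.dom_finite p) (Primrec.const true)
    have hvar : ∀ x : Fin d, Primrec fun q : List Γ × (Fin d → ℕ) => q.2 x := fun x =>
      Primrec.fin_app.comp Primrec.snd (Primrec.const x)
    refine PrimrecPred.of_eq (Primrec.eq.comp (Primrec.list_length.comp ((Primrec.listFilter hp).comp
      (Primrec.list_take.comp (hvar x) Primrec.fst))) (Primrec.nat_add.comp (hvar y) (hvar z))) ?_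
    intro q
    simp only [WordFormula.Eval, List.countP_eq_length_filter, Bool.decide_eq_true]
  | not φ ih => exact ih.not
  | and φ ψ ih₁ ih₂ => exact ih₁.and ih₂
  | @ex d φ ih =>
    have hR : PrimrecRel fun (i : ℕ) (q : List Γ × (Fin d → ℕ)) =>
        φ.Eval q.1 (Fin.snoc q.2 i) :=
      ih.comp (Primrec.pair (Primrec.fst.comp Primrec.snd)
        (Primrec.fin_snoc.comp (Primrec.snd.comp Primrec.snd) Primrec.fst))
    refine PrimrecPred.of_eq (hR.exists_mem_list.comp
      (Primrec.list_range.comp (Primrec.succ.comp (Primrec.list_length.comp Primrec.fst)))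
      Primrec.id) ?_
    intro q
    simp only [WordFormula.Eval, List.mem_range, Nat.lt_succ_iff, id]

end StackMachines

/-! ### Definable predicates on words -/

namespace WordFormula

variable {Γ : Type} {d : ℕ}

/-- The predicate is defined by a formula. -/
def Definable (R : List Γ → (Fin d → ℕ) → Prop) : Prop :=
  ∃ φ : WordFormula Γ d, ∀ w e, (∀ i, e i ≤ w.length) → (φ.Eval w e ↔ R w e)

/-- The functions that select a variable. -/
def IsVar (x : (Fin d → ℕ) → ℕ) : Prop := ∃ i, x = fun e => e i

lemma IsVar.last : IsVar fun e : Fin (d + 1) → ℕ => e (Fin.last d) := ⟨_, rfl⟩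

lemma IsVar.le_length {x : (Fin d → ℕ) → ℕ} (hx : IsVar x) {w : List Γ} {e : Fin d → ℕ}
    (he : ∀ i, e i ≤ w.length) : x e ≤ w.length := by
  obtain ⟨i, rfl⟩ := hx
  exact he i

lemma IsVar.init {x : (Fin d → ℕ) → ℕ} (hx : IsVar x) :
    IsVar fun e : Fin (d + 1) → ℕ => x (Fin.init e) := by
  obtain ⟨i, rfl⟩ := hx
  exact ⟨i.castSucc, rfl⟩

/-- Sums of variables and constants. -/
inductive IsTerm : ∀ {d : ℕ}, ((Fin d → ℕ) → ℕ) → Prop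
  | of {d : ℕ} (i : Fin d) : IsTerm fun e => e i
  | const {d : ℕ} (c : ℕ) : IsTerm fun _ : Fin d → ℕ => c
  | add {d : ℕ} {s t : (Fin d → ℕ) → ℕ} (hs : IsTerm s) (ht : IsTerm t) :
      IsTerm fun e => s e + t e

lemma IsVar.term {x : (Fin d → ℕ) → ℕ} (hx : IsVar x) : IsTerm x := by
  obtain ⟨i, rfl⟩ := hx
  exact .of i

lemma IsTerm.init {t : (Fin d → ℕ) → ℕ} (ht : IsTerm t) :
    IsTerm fun e : Fin (d + 1) → ℕ => t (Fin.init e) := by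
  induction ht with
  | of i => exact .of i.castSucc
  | const c => exact .const c
  | add _ _ ih₁ ih₂ => exact .add ih₁ ih₂

lemma IsTerm.last : IsTerm fun e : Fin (d + 1) → ℕ => e (Fin.last d) := .of _

namespace Definable

variable {R R' : List Γ → (Fin d → ℕ) → Prop}

lemma congr (h : Definable R) (hR : ∀ w e, (∀ i, e i ≤ w.length) → (R w e ↔ R' w e)) :
    Definable R' := by
  obtain ⟨φ, hφ⟩ := h
  exact ⟨φ, fun w e he => (hφ w e he).trans (hR w e he)⟩

lemma not (h : Definable R) : Definable fun w e => ¬ R w e := by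
  obtain ⟨φ, hφ⟩ := h
  exact ⟨.not φ, fun w e he => not_congr (hφ w e he)⟩

lemma and (h : Definable R) (h' : Definable R') : Definable fun w e => R w e ∧ R' w e := by
  obtain ⟨φ, hφ⟩ := h
  obtain ⟨ψ, hψ⟩ := h'
  exact ⟨.and φ ψ, fun w e he => and_congr (hφ w e he) (hψ w e he)⟩

lemma imp (h : Definable R) (h' : Definable R') : Definable fun w e => R w e → R' w e :=
  (h.and h'.not).not.congr fun w e _ => by tauto

lemma or (h : Definable R) (h' : Definable R') : Definable fun w e => R w e ∨ R' w e :=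
  (h.not.and h'.not).not.congr fun w e _ => by tauto

/-- The bound variable is the last coordinate and `Fin.init` gives the outer ones, so that
definability proofs can follow the shape of the predicate without writing a formula. -/
lemma ex {P : List Γ → (Fin d → ℕ) → ℕ → Prop}
    (h : Definable fun w (e : Fin (d + 1) → ℕ) => P w (Fin.init e) (e (Fin.last d))) :
    Definable fun w e => ∃ i ≤ w.length, P w e i := by
  obtain ⟨φ, hφ⟩ := h
  refine ⟨.ex φ, fun w e he => exists_congr fun i => and_congr_right fun hi => ?_⟩
  rw [hφ]
  · simp
  · intro j
    induction j using Fin.lastCases with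
    | last => simpa using hi
    | cast j => simpa using he j

lemma all {P : List Γ → (Fin d → ℕ) → ℕ → Prop}
    (h : Definable fun w (e : Fin (d + 1) → ℕ) => P w (Fin.init e) (e (Fin.last d))) :
    Definable fun w e => ∀ i ≤ w.length, P w e i :=
  (ex (P := fun w e i => ¬ P w e i) h.not).not.congr fun w e _ => by push Not; rfl

variable {x y z : (Fin d → ℕ) → ℕ}

lemma zero (hx : IsVar x) : Definable fun (_ : List Γ) e => x e = 0 := by
  obtain ⟨i, rfl⟩ := hx
  -- Counting no letters turns the atom into `0 = x + x`.
  exact ⟨.count (fun _ => false) i i i, fun w e _ => by simp [Eval]; omega⟩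

lemma countPrefix (p : Γ → Bool) (hx : IsVar x) (hy : IsVar y) :
    Definable fun w e => (w.take (x e)).countP p = y e := by
  obtain ⟨i, rfl⟩ := hx
  obtain ⟨j, rfl⟩ := hy
  -- The superfluous summand of the atom is a fresh variable that is forced to be `0`.
  have h : Definable fun (w : List Γ) (e : Fin (d + 1) → ℕ) =>
      (w.take (e i.castSucc)).countP p = e j.castSucc + e (Fin.last d) :=
    ⟨.count p i.castSucc j.castSucc (Fin.last d), fun _ _ _ => Iff.rfl⟩
  refine ((zero IsVar.last).and h).ex (P := fun w e k => k = 0 ∧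
    (w.take (e i)).countP p = e j + k) |>.congr fun w e _ => ?_
  simp

lemma sum (hx : IsVar x) (hy : IsVar y) (hz : IsVar z) :
    Definable fun (_ : List Γ) e => x e = y e + z e := by
  obtain ⟨i, rfl⟩ := hx
  obtain ⟨j, rfl⟩ := hy
  obtain ⟨k, rfl⟩ := hz
  -- Counting all letters of the prefix of length `x ≤ w.length` gives `x` itself.
  refine ⟨.count (fun _ => true) i j k, fun w e he => ?_⟩
  simp [Eval, he i]

lemma le (hx : IsVar x) (hy : IsVar y) : Definable fun (_ : List Γ) e => x e ≤ y e := by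
  refine (sum hy.init hx.init IsVar.last).ex (P := fun w e k => y e = x e + k) |>.congr
    fun w e he => ?_
  have hy' : y e ≤ w.length := hy.le_length he
  constructor
  · rintro ⟨k, -, hk⟩
    omega
  · intro h
    exact ⟨y e - x e, by omega, by omega⟩

lemma lt (hx : IsVar x) (hy : IsVar y) : Definable fun (_ : List Γ) e => x e < y e :=
  (le hy hx).not.congr fun _ _ _ => not_le

lemma eq (hx : IsVar x) (hy : IsVar y) : Definable fun (_ : List Γ) e => x e = y e :=
  ((le hx hy).and (le hy hx)).congr fun _ _ _ => le_antisymm_iff.symm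

/-- The successor of `y` is the least number above `y`; if `y < x`, then `y + 1 ≤ x` is within the
range of the quantifier. -/
lemma succ (hx : IsVar x) (hy : IsVar y) : Definable fun (_ : List Γ) e => x e = y e + 1 := by
  refine ((lt hy hx).and ((lt hy.init IsVar.last).imp (le hx.init IsVar.last)).all).congr
    (R := fun (w : List Γ) e => y e < x e ∧ ∀ k ≤ w.length, y e < k → x e ≤ k) fun w e he => ?_
  have hx' : x e ≤ w.length := hx.le_length he
  constructor
  · rintro ⟨h1, h2⟩
    have := h2 (y e + 1) (by omega) (by omega)
    omega
  · intro h
    exact ⟨by omega, fun k _ hk => by omega⟩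

lemma eq_const {d : ℕ} {x : (Fin d → ℕ) → ℕ} (hx : IsVar x) (c : ℕ) :
    Definable fun (_ : List Γ) e => x e = c := by
  induction c generalizing d with
  | zero => exact zero hx
  | succ c ih =>
    refine ((ih IsVar.last).and (succ hx.init IsVar.last)).ex
      (P := fun w e k => k = c ∧ x e = k + 1) |>.congr fun w e he => ?_
    have hx' : x e ≤ w.length := hx.le_length he
    constructor
    · rintro ⟨k, -, rfl, h⟩
      exact h
    · intro h
      exact ⟨c, by omega, rfl, h⟩

/-- A sum needs two fresh variables for the values of its summands, so the induction has to allow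
the variables of the term to be renamed into a larger context. -/
lemma eq_term_comp {t : (Fin d → ℕ) → ℕ} (ht : IsTerm t) {d' : ℕ} (ρ : Fin d → Fin d')
    {x : (Fin d' → ℕ) → ℕ} (hx : IsVar x) :
    Definable fun (_ : List Γ) e => x e = t fun i => e (ρ i) := by
  induction ht generalizing d' with
  | of i => exact eq hx ⟨ρ i, rfl⟩
  | const c => exact eq_const hx c
  | @add s t _ _ ih₁ ih₂ =>
    have h1 := ih₁ (fun i => (ρ i).castSucc.castSucc) (IsVar.last (d := d')).init
    have h2 := ih₂ (fun i => (ρ i).castSucc.castSucc) (IsVar.last (d := d' + 1))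
    refine (h1.and (h2.and (sum hx.init.init (IsVar.last (d := d')).init IsVar.last))).ex
      (P := fun w e k => e (Fin.last d') = s (fun i => e (ρ i).castSucc) ∧
        k = t (fun i => e (ρ i).castSucc) ∧ x (Fin.init e) = e (Fin.last d') + k) |>.ex
      (P := fun w e l => ∃ k ≤ w.length, l = s (fun i => e (ρ i)) ∧ k = t (fun i => e (ρ i)) ∧
        x e = l + k) |>.congr fun w e he => ?_
    have hx' : x e ≤ w.length := hx.le_length he
    constructor
    · rintro ⟨_, -, _, -, rfl, rfl, h⟩
      exact h
    · intro h
      have h' : x e = s (fun i => e (ρ i)) + t (fun i => e (ρ i)) := h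
      exact ⟨_, by omega, _, by omega, rfl, rfl, h⟩

lemma eq_term {t : (Fin d → ℕ) → ℕ} (hx : IsVar x) (ht : IsTerm t) :
    Definable fun (_ : List Γ) e => x e = t e :=
  eq_term_comp ht id hx

/-- Substitution of a term. -/
lemma subst {P : List Γ → (Fin d → ℕ) → ℕ → Prop} {t : (Fin d → ℕ) → ℕ} (ht : IsTerm t)
    (h : Definable fun w (e : Fin (d + 1) → ℕ) => P w (Fin.init e) (e (Fin.last d)))
    (hb : ∀ w e i, P w e i → i ≤ w.length) : Definable fun w e => P w e (t e) := by
  refine ((eq_term IsVar.last ht.init).and h).ex (P := fun w e i => i = t e ∧ P w e i) |>.congr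
    fun w e _ => ?_
  constructor
  · rintro ⟨_, -, rfl, h⟩
    exact h
  · intro h
    -- A term may exceed the length of the word and so fall outside the quantifier; `hb` says that
    -- the predicate is false there.
    exact ⟨_, hb _ _ _ h, rfl, h⟩

end Definable

/-! ### Letters and blocks -/

/-- The letter at position `x` satisfies `p`. -/
def LetterAt (p : Γ → Bool) (w : List Γ) (x : ℕ) : Prop := ∃ a, w[x]? = some a ∧ p a

lemma LetterAt.lt_length {p : Γ → Bool} {w : List Γ} {x : ℕ} (h : LetterAt p w x) :
    x < w.length := by
  obtain ⟨a, ha, -⟩ := h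
  exact (List.getElem?_eq_some_iff.1 ha).1

/-- Prefix counts see single letters: the count changes from `x` to `x + 1` exactly when the letter
at `x` is counted. -/
lemma countP_take_succ_ne_iff (p : Γ → Bool) (w : List Γ) (x : ℕ) :
    (w.take (x + 1)).countP p ≠ (w.take x).countP p ↔ LetterAt p w x := by
  rw [List.take_add_one, List.countP_append]
  unfold LetterAt
  cases h : w[x]? with
  | none => simp
  | some a => by_cases hp : p a <;> simp [hp]

/-- Blocks end at the letters that satisfy `sep`. The letter number `j` of the block number `b`
satisfies `p`. -/
def BlockLetter (sep p : Γ → Bool) (w : List Γ) (b j : ℕ) : Prop :=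
  ∃ s ≤ w.length, ∃ x ≤ w.length, x = s + j ∧ (w.take s).countP sep = b ∧
    (s = 0 ∨ ∃ y ≤ w.length, s = y + 1 ∧ LetterAt sep w y) ∧ LetterAt p w x ∧
    (w.take x).countP sep = b

namespace Definable

lemma letterAt (p : Γ → Bool) {t : (Fin d → ℕ) → ℕ} (ht : IsTerm t) :
    Definable fun w e => LetterAt p w (t e) := by
  refine subst (P := fun w _ x => LetterAt p w x) ht ?_ fun w _ _ h => h.lt_length.le
  refine ((succ IsVar.last.init IsVar.last.init.init).and
    ((countPrefix p IsVar.last.init.init IsVar.last).and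
    (countPrefix p IsVar.last.init IsVar.last).not)).ex
    (P := fun w e c => e (Fin.last (d + 1)) = Fin.init e (Fin.last d) + 1 ∧
      (w.take (Fin.init e (Fin.last d))).countP p = c ∧
      ¬ (w.take (e (Fin.last (d + 1)))).countP p = c) |>.ex
    (P := fun w e y => ∃ c ≤ w.length, y = e (Fin.last d) + 1 ∧
      (w.take (e (Fin.last d))).countP p = c ∧ ¬ (w.take y).countP p = c) |>.congr fun w e _ => ?_
  rw [← countP_take_succ_ne_iff]
  constructor
  · rintro ⟨_, -, _, -, rfl, rfl, h⟩
    exact h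
  · intro h
    have h' := ((countP_take_succ_ne_iff _ _ _).1 h).lt_length
    refine ⟨_, h', _, List.countP_le_length.trans ?_, rfl, rfl, h⟩
    rw [List.length_take]
    exact min_le_right _ _

lemma blockLetter (sep p : Γ → Bool) {s t : (Fin d → ℕ) → ℕ} (hs : IsTerm s) (ht : IsTerm t) :
    Definable fun w e => BlockLetter sep p w (s e) (t e) := by
  refine subst (P := fun w e b => BlockLetter sep p w b (t e)) hs
    (subst (P := fun w e j => BlockLetter sep p w (e (Fin.last d)) j) ht.init ?_ ?_) ?_
  · exact .ex <| .ex <| .and (eq_term IsVar.last (.add IsVar.last.init.term IsVar.last.init.init.term))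
      <| .and (countPrefix sep IsVar.last.init IsVar.last.init.init.init)
      <| .and (.or (zero IsVar.last.init) <| .ex <| .and (succ IsVar.last.init.init IsVar.last)
        (letterAt sep IsTerm.last))
      <| .and (letterAt p IsTerm.last) (countPrefix sep IsVar.last IsVar.last.init.init.init)
  · rintro w e j ⟨s, -, x, hx, rfl, -⟩
    omega
  · rintro w e b ⟨s, -, x, -, -, rfl, -⟩
    refine List.countP_le_length.trans ?_
    rw [List.length_take]
    exact min_le_right _ _

end Definable

end WordFormula

open WordFormula

/-! ### The formula for certificates -/

/-- The alphabet of the words that present pairs of an instance and a candidate certificate. -/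
abbrev PairLetter : Type := Option Bool ⊕ Option Bool

namespace PairLetter

/-- The separators. -/
def isSep : PairLetter → Bool
  | .inl none => true
  | .inr none => true
  | _ => false

/-- The separators in the instance. -/
def isRowSep : PairLetter → Bool
  | .inl none => true
  | _ => false

/-- The bit `1` in the instance. -/
def isOne : PairLetter → Bool
  | .inl (some true) => true
  | _ => false

/-- The letter that does not occur in certificates. -/
def isBad : PairLetter → Bool
  | .inr (some false) => true
  | _ => false

/-- The block `b` has length `j`. -/
def BlockLength (w : List PairLetter) (b j : ℕ) : Prop := BlockLetter isSep isSep w b j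

/-- The bit `j` of the block `b` is `1`. -/
def BlockBit (w : List PairLetter) (b j : ℕ) : Prop := BlockLetter isSep isOne w b j

/-- All the words behind the instance are unary. -/
def IsUnary (w : List PairLetter) : Prop :=
  (∀ x ≤ w.length, ¬ LetterAt isBad w x) ∧
  (∀ x ≤ w.length, LetterAt (fun _ => true) w x → ¬ LetterAt (fun _ => true) w (x + 1) →
    LetterAt isSep w x)

/-- The blocks `n + 1, …, 2 n` present a drift partition with the maximal index `k`. -/
def IsDrift (w : List PairLetter) (n k : ℕ) : Prop :=
  -- Blocks `0, …, n - 1` are the rows of the instance, block `n` holds `k`, and block `n + 1 + u`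
  -- holds the index of `u`. Numbers are lengths of blocks. The adjacency bits of a row start at
  -- position `4`.
  (∀ u ≤ w.length, u < n → ∃ i ≤ w.length, i ≤ k ∧ BlockLength w (n + 1 + u) i) ∧
  (∀ i ≤ w.length, i ≤ k → ∃ u ≤ w.length, u < n ∧ BlockLength w (n + 1 + u) i) ∧
  -- Both drift conditions at once: an edge to a higher block must start at a drift vertex, and in
  -- particular at a vertex of Nature.
  (∀ u ≤ w.length, u < n → ∀ v ≤ w.length, v < n → ∀ i ≤ w.length, ∀ j ≤ w.length,
    BlockLength w (n + 1 + u) i → BlockLength w (n + 1 + v) j → BlockBit w u (4 + v) → i < j →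
    ¬ BlockBit w u 0 ∧ ¬ i = 0 ∧ i < k ∧ ∃ v' ≤ w.length, v' < n ∧ BlockBit w u (4 + v') ∧
      ∃ j' ≤ w.length, j' < i ∧ BlockLength w (n + 1 + v') j')

/-- The blocks from `2 n + 1` on present a simple path in the last block of the partition. -/
def IsPath (w : List PairLetter) (n k : ℕ) : Prop :=
  (∀ b ≤ w.length, ∀ q ≤ w.length, BlockLength w (n + n + 1 + b) q →
    q < n ∧ BlockLength w (n + 1 + q) k) ∧
  (∀ b ≤ w.length, ∀ q ≤ w.length, ∀ q' ≤ w.length, BlockLength w (n + n + 1 + b) q →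
    BlockLength w (n + n + 1 + (b + 1)) q' → BlockBit w q (4 + q')) ∧
  (∀ b ≤ w.length, ∀ b' ≤ w.length, ∀ q ≤ w.length, BlockLength w (n + n + 1 + b) q →
    BlockLength w (n + n + 1 + b') q → b = b') ∧
  (∃ q ≤ w.length, BlockLength w (n + n + 1 + 0) q ∧ BlockBit w q 3) ∧
  -- The last vertex of the path is the one whose block has no successor.
  (∃ b ≤ w.length, ∃ q ≤ w.length, BlockLength w (n + n + 1 + b) q ∧
    (∀ q' ≤ w.length, ¬ BlockLength w (n + n + 1 + (b + 1)) q') ∧ BlockBit w q 1)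

/-- The word presents an instance and a valid certificate. -/
def IsCertified (w : List PairLetter) : Prop :=
  -- As the largest value of a variable, `m` is the length of the word, so `n` counts all its row
  -- separators.
  IsUnary w ∧ ∃ n ≤ w.length, (∃ m ≤ w.length, (∀ x ≤ w.length, x ≤ m) ∧
    (w.take m).countP isRowSep = n) ∧ ∃ k ≤ w.length, BlockLength w n k ∧
    IsDrift w n k ∧ IsPath w n k ∧
    (∀ u ≤ w.length, u < n → BlockBit w u 1 → BlockLength w (n + 1 + u) k) ∧
    (∀ u ≤ w.length, u < n → BlockBit w u 2 → ¬ BlockLength w (n + 1 + u) k)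

open Definable

section

variable {d : ℕ} {x y : (Fin d → ℕ) → ℕ}

lemma definable_blockLength {s t : (Fin d → ℕ) → ℕ} (hs : IsTerm s) (ht : IsTerm t) :
    Definable fun w e => BlockLength w (s e) (t e) := blockLetter _ _ hs ht

lemma definable_blockBit {s t : (Fin d → ℕ) → ℕ} (hs : IsTerm s) (ht : IsTerm t) :
    Definable fun w e => BlockBit w (s e) (t e) := blockLetter _ _ hs ht

lemma definable_isUnary : Definable fun w (_ : Fin d → ℕ) => IsUnary w :=
  .and (.all <| .not <| letterAt _ IsTerm.last)
    (.all <| .imp (letterAt _ IsTerm.last) <| .imp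
      (.not <| letterAt _ <| .add IsTerm.last (.const 1)) (letterAt _ IsTerm.last))

lemma definable_isDrift (hn : IsVar x) (hk : IsVar y) :
    Definable fun w e => IsDrift w (x e) (y e) := by
  refine .and (.all <| .imp (lt IsVar.last hn.init) <| .ex <| .and (le IsVar.last hk.init.init)
    (definable_blockLength (.add (.add hn.init.init.term (.const 1)) IsVar.last.init.term)
      IsTerm.last)) <| .and
    (.all <| .imp (le IsVar.last hk.init) <| .ex <| .and (lt IsVar.last hn.init.init)
    (definable_blockLength (.add (.add hn.init.init.term (.const 1)) IsTerm.last)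
      IsVar.last.init.term)) ?_
  refine .all <| .imp (lt IsVar.last hn.init) <| .all <| .imp (lt IsVar.last hn.init.init) <|
    .all <| .all <| .imp (definable_blockLength
      (.add (.add hn.init.init.init.init.term (.const 1)) IsVar.last.init.init.init.term)
      IsVar.last.init.term) <| .imp (definable_blockLength
      (.add (.add hn.init.init.init.init.term (.const 1)) IsVar.last.init.init.term)
      IsTerm.last) <| .imp (definable_blockBit IsVar.last.init.init.init.term
        (.add (.const 4) IsVar.last.init.init.term)) <|
      .imp (lt IsVar.last.init IsVar.last) <|
      .and (.not <| definable_blockBit IsVar.last.init.init.init.term (.const 0)) <|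
      .and (.not <| zero IsVar.last.init) <| .and (lt IsVar.last.init hk.init.init.init.init) <|
      .ex <| .and (lt IsVar.last hn.init.init.init.init.init) <|
      .and (definable_blockBit IsVar.last.init.init.init.init.term
        (.add (.const 4) IsTerm.last)) <|
      .ex <| .and (lt IsVar.last IsVar.last.init.init.init) <| definable_blockLength
        (.add (.add hn.init.init.init.init.init.init.term (.const 1)) IsVar.last.init.term)
        IsTerm.last

lemma definable_isPath (hn : IsVar x) (hk : IsVar y) :
    Definable fun w e => IsPath w (x e) (y e) := by
  have path : ∀ {d : ℕ} {x t s : (Fin d → ℕ) → ℕ}, IsVar x → IsTerm t → IsTerm s →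
      Definable fun w e => BlockLength w (x e + x e + 1 + t e) (s e) := fun hx ht hs =>
    definable_blockLength (.add (.add (.add hx.term hx.term) (.const 1)) ht) hs
  refine .and ?_ <| .and ?_ <| .and ?_ <| .and ?_ ?_
  · exact .all <| .all <| .imp (path hn.init.init IsVar.last.init.term IsTerm.last) <|
      .and (lt IsVar.last hn.init.init) <| definable_blockLength
        (.add (.add hn.init.init.term (.const 1)) IsTerm.last) hk.init.init.term
  · exact .all <| .all <| .all <|
      .imp (path hn.init.init.init IsVar.last.init.init.term IsVar.last.init.term) <|
      .imp (path hn.init.init.init (.add IsVar.last.init.init.term (.const 1)) IsTerm.last) <|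
      definable_blockBit IsVar.last.init.term (.add (.const 4) IsTerm.last)
  · exact .all <| .all <| .all <|
      .imp (path hn.init.init.init IsVar.last.init.init.term IsTerm.last) <|
      .imp (path hn.init.init.init IsVar.last.init.term IsTerm.last) <|
      eq IsVar.last.init.init IsVar.last.init
  · exact .ex <| .and (path hn.init (.const 0) IsTerm.last) <|
      definable_blockBit IsTerm.last (.const 3)
  · exact .ex <| .ex <| .and (path hn.init.init IsVar.last.init.term IsTerm.last) <| .and
      (.all <| .not <| path hn.init.init.init (.add IsVar.last.init.init.term (.const 1))
        IsTerm.last) <|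
      definable_blockBit IsTerm.last (.const 1)

end

theorem definable_isCertified :
    Definable (d := 0) fun w _ => IsCertified w := by
  refine .and definable_isUnary <| .ex <| .and (.ex <| .and (.all <| le IsVar.last IsVar.last.init)
    (countPrefix _ IsVar.last IsVar.last.init)) <| .ex <|
    .and (definable_blockLength IsVar.last.init.term IsTerm.last) <|
    .and (definable_isDrift IsVar.last.init IsVar.last) <|
    .and (definable_isPath IsVar.last.init IsVar.last) <| .and ?_ ?_
  · exact .all <| .imp (lt IsVar.last IsVar.last.init.init) <|
      .imp (definable_blockBit IsTerm.last (.const 1)) <| definable_blockLength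
        (.add (.add IsVar.last.init.init.term (.const 1)) IsTerm.last) IsVar.last.init.term
  · exact .all <| .imp (lt IsVar.last IsVar.last.init.init) <|
      .imp (definable_blockBit IsTerm.last (.const 2)) <| .not <| definable_blockLength
        (.add (.add IsVar.last.init.init.term (.const 1)) IsTerm.last) IsVar.last.init.term

end PairLetter

/-! ### Words as sequences of blocks -/

namespace WordFormula

variable {Γ : Type}

/-- Words that end with their only separator. -/
def IsBlock (sep : Γ → Bool) (B : List Γ) : Prop :=
  ∃ l a, B = l ++ [a] ∧ (∀ c ∈ l, sep c = false) ∧ sep a = true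

lemma letterAt_append (p : Γ → Bool) (B w : List Γ) (x : ℕ) : LetterAt p (B ++ w) x ↔
    x < B.length ∧ LetterAt p B x ∨ B.length ≤ x ∧ LetterAt p w (x - B.length) := by
  unfold LetterAt
  rcases lt_or_ge x B.length with h | h
  · rw [List.getElem?_append_left h]
    simp [h, not_le.2 h]
  · rw [List.getElem?_append_right h]
    simp [h, not_lt.2 h]

lemma IsBlock.letterAt_sep_iff {sep : Γ → Bool} {B : List Γ} (h : IsBlock sep B) (x : ℕ) :
    LetterAt sep B x ↔ x + 1 = B.length := by
  obtain ⟨l, a, rfl, hl, ha⟩ := h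
  rw [letterAt_append]
  constructor
  · rintro (⟨-, c, hc, hc'⟩ | ⟨h, h'⟩)
    · have := hl c (List.mem_of_getElem? hc)
      simp [this] at hc'
    · have := h'.lt_length
      simp at this ⊢
      omega
  · intro h
    have hx : x = l.length := by simpa using h
    subst hx
    exact .inr ⟨le_rfl, a, by simp, ha⟩

lemma IsBlock.countP_take {sep : Γ → Bool} {B : List Γ} (h : IsBlock sep B) (x : ℕ) :
    (B.take x).countP sep = if x < B.length then 0 else 1 := by
  obtain ⟨l, a, rfl, hl, ha⟩ := h
  split_ifs with hx
  · have : x ≤ l.length := by simp at hx; omega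
    rw [List.take_append_of_le_length this, List.countP_eq_zero]
    intro c hc
    simp [hl c (List.mem_of_mem_take hc)]
  · rw [List.take_of_length_le (not_lt.1 hx), List.countP_append, List.countP_eq_zero.2]
    · simp [ha]
    · intro c hc
      simp [hl c hc]

/-- Induction on the number of blocks. The prefix count of separators is `0` throughout the first
block and `1` at its end, so both it and the positions shift uniformly afterwards. The count alone
does not fix the start `s` of a block; the requirement that `s` be `0` or follow a separator does.
-/
lemma blockLetter_flatten (sep p : Γ → Bool) (Bs : List (List Γ)) (hBs : ∀ B ∈ Bs, IsBlock sep B)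
    (b j : ℕ) : BlockLetter sep p Bs.flatten b j ↔ ∃ B, Bs[b]? = some B ∧ LetterAt p B j := by
  induction Bs generalizing b with
  | nil =>
    constructor
    · rintro ⟨_, -, _, -, -, -, -, h, -⟩
      simpa using h.lt_length
    · rintro ⟨B, h, -⟩
      simp at h
  | cons B Bs ih =>
    have hB := hBs B (by simp)
    have ih := fun b => ih (fun C hC => hBs C (by simp [hC])) b
    have hcnt : ∀ x, ((B ++ Bs.flatten).take x).countP sep =
        (if x < B.length then 0 else 1) + (Bs.flatten.take (x - B.length)).countP sep := by
      intro x
      rw [List.take_append, List.countP_append, hB.countP_take]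
    have hpos : 0 < B.length := by
      obtain ⟨l, a, rfl, -⟩ := hB
      simp
    rw [List.flatten_cons]
    cases b with
    | zero =>
      simp only [List.getElem?_cons_zero, Option.some.injEq, exists_eq_left']
      constructor
      · rintro ⟨s, hs, x, hx, rfl, hs0, hs', hp, hx0⟩
        rw [hcnt] at hs0 hx0
        have h1 : s < B.length := by by_contra h; simp [h] at hs0
        have h2 : s + j < B.length := by by_contra h; simp [h] at hx0
        rcases hs' with rfl | ⟨y, -, rfl, hy⟩
        · rw [zero_add] at hp h2
          rw [letterAt_append] at hp
          rcases hp with hp | hp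
          · exact hp.2
          · omega
        · rw [letterAt_append, hB.letterAt_sep_iff] at hy
          omega
      · intro h
        have hj := h.lt_length
        refine ⟨0, Nat.zero_le _, j, by simp; omega, (zero_add j).symm, by simp, .inl rfl,
          (letterAt_append _ _ _ _).2 (.inl ⟨hj, h⟩), ?_⟩
        rw [hcnt, if_pos hj, Nat.sub_eq_zero_of_le hj.le]
        simp
    | succ b =>
      rw [List.getElem?_cons_succ, ← ih]
      constructor
      · rintro ⟨s, hs, x, hx, rfl, hsb, hs', hp, hxb⟩
        rw [hcnt] at hsb hxb
        rw [List.length_append] at hs hx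
        have h1 : B.length ≤ s := by
          by_contra h
          rw [if_pos (not_le.1 h), Nat.sub_eq_zero_of_le (not_le.1 h).le] at hsb
          simp at hsb
        rw [if_neg (by omega)] at hsb hxb
        refine ⟨s - B.length, by omega, s + j - B.length, by omega, by omega, by omega, ?_, ?_,
          by omega⟩
        · rcases hs' with rfl | ⟨y, -, rfl, hy⟩
          · omega
          · rcases Nat.eq_or_lt_of_le h1 with h | h
            · exact .inl (by omega)
            · rw [letterAt_append] at hy
              rcases hy with hy | hy
              · omega
              · refine .inr ⟨y - B.length, by omega, by omega, hy.2⟩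
        · rw [letterAt_append] at hp
          rcases hp with hp | hp
          · omega
          · exact hp.2
      · rintro ⟨s, hs, x, hx, rfl, hsb, hs', hp, hxb⟩
        refine ⟨B.length + s, by rw [List.length_append]; omega, B.length + (s + j), by rw [List.length_append]; omega, by omega, ?_, .inr ?_,
          ?_, ?_⟩
        · rw [hcnt, if_neg (by omega), Nat.add_sub_cancel_left, hsb, add_comm]
        · rcases hs' with rfl | ⟨y, hy, rfl, hy'⟩
          · refine ⟨B.length - 1, by simp; omega, by omega, ?_⟩
            rw [letterAt_append, hB.letterAt_sep_iff]
            omega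
          · refine ⟨B.length + y, by rw [List.length_append]; omega, by omega, ?_⟩
            rw [letterAt_append, Nat.add_sub_cancel_left]
            exact .inr ⟨by omega, hy'⟩
        · rw [letterAt_append, Nat.add_sub_cancel_left]
          exact .inr ⟨by omega, hp⟩
        · rw [hcnt, if_neg (by omega), Nat.add_sub_cancel_left, hxb, add_comm]

lemma BlockLetter.le_length {sep p : Γ → Bool} {w : List Γ} {b j : ℕ}
    (h : BlockLetter sep p w b j) : b ≤ w.length ∧ j ≤ w.length := by
  obtain ⟨s, -, x, hx, rfl, rfl, -⟩ := h
  refine ⟨List.countP_le_length.trans ?_, by omega⟩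
  rw [List.length_take]
  exact min_le_right _ _

/-- The last letter of a sequence of blocks is a separator. -/
lemma letterAt_sep_flatten (sep : Γ → Bool) (Bs : List (List Γ)) (hBs : ∀ B ∈ Bs, IsBlock sep B)
    {x : ℕ} (h : LetterAt (fun _ => true) Bs.flatten x)
    (h' : ¬ LetterAt (fun _ => true) Bs.flatten (x + 1)) : LetterAt sep Bs.flatten x := by
  have hx := h.lt_length
  have hx' : Bs.flatten.length ≤ x + 1 := by
    by_contra hlt
    exact h' ⟨_, List.getElem?_eq_getElem (not_le.1 hlt), rfl⟩
  rcases List.eq_nil_or_concat' Bs with rfl | ⟨Bs', B, rfl⟩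
  · simp at hx
  · have hB := hBs B (by simp)
    have hpos : 0 < B.length := by
      obtain ⟨l, a, rfl, -⟩ := hB
      simp
    rw [List.flatten_append, List.flatten_singleton, List.length_append] at hx hx'
    rw [List.flatten_append, List.flatten_singleton, letterAt_append, hB.letterAt_sep_iff]
    omega

end WordFormula

/-! ### Words of certificates -/

/-- Without the letter `some false` a word is a sequence of unary numbers, followed by a possibly
unfinished one. -/
lemma exists_eq_flatten_unaryWord_append {y : List (Option Bool)} (h : some false ∉ y) :
    ∃ (l : List ℕ) (m : ℕ), y = (l.map unaryWord).flatten ++ List.replicate m (some true) := by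
  induction y using List.reverseRecOn with
  | nil => exact ⟨[], 0, rfl⟩
  | append_singleton y a ih =>
    obtain ⟨l, m, rfl⟩ := ih fun h' => h (List.mem_append_left _ h')
    match a with
    | none => exact ⟨l ++ [m], 0, by simp [unaryWord]⟩
    | some true => exact ⟨l, m + 1, by rw [List.replicate_succ', List.append_assoc]⟩
    | some false => simp at h

namespace PairLetter

/-- The row of a vertex in the presentation of an instance. -/
def row (x : NWRInstance) (u : Fin x.n) : List (Option Bool) :=
  open scoped Classical in
  [some (decide (u ∈ x.arena.VP)), some (decide (u ∈ x.arena.T)),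
    some (decide (u ∈ x.W)), some (decide (u = x.v))] ++
    (List.ofFn fun w : Fin x.n => some (decide (x.arena.E u w))) ++ [none]

lemma encode_eq (x : NWRInstance) : x.encode = (List.ofFn (row x)).flatten := rfl

/-- The word of an instance and a list of numbers. -/
def pairWord (x : NWRInstance) (l : List ℕ) : List PairLetter :=
  x.encode.map Sum.inl ++ ((l.map unaryWord).flatten).map Sum.inr

/-- The blocks of the word of an instance and a list of numbers. -/
def blocks (x : NWRInstance) (l : List ℕ) : List (List PairLetter) :=
  (List.ofFn fun u => (row x u).map Sum.inl) ++ l.map fun q => (unaryWord q).map Sum.inr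

lemma flatten_blocks (x : NWRInstance) (l : List ℕ) : (blocks x l).flatten = pairWord x l := by
  rw [blocks, pairWord, List.flatten_append, encode_eq, List.map_flatten, List.map_flatten,
    List.map_map, List.map_ofFn]
  rfl

lemma isBlock_row (x : NWRInstance) (u : Fin x.n) : IsBlock isSep ((row x u).map Sum.inl) := by
  classical
  refine ⟨_, Sum.inl none, List.map_append, ?_, rfl⟩
  intro c hc
  simp only [List.map_append, List.mem_append, List.mem_map, List.mem_ofFn] at hc
  rcases hc with ⟨a, ha, rfl⟩ | ⟨a, ⟨i, rfl⟩, rfl⟩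
  · simp at ha
    rcases ha with rfl | rfl | rfl | rfl <;> rfl
  · rfl

lemma isBlock_unaryWord (q : ℕ) : IsBlock isSep ((unaryWord q).map Sum.inr) := by
  refine ⟨_, Sum.inr none, List.map_append, ?_, rfl⟩
  intro c hc
  simp at hc
  rw [hc.2]
  rfl

lemma isBlock_of_mem_blocks {x : NWRInstance} {l : List ℕ} {B : List PairLetter}
    (hB : B ∈ blocks x l) : IsBlock isSep B := by
  rw [blocks, List.mem_append, List.mem_ofFn, List.mem_map] at hB
  rcases hB with ⟨u, rfl⟩ | ⟨q, -, rfl⟩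
  · exact isBlock_row x u
  · exact isBlock_unaryWord q

lemma blockLetter_pairWord (p : PairLetter → Bool) (x : NWRInstance) (l : List ℕ) (b j : ℕ) :
    BlockLetter isSep p (pairWord x l) b j ↔ ∃ B, (blocks x l)[b]? = some B ∧ LetterAt p B j := by
  rw [← flatten_blocks]
  exact blockLetter_flatten _ _ _ (fun _ => isBlock_of_mem_blocks) _ _

lemma blocks_row (x : NWRInstance) (l : List ℕ) (u : Fin x.n) :
    (blocks x l)[(u : ℕ)]? = some ((row x u).map Sum.inl) := by
  rw [blocks, List.getElem?_append_left (by simp)]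
  simp

/-- The separator of a unary block stands at the position equal to the number presented. -/
lemma blockLength_pairWord (x : NWRInstance) (l : List ℕ) (i q : ℕ) :
    BlockLength (pairWord x l) (x.n + i) q ↔ l[i]? = some q := by
  rw [BlockLength, blockLetter_pairWord, blocks, List.getElem?_append_right (by simp)]
  simp only [List.length_ofFn, Nat.add_sub_cancel_left, List.getElem?_map, Option.map_eq_some_iff]
  constructor
  · rintro ⟨B, ⟨r, hr, rfl⟩, h⟩
    rw [(isBlock_unaryWord r).letterAt_sep_iff] at h
    simp [unaryWord] at h
    rw [hr, h]
  · intro h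
    refine ⟨_, ⟨q, h, rfl⟩, ?_⟩
    rw [(isBlock_unaryWord q).letterAt_sep_iff]
    simp [unaryWord]

lemma blockBit_pairWord (x : NWRInstance) (l : List ℕ) (u : Fin x.n) (j : ℕ) :
    BlockBit (pairWord x l) u j ↔ (row x u)[j]? = some (some true) := by
  rw [BlockBit, blockLetter_pairWord, blocks_row]
  simp only [Option.some.injEq, exists_eq_left', LetterAt, List.getElem?_map,
    Option.map_eq_some_iff]
  constructor
  · rintro ⟨a, ⟨b, hb, rfl⟩, ha⟩
    match b with
    | some true => exact hb
    | some false => simp [isOne] at ha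
    | none => simp [isOne] at ha
  · intro h
    exact ⟨_, ⟨_, h, rfl⟩, rfl⟩

section Bits

variable (x : NWRInstance) (l : List ℕ) (u : Fin x.n)

lemma blockBit_zero : BlockBit (pairWord x l) u 0 ↔ u ∈ x.arena.VP := by
  rw [blockBit_pairWord]; simp [row]

lemma blockBit_one : BlockBit (pairWord x l) u 1 ↔ u ∈ x.arena.T := by
  rw [blockBit_pairWord]; simp [row]

lemma blockBit_two : BlockBit (pairWord x l) u 2 ↔ u ∈ x.W := by
  rw [blockBit_pairWord]; simp [row]

lemma blockBit_three : BlockBit (pairWord x l) u 3 ↔ u = x.v := by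
  rw [blockBit_pairWord]; simp [row]

lemma blockBit_four_add (v : Fin x.n) :
    BlockBit (pairWord x l) u (4 + v) ↔ x.arena.E u v := by
  rw [blockBit_pairWord]
  simp [row, add_comm 4]

end Bits

lemma countP_isRowSep_pairWord (x : NWRInstance) (l : List ℕ) :
    (pairWord x l).countP isRowSep = x.n := by
  rw [← flatten_blocks, List.countP_flatten, blocks, List.map_append, List.sum_append,
    List.map_ofFn, List.map_map]
  have h1 : (List.countP isRowSep ∘ fun u => (row x u).map Sum.inl) = fun _ => 1 := by
    classical
    funext u
    simp only [Function.comp, row, List.map_append, List.countP_append]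
    rw [List.countP_eq_zero.2, List.countP_eq_zero.2]
    · rfl
    · intro c hc
      simp only [List.mem_map, List.mem_ofFn] at hc
      obtain ⟨a, ⟨i, rfl⟩, rfl⟩ := hc
      simp [isRowSep]
    · intro c hc
      simp at hc
      rcases hc with rfl | rfl | rfl | rfl <;> simp [isRowSep]
  have h2 : (List.countP isRowSep ∘ fun q => (unaryWord q).map Sum.inr) = fun _ => 0 := by
    funext q
    simp only [Function.comp]
    rw [List.countP_eq_zero]
    intro c hc
    rw [List.mem_map] at hc
    obtain ⟨a, -, rfl⟩ := hc
    simp [isRowSep]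
  rw [h1, h2]
  simp

lemma isUnary_pairWord (x : NWRInstance) (l : List ℕ) : IsUnary (pairWord x l) := by
  refine ⟨?_, fun y _ h h' => ?_⟩
  · rintro y - ⟨a, ha, ha'⟩
    have hm := List.mem_of_getElem? ha
    rw [pairWord, List.mem_append] at hm
    rcases hm with hm | hm
    · obtain ⟨b, -, rfl⟩ := List.mem_map.1 hm
      simp [isBad] at ha'
    · obtain ⟨b, hb, rfl⟩ := List.mem_map.1 hm
      simp [unaryWord] at hb
      obtain ⟨q, -, hb | hb⟩ := hb
      · rw [hb.2] at ha'
        simp [isBad] at ha'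
      · rw [hb] at ha'
        simp [isBad] at ha'
  · rw [← flatten_blocks] at h h' ⊢
    exact letterAt_sep_flatten _ _ (fun _ => isBlock_of_mem_blocks) h h'

/-- Needed because witnesses in NP are arbitrary words. An unfinished number at the end is
impossible, as the last letter must be a separator. -/
lemma exists_eq_flatten_of_isUnary {X y : List (Option Bool)}
    (h : IsUnary (X.map Sum.inl ++ y.map Sum.inr)) : ∃ l : List ℕ, y = (l.map unaryWord).flatten := by
  have hbad : some false ∉ y := by
    intro hy
    obtain ⟨i, hi⟩ := List.mem_iff_getElem?.1 hy
    have : LetterAt isBad (X.map Sum.inl ++ y.map Sum.inr) (X.length + i) := by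
      rw [letterAt_append]
      exact .inr ⟨by simp, Sum.inr (some false), by simp [hi], rfl⟩
    exact h.1 _ this.lt_length.le this
  obtain ⟨l, m, rfl⟩ := exists_eq_flatten_unaryWord_append hbad
  cases m with
  | zero => exact ⟨l, by simp⟩
  | succ m =>
    exfalso
    rw [List.replicate_succ', ← List.append_assoc, List.map_append, ← List.append_assoc] at h
    set w := X.map Sum.inl ++
      ((l.map unaryWord).flatten ++ List.replicate m (some true)).map Sum.inr with hw
    obtain ⟨a, ha, ha'⟩ := h.2 w.length (by simp) ⟨Sum.inr (some true), by simp, rfl⟩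
      (fun h' => by have := h'.lt_length; simp at this)
    have : Sum.inr (some true) = a := by simpa using ha
    subst this
    simp [isSep] at ha'

end PairLetter

/-! ### Certificates as lists of numbers -/

namespace Certificate

variable {n : ℕ} (c : Certificate (Fin n))

/-- The numbers by which a certificate is presented. -/
def toList : List ℕ :=
  c.k :: (List.ofFn fun u => (c.part u : ℕ)) ++ c.path.map Fin.val

lemma encode_eq : c.encode = (c.toList.map unaryWord).flatten := by
  -- In `encode` the vertices of the path become numbers through the list monad, which amounts to
  -- mapping `Fin.val`.
  have h : (do let a ← c.path; pure (a : ℕ)) = c.path.map Fin.val := by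
    rw [List.bind_eq_flatMap, List.map_eq_flatMap]
    rfl
  simp only [encode, toList, List.cons_append, List.map_cons, List.map_append, h,
    List.flatten_cons, List.flatten_append, List.map_ofFn, List.append_assoc]
  rfl

lemma toList_zero : c.toList[0]? = some c.k := rfl

lemma toList_part (u : Fin n) : c.toList[1 + (u : ℕ)]? = some (c.part u : ℕ) := by
  rw [toList, List.cons_append, Nat.add_comm 1, List.getElem?_cons_succ,
    List.getElem?_append_left (by simp)]
  simp

lemma toList_path (b : ℕ) : c.toList[n + 1 + b]? = (c.path[b]?).map Fin.val := by
  rw [toList, List.cons_append, show n + 1 + b = n + b + 1 by omega, List.getElem?_cons_succ,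
    List.getElem?_append_right (by simp)]
  simp

end Certificate

namespace PairLetter

lemma encodeWithCertificate_eq (x : NWRInstance) (c : Certificate (Fin x.n)) :
    encodeWithCertificate ⟨x, c⟩ = pairWord x c.toList := by
  rw [encodeWithCertificate, pairWord, Certificate.encode_eq]

lemma BlockLength.le_length {w : List PairLetter} {b j : ℕ} (h : BlockLength w b j) :
    b ≤ w.length ∧ j ≤ w.length := BlockLetter.le_length h

lemma n_le_length (x : NWRInstance) (l : List ℕ) : x.n ≤ (pairWord x l).length := by
  rw [← countP_isRowSep_pairWord x l]
  exact List.countP_le_length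

lemma blockLength_index {x : NWRInstance} {l : List ℕ} {q : ℕ} :
    BlockLength (pairWord x l) x.n q ↔ l[0]? = some q := blockLength_pairWord x l 0 q

lemma blockLength_part {x : NWRInstance} {l : List ℕ} {u q : ℕ} :
    BlockLength (pairWord x l) (x.n + 1 + u) q ↔ l[1 + u]? = some q := by
  rw [add_assoc, blockLength_pairWord]

lemma blockLength_path {x : NWRInstance} {l : List ℕ} {b q : ℕ} :
    BlockLength (pairWord x l) (x.n + x.n + 1 + b) q ↔ l[x.n + 1 + b]? = some q := by
  rw [add_assoc, add_assoc, blockLength_pairWord, add_assoc]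

lemma isCertified_pairWord (x : NWRInstance) (l : List ℕ) :
    IsCertified (pairWord x l) ↔ ∃ k, BlockLength (pairWord x l) x.n k ∧
      IsDrift (pairWord x l) x.n k ∧ IsPath (pairWord x l) x.n k ∧
      (∀ u : Fin x.n, u ∈ x.arena.T → BlockLength (pairWord x l) (x.n + 1 + u) k) ∧
      (∀ u : Fin x.n, u ∈ x.W → ¬ BlockLength (pairWord x l) (x.n + 1 + u) k) := by
  have hn := n_le_length x l
  constructor
  · rintro ⟨-, n, -, ⟨m, hm, hm', rfl⟩, k, -, hk, hd, hp, hT, hW⟩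
    have : (pairWord x l).length = m := le_antisymm (hm' _ le_rfl) hm
    subst this
    rw [List.take_length, countP_isRowSep_pairWord] at *
    exact ⟨k, hk, hd, hp,
      fun u hu => hT u (u.2.le.trans hn) u.2 ((blockBit_one x l u).2 hu),
      fun u hu => hW u (u.2.le.trans hn) u.2 ((blockBit_two x l u).2 hu)⟩
  · rintro ⟨k, hk, hd, hp, hT, hW⟩
    refine ⟨isUnary_pairWord x l, x.n, hn, ⟨_, le_rfl, fun _ h => h, ?_⟩, k, hk.le_length.2, hk,
      hd, hp, fun u _ hu h => hT ⟨u, hu⟩ ((blockBit_one x l ⟨u, hu⟩).1 h),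
      fun u _ hu h => hW ⟨u, hu⟩ ((blockBit_two x l ⟨u, hu⟩).1 h)⟩
    rw [List.take_length, countP_isRowSep_pairWord]

/-- Every list of numbers with the property comes from a certificate. -/
lemma exists_eq_toList {x : NWRInstance} {l : List ℕ} (h : IsCertified (pairWord x l)) :
    ∃ c : Certificate (Fin x.n), l = c.toList := by
  have hn := n_le_length x l
  obtain ⟨k, hk, hd, hp, -, -⟩ := (isCertified_pairWord x l).1 h
  rw [blockLength_index] at hk
  have hpart : ∀ u : Fin x.n, ∃ i : Fin (k + 1), l[1 + (u : ℕ)]? = some (i : ℕ) := by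
    intro u
    obtain ⟨i, -, hi, hi'⟩ := hd.1 u (u.2.le.trans hn) u.2
    exact ⟨⟨i, Nat.lt_succ_of_le hi⟩, blockLength_part.1 hi'⟩
  choose part hpart using hpart
  -- The first clause of `IsPath` makes every remaining number a vertex.
  have hpath : ∀ q ∈ l.drop (x.n + 1), q < x.n := by
    intro q hq
    obtain ⟨b, hb⟩ := List.mem_iff_getElem?.1 hq
    rw [List.getElem?_drop, ← blockLength_path] at hb
    exact (hp.1 b (by have := hb.le_length.1; omega) q hb.le_length.2 hb).1
  refine ⟨⟨k, part, (l.drop (x.n + 1)).pmap Fin.mk hpath⟩, List.ext_getElem? fun i => ?_⟩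
  rcases Nat.eq_zero_or_pos i with rfl | hi
  · rw [hk, Certificate.toList_zero]
  rcases lt_or_ge i (x.n + 1) with hi' | hi'
  · obtain ⟨u, rfl⟩ : ∃ u : Fin x.n, i = 1 + u := ⟨⟨i - 1, by omega⟩, by simp; omega⟩
    rw [hpart, Certificate.toList_part]
  · obtain ⟨b, rfl⟩ := Nat.exists_eq_add_of_le hi'
    rw [Certificate.toList_path, ← List.getElem?_map, List.map_pmap, List.pmap_eq_map,
      List.map_id', List.getElem?_drop]

section

variable {x : NWRInstance} {c : Certificate (Fin x.n)}

lemma blockLength_toList_part {u : Fin x.n} {q : ℕ} :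
    BlockLength (pairWord x c.toList) (x.n + 1 + u) q ↔ (c.part u : ℕ) = q := by
  rw [blockLength_part, Certificate.toList_part, Option.some_inj]

lemma blockLength_toList_path {b q : ℕ} :
    BlockLength (pairWord x c.toList) (x.n + x.n + 1 + b) q ↔
      ∃ a, c.path[b]? = some a ∧ (a : ℕ) = q := by
  rw [blockLength_path, Certificate.toList_path, Option.map_eq_some_iff]

lemma isDrift_toList : IsDrift (pairWord x c.toList) x.n c.k ↔
    x.arena.IsDriftPartition c.part := by
  have hn := n_le_length x c.toList
  have hk : c.k ≤ (pairWord x c.toList).length :=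
    (blockLength_index.2 c.toList_zero).le_length.2
  have hnk : ∀ u : Fin x.n, (c.part u : ℕ) ≤ (pairWord x c.toList).length := fun u =>
    (Nat.le_of_lt_succ (c.part u).2).trans hk
  have hnu : ∀ u : Fin x.n, (u : ℕ) ≤ (pairWord x c.toList).length := fun u => u.2.le.trans hn
  constructor
  · rintro ⟨-, h2, h3⟩
    have h3 : ∀ u v, x.arena.E u v → c.part u < c.part v → u ∉ x.arena.VP ∧
        u ∈ x.arena.driftVertices c.part := by
      intro u v huv hlt
      obtain ⟨h1, h2, h3, v', hv', hv'n, hE, j', -, hj', hj''⟩ := h3 u (hnu u) u.2 v (hnu v) v.2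
        _ (hnk u) _ (hnk v) (blockLength_toList_part.2 rfl) (blockLength_toList_part.2 rfl)
        ((blockBit_four_add _ _ _ _).2 huv) hlt
      rw [blockBit_zero] at h1
      lift v' to Fin x.n using hv'n
      obtain rfl := blockLength_toList_part.1 hj''
      exact ⟨h1, (TargetArena.mem_driftVertices ..).2 ⟨⟨Nat.pos_of_ne_zero h2, h3⟩, h1, v',
        (blockBit_four_add ..).1 hE, hj'⟩⟩
    refine ⟨fun i => ?_, ?_, ?_⟩
    · obtain ⟨u, -, hu, hi⟩ := h2 i (by omega) (by omega)
      exact ⟨⟨u, hu⟩, Fin.ext ((blockLength_toList_part (u := ⟨u, hu⟩)).1 hi)⟩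
    · rintro i u ⟨rfl, hu⟩
      refine Set.eq_empty_of_forall_notMem ?_
      rintro v ⟨hv, hv'⟩
      exact (h3 u v hv (by simpa using hv')).1 hu
    · rintro i u ⟨rfl, hu⟩ ⟨v, hv, hv'⟩
      exact (h3 u v hv (by simpa using hv')).2
  · rintro ⟨h1, h2, h3⟩
    refine ⟨fun u _ hu => ⟨_, hnk ⟨u, hu⟩, by omega,
      (blockLength_toList_part (u := ⟨u, hu⟩)).2 rfl⟩, fun i _ hi => ?_, ?_⟩
    · obtain ⟨u, hu⟩ := h1 ⟨i, Nat.lt_succ_of_le hi⟩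
      exact ⟨u, hnu u, u.2, blockLength_toList_part.2 (by rw [hu])⟩
    · intro u _ hu v _ hv i _ j _ hi hj hE hij
      lift u to Fin x.n using hu
      lift v to Fin x.n using hv
      rw [blockLength_toList_part] at hi hj
      rw [blockBit_four_add] at hE
      subst hi hj
      have hu : u ∉ x.arena.VP := by
        intro hu
        have := h2 _ u ⟨rfl, hu⟩
        exact Set.eq_empty_iff_forall_notMem.1 this v ⟨hE, by simpa using hij⟩
      have := h3 _ u ⟨rfl, hu⟩ ⟨v, hE, by simpa using hij⟩
      rw [TargetArena.mem_driftVertices] at this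
      obtain ⟨⟨h0, hk⟩, -, v', hE', hlt⟩ := this
      exact ⟨(blockBit_zero ..).not.2 hu, (Fin.lt_def.1 h0).ne', hk, v', hnu v', v'.2,
        (blockBit_four_add ..).2 hE', _, hnk v', hlt, blockLength_toList_part.2 rfl⟩

lemma isPath_toList : IsPath (pairWord x c.toList) x.n c.k ↔
    x.arena.IsSimplePathToTarget x.v c.path ∧ ∀ u ∈ c.path, c.part u = Fin.last c.k := by
  have hn := n_le_length x c.toList
  have hnu : ∀ u : Fin x.n, (u : ℕ) ≤ (pairWord x c.toList).length := fun u => u.2.le.trans hn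
  have hb : ∀ {b a}, c.path[b]? = some a → b ≤ (pairWord x c.toList).length := by
    intro b a h
    have := (blockLength_toList_path.2 ⟨a, h, rfl⟩).le_length.1
    omega
  constructor
  · rintro ⟨h1, h2, h3, ⟨q, -, hq, hq'⟩, ⟨b, -, q', -, hb1, hb2, hb3⟩⟩
    refine ⟨⟨?_, ?_, ?_, ?_⟩, ?_⟩
    · rw [List.isChain_iff_getElem]
      intro i hi
      rw [← blockBit_four_add x c.toList]
      have h := List.getElem?_eq_getElem (show i < c.path.length by omega)
      have h' := List.getElem?_eq_getElem hi
      exact h2 i (hb h) _ (hnu _) _ (hnu _) (blockLength_toList_path.2 ⟨_, h, rfl⟩)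
        (blockLength_toList_path.2 ⟨_, h', rfl⟩)
    · rw [List.nodup_iff_getElem?_ne_getElem?]
      intro i j hij hj he
      have h' := List.getElem?_eq_getElem hj
      have h := he.trans h'
      exact hij.ne (h3 i (hb h) j (hb h') _ (hnu _) (blockLength_toList_path.2 ⟨_, h, rfl⟩)
        (blockLength_toList_path.2 ⟨_, h', rfl⟩))
    · obtain ⟨a, ha, rfl⟩ := blockLength_toList_path.1 hq
      rw [blockBit_three] at hq'
      rw [List.head?_eq_getElem?, ha, hq']
    · obtain ⟨a, ha, rfl⟩ := blockLength_toList_path.1 hb1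
      rw [blockBit_one] at hb3
      refine ⟨a, hb3, ?_⟩
      have hlt := (List.getElem?_eq_some_iff.1 ha).1
      have : c.path.length ≤ b + 1 := by
        by_contra hc
        exact hb2 _ (hnu _)
          (blockLength_toList_path.2 ⟨_, List.getElem?_eq_getElem (not_le.1 hc), rfl⟩)
      rw [List.getLast?_eq_getElem?, ← ha]
      congr 1
      omega
    · intro u hu
      obtain ⟨b, hb'⟩ := List.mem_iff_getElem?.1 hu
      exact Fin.ext (blockLength_toList_part.1
        (h1 b (hb hb') u (hnu u) (blockLength_toList_path.2 ⟨_, hb', rfl⟩)).2)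
  · rintro ⟨⟨h1, h2, h3, ⟨t, ht, ht'⟩⟩, h5⟩
    refine ⟨?_, ?_, ?_, ?_, ?_⟩
    · intro b _ q _ hq
      obtain ⟨a, ha, rfl⟩ := blockLength_toList_path.1 hq
      exact ⟨a.2, blockLength_toList_part.2 (by rw [h5 a (List.mem_of_getElem? ha)]; rfl)⟩
    · intro b _ q _ q' _ hq hq'
      obtain ⟨a, ha, rfl⟩ := blockLength_toList_path.1 hq
      obtain ⟨a', ha', rfl⟩ := blockLength_toList_path.1 hq'
      obtain ⟨hi, rfl⟩ := List.getElem?_eq_some_iff.1 ha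
      obtain ⟨hi', rfl⟩ := List.getElem?_eq_some_iff.1 ha'
      exact (blockBit_four_add ..).2 (List.isChain_iff_getElem.1 h1 b hi')
    · intro b _ b' _ q _ hq hq'
      obtain ⟨a, ha, rfl⟩ := blockLength_toList_path.1 hq
      obtain ⟨a', ha', haa⟩ := blockLength_toList_path.1 hq'
      obtain rfl := Fin.ext haa
      exact (List.getElem?_inj (List.getElem?_eq_some_iff.1 ha).1 h2).1 (ha.trans ha'.symm)
    · rw [List.head?_eq_getElem?] at h3
      exact ⟨x.v, hnu _, blockLength_toList_path.2 ⟨_, h3, rfl⟩, (blockBit_three ..).2 rfl⟩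
    · rw [List.getLast?_eq_getElem?] at ht'
      refine ⟨_, hb ht', t, hnu t, blockLength_toList_path.2 ⟨_, ht', rfl⟩, ?_,
        (blockBit_one ..).2 ht⟩
      intro q _ hq
      obtain ⟨a, ha, rfl⟩ := blockLength_toList_path.1 hq
      have := (List.getElem?_eq_some_iff.1 ha).1
      omega

theorem isCertified_toList : IsCertified (pairWord x c.toList) ↔ c.IsValid x.arena x.v x.W := by
  rw [isCertified_pairWord]
  have key : ∀ u : Fin x.n, BlockLength (pairWord x c.toList) (x.n + 1 + u) c.k ↔
      c.part u = Fin.last c.k := fun u => by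
    rw [blockLength_toList_part, Fin.ext_iff, Fin.val_last]
  constructor
  · rintro ⟨k, hk, hd, hp, hT, hW⟩
    obtain rfl : c.k = k := Option.some_inj.1 (blockLength_index.1 hk)
    rw [isDrift_toList] at hd
    rw [isPath_toList] at hp
    exact ⟨hd, hp.1, hp.2, fun u hu => (key u).1 (hT u hu), fun u hu =>
      (mem_layersBelow ..).2 (Fin.lt_last_iff_ne_last.2 fun h => hW u hu ((key u).2 h))⟩
  · rintro ⟨hd, hp, hp', hT, hW⟩
    refine ⟨c.k, blockLength_index.2 c.toList_zero, isDrift_toList.2 hd, isPath_toList.2 ⟨hp, hp'⟩,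
      fun u hu => (key u).2 (hT hu), fun u hu h => ?_⟩
    exact ((mem_layersBelow ..).1 (hW hu)).ne ((key u).1 h)

end

end PairLetter

/-! ### Bounded search -/

/-- The words of length at most `N` over a list of letters. -/
def List.wordsUpTo {Δ : Type} (letters : List Δ) (N : ℕ) : List (List Δ) :=
  Nat.rec [[]] (fun _ L => [] :: L.flatMap fun y => letters.map fun a => a :: y) N

lemma List.mem_wordsUpTo {Δ : Type} {letters : List Δ} (h : ∀ a, a ∈ letters) (N : ℕ)
    (y : List Δ) : y ∈ letters.wordsUpTo N ↔ y.length ≤ N := by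
  induction N generalizing y with
  | zero => simp [wordsUpTo]
  | succ N ih =>
    change y ∈ [] :: ((letters.wordsUpTo N).flatMap fun y => letters.map fun a => a :: y) ↔ _
    cases y with
    | nil => simp
    | cons a y => simp [ih, h]

lemma Primrec.wordsUpTo {Δ : Type} [Primcodable Δ] (letters : List Δ) :
    Primrec letters.wordsUpTo := by
  refine Primrec.nat_rec₁ (f := fun _ L => [] :: L.flatMap fun y => letters.map fun a => a :: y)
    [[]] ?_
  refine Primrec.list_cons.comp (Primrec.const _) (Primrec.list_flatMap Primrec.snd ?_)
  exact Primrec.list_map (Primrec.const _)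
    (Primrec.list_cons.comp Primrec.snd (Primrec.snd.comp Primrec.fst))

/-- Over a finite alphabet there are finitely many words of bounded length, and a primitive
recursive function lists them. -/
lemma WordFormula.primrecPred_exists_le {Γ Δ : Type} [Finite Γ] [Primcodable Γ] [Finite Δ]
    [Primcodable Δ] (φ : WordFormula (Γ ⊕ Δ) 0) {b : ℕ → ℕ} (hb : Primrec b) :
    PrimrecPred fun w : List Γ => ∃ y : List Δ, y.length ≤ b w.length ∧
      φ.Eval (w.map Sum.inl ++ y.map Sum.inr) Fin.elim0 := by
  obtain ⟨letters, hl⟩ := Finite.exists_univ_list Δ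
  have h : PrimrecRel fun (y : List Δ) (w : List Γ) =>
      φ.Eval (w.map Sum.inl ++ y.map Sum.inr) Fin.elim0 := by
    refine φ.primrecPred_eval.comp (f := fun q : List Δ × List Γ =>
      (q.2.map Sum.inl ++ q.1.map Sum.inr, Fin.elim0)) (Primrec.pair ?_ (Primrec.const _))
    exact Primrec.list_append.comp
      (Primrec.list_map Primrec.snd (Primrec.sumInl.comp Primrec.snd))
      (Primrec.list_map Primrec.fst (Primrec.sumInr.comp Primrec.snd))
  have := h.exists_mem_list.comp
    ((Primrec.wordsUpTo letters).comp (hb.comp Primrec.list_length)) Primrec.id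
  refine this.of_eq fun w => ?_
  simp only [List.mem_wordsUpTo hl.2]
  rfl

/-! ### The size of certificates -/

lemma NWRInstance.n_le_length_encode (x : NWRInstance) : x.n ≤ x.encode.length := by
  simpa [PairLetter.pairWord] using PairLetter.n_le_length x []

/-- Non-empty blocks give `k + 1 ≤ n`, and simplicity gives a path with at most `n` vertices. So
there are at most `2 * n + 1` numbers, each written with at most `n + 1` letters. -/
lemma Certificate.IsValid.length_encode_le {n : ℕ} {c : Certificate (Fin n)}
    {A : TargetArena (Fin n)} {v : Fin n} {W : Set (Fin n)} (h : c.IsValid A v W) :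
    c.encode.length ≤ (2 * n + 1) * (n + 1) := by
  have hk : c.k + 1 ≤ n := by
    simpa using Fintype.card_le_of_surjective _ h.drift.surjective
  have hp : c.path.length ≤ n := by simpa using h.path_ok.simple.length_le_card
  rw [encode_eq, List.length_flatten, List.map_map]
  refine (List.sum_le_card_nsmul _ (n + 1) ?_).trans ?_
  · intro m hm
    obtain ⟨q, hq, rfl⟩ := List.mem_map.1 hm
    rw [toList, List.cons_append, List.mem_cons, List.mem_append, List.mem_ofFn, List.mem_map] at hq
    simp only [Function.comp, unaryWord, List.length_append, List.length_replicate,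
      List.length_singleton]
    rcases hq with rfl | ⟨u, rfl⟩ | ⟨u, -, rfl⟩ <;> omega
  · rw [smul_eq_mul]
    refine Nat.mul_le_mul_right _ ?_
    simp [toList]
    omega

/-! ### The complexity of the never-worse relation -/

lemma notMem_NWRProblem_iff (x : NWRInstance) : x ∉ NWRProblem ↔
    ∃ c : Certificate (Fin x.n), c.IsValid x.arena x.v x.W :=
  ⟨x.arena.exists_certificate_of_not_neverWorse x.VN_nonempty x.W_nonempty,
    fun ⟨_, hc⟩ => x.arena.not_neverWorse_of_certificate x.VN_nonempty hc⟩

/-- Certificates are replaced by arbitrary words of polynomial length, the form that both coNP and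
bounded search require; the formula itself guarantees that an accepted word encodes a certificate.
-/
lemma notMem_NWRProblem_iff_isCertified (x : NWRInstance) : x ∉ NWRProblem ↔
    ∃ y : List (Option Bool), y.length ≤ (2 * x.encode.length + 1) * (x.encode.length + 1) ∧
      PairLetter.IsCertified (x.encode.map Sum.inl ++ y.map Sum.inr) := by
  rw [notMem_NWRProblem_iff]
  constructor
  · rintro ⟨c, hc⟩
    have hn := x.n_le_length_encode
    refine ⟨c.encode, hc.length_encode_le.trans (by gcongr), ?_⟩
    rw [c.encode_eq]
    exact PairLetter.isCertified_toList.2 hc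
  · rintro ⟨y, -, hy⟩
    obtain ⟨l, rfl⟩ := PairLetter.exists_eq_flatten_of_isUnary hy.1
    obtain ⟨c, rfl⟩ := PairLetter.exists_eq_toList hy
    exact ⟨c, PairLetter.isCertified_toList.1 hy⟩

lemma PairLetter.exists_wordFormula :
    ∃ φ : WordFormula PairLetter 0, ∀ w, φ.Eval w Fin.elim0 ↔ IsCertified w := by
  obtain ⟨φ, hφ⟩ := definable_isCertified
  exact ⟨φ, fun w => hφ w _ fun i => i.elim0⟩

lemma decidableProblem_NWRProblem : DecidableProblem NWRInstance.encode NWRProblem := by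
  obtain ⟨φ, hφ⟩ := PairLetter.exists_wordFormula
  have hb : Primrec fun m : ℕ => (2 * m + 1) * (m + 1) :=
    Primrec.nat_mul.comp
      (Primrec.succ.comp (Primrec.nat_mul.comp (Primrec.const 2) Primrec.id)) Primrec.succ
  obtain ⟨_, hf⟩ := (φ.primrecPred_exists_le hb).not
  refine ⟨_, hf.to_comp, fun x => ?_⟩
  rw [decide_eq_true_iff, ← not_iff_not, notMem_NWRProblem_iff_isCertified, not_not]
  simp only [hφ]

lemma inPolyTime_certificateCheck : InPolyTime encodeWithCertificate CertificateCheck := by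
  obtain ⟨φ, hφ⟩ := PairLetter.exists_wordFormula
  refine φ.inPolyTime fun ⟨x, c⟩ => ?_
  rw [hφ, PairLetter.encodeWithCertificate_eq, PairLetter.isCertified_toList]
  rfl

lemma inCoNP_NWRProblem : InCoNP NWRInstance.encode NWRProblem := by
  obtain ⟨φ, hφ⟩ := PairLetter.exists_wordFormula
  refine ⟨Option Bool, inferInstance,
    {a | PairLetter.IsCertified (encodeWithWord NWRInstance.encode a)},
    (2 * .X + 1) * (.X + 1), φ.inPolyTime fun a => (hφ _).symm, fun x => ?_⟩
  rw [Set.mem_compl_iff, notMem_NWRProblem_iff_isCertified]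
  simp only [Polynomial.eval_mul, Polynomial.eval_add, Polynomial.eval_ofNat, Polynomial.eval_X,
    Polynomial.eval_one]
  rfl

end

theorem mainTheorem5 :
    -- deciding whether `v ⊴ W` holds is decidable
    DecidableProblem NWRInstance.encode NWRProblem ∧
    -- and in coNP
    InCoNP NWRInstance.encode NWRProblem ∧
    -- the certificates of non-membership: drift partitions with simple paths
    ((∀ x : NWRInstance, x ∉ NWRProblem ↔
        ∃ c : Certificate (Fin x.n), c.IsValid x.arena x.v x.W) ∧
      (∃ p : Polynomial ℕ, ∀ (x : NWRInstance) (c : Certificate (Fin x.n)),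
        c.IsValid x.arena x.v x.W → c.encode.length ≤ p.eval x.encode.length) ∧
      InPolyTime encodeWithCertificate CertificateCheck) := by
  refine ⟨decidableProblem_NWRProblem, inCoNP_NWRProblem, notMem_NWRProblem_iff,
    ⟨(2 * .X + 1) * (.X + 1), fun x c hc => hc.length_encode_le.trans ?_⟩,
    inPolyTime_certificateCheck⟩
  have hn := x.n_le_length_encode
  simp only [Polynomial.eval_mul, Polynomial.eval_add, Polynomial.eval_ofNat, Polynomial.eval_X,
    Polynomial.eval_one]
  gcongr
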